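/- Let $\gamma:\mathbb R\to[0,\infty)$ be smooth and $1$-periodic. There is a constant $C>0$, depending only on $\gamma$, such that the following holds for every $\varepsilon>0$ with $\varepsilon\max\gamma<1$. Put $$\Omega_\varepsilon=\{x\in\mathbb R^2:\ 0<x_1<1,\ \varepsilon\gamma(x_1/\varepsilon)<x_2<1\},\qquad \Gamma_\varepsilon=\{x:\ 0<x_1<1,\ x_2=\varepsilon\gamma(x_1/\varepsilon)\},$$ $$\Omega_0=(0,1)^2,\qquad \Gamma_0=(0,1)\times\{0\},$$ and for $j\in\{\varepsilon,0\}$ let $V(\Omega_j)$ be the space of all $v\in H^1(\Omega_j)$ whose trace vanishes on $\partial\Omega_j\setminus\Gamma_j$. Let $f\in L^2(\Omega_0)$, let $g:\mathbb R\to\mathbb R$ be smooth and $1$-periodic, and put $g_\varepsilon(x)=g(x_1/\varepsilon)$ and $$r=\int_0^1\sqrt{1+\gamma'(t)^2}\,dt,\qquad \langle g\rangle=\frac1r\int_0^1 g(t)\sqrt{1+\gamma'(t)^2}\,dt .$$ Let $u^\varepsilon\in V(\Omega_\varepsilon)$ be the weak solution of the problem with oscillating flux $g_\varepsilon$ on the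 rough side, $$\int_{\Omega_\varepsilon}\nabla u^\varepsilon\cdot\nabla v\,dx=\int_{\Omega_\varepsilon}f v\,dx+\int_{\Gamma_\varepsilon}g_\varepsilon v\,ds\qquad\text{for all }v\in V(\Omega_\varepsilon),$$ and let $u^0\in V(\Omega_0)$ be the weak solution of the homogenized problem on the flat square with the constant flux $r\langle g\rangle$ on $\Gamma_0$, $$\int_{\Omega_0}\nabla u^0\cdot\nabla v\,dx=\int_{\Omega_0}f v\,dx+\int_{\Gamma_0}r\langle g\rangle\, v\,ds\qquad\text{for all }v\in V(\Omega_0).$$ If $\nabla u^0\in H^1(\Omega_0)^2$, then $$\|\nabla(u^\varepsilon-u^0)\|_{L^2(\Omega_\varepsilon)}\le C\sqrt{\varepsilon}\,\bigl(\|f\|_{L^2(\Omega_0)}+\|\nabla u^0\|_{H^1(\Omega_0)}+\|g_\varepsilon\|_{L^2(\Gamma_\varepsilon)}\bigr).$$ -/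

import Mathlib

open MeasureTheory Set Filter Topology
open scoped ContDiff ENNReal

noncomputable section

namespace RoughNeumann

/-! Points of the plane are pairs `x = (x.1, x.2)` with Lebesgue measure `volume`. Only the topology, the
smooth structure and Lebesgue measure of the plane are used; all Euclidean lengths are written out in
coordinates. -/

/-- The region `{ 0 < x₁ < 1, h(x₁) < x₂ < 1 }` between the graph of `h` and the line `x₂ = 1`. -/
def region (h : ℝ → ℝ) : Set (ℝ × ℝ) :=
  {x | 0 < x.1 ∧ x.1 < 1 ∧ h x.1 < x.2 ∧ x.2 < 1}

/-- Arc length on the bottom side `{ 0 < x₁ < 1, x₂ = h(x₁) }`: `ds = √(1 + h'(x₁)²) dx₁`. -/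
def bottomMeasure (h : ℝ → ℝ) : Measure (ℝ × ℝ) :=
  ((volume.restrict (Ioo (0 : ℝ) 1)).withDensity
    (fun s => ENNReal.ofReal (√(1 + (deriv h s) ^ 2)))).map (fun s => (s, h s))

/-- Arc length on the rest of the boundary of `region h`: the two vertical sides and the top side. -/
def dirichletMeasure (h : ℝ → ℝ) : Measure (ℝ × ℝ) :=
  (volume.restrict (Ioo (h 0) 1)).map (fun t => ((0 : ℝ), t)) +
    (volume.restrict (Ioo (h 1) 1)).map (fun t => ((1 : ℝ), t)) +
    (volume.restrict (Ioo (0 : ℝ) 1)).map (fun s => (s, (1 : ℝ)))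

/-- `v ∈ H¹(D)`, with weak gradient `G = (∂₁v, ∂₂v)`. -/
structure HasH1Grad (D : Set (ℝ × ℝ)) (v : ℝ × ℝ → ℝ) (G : ℝ × ℝ → ℝ × ℝ) : Prop where
  memLp : MemLp v 2 (volume.restrict D)
  memLp_fst : MemLp (fun x => (G x).1) 2 (volume.restrict D)
  memLp_snd : MemLp (fun x => (G x).2) 2 (volume.restrict D)
  weak_fst : ∀ φ : ℝ × ℝ → ℝ, ContDiff ℝ ∞ φ → HasCompactSupport φ → tsupport φ ⊆ D →
    ∫ x in D, v x * fderiv ℝ φ x (1, 0) = -∫ x in D, (G x).1 * φ x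
  weak_snd : ∀ φ : ℝ × ℝ → ℝ, ContDiff ℝ ∞ φ → HasCompactSupport φ → tsupport φ ⊆ D →
    ∫ x in D, v x * fderiv ℝ φ x (0, 1) = -∫ x in D, (G x).2 * φ x

/-- `τ ∈ L²(σ)` is the boundary trace of `v ∈ H¹(D)` (with gradient `G`), where `σ` is arc length on `∂D`:
some functions smooth on the whole plane converge to `v` in `H¹(D)` and to `τ` in `L²(σ)`. On a bounded
Lipschitz domain this is the graph of the usual trace operator `H¹(D) → L²(∂D)`. -/
def IsTrace (D : Set (ℝ × ℝ)) (σ : Measure (ℝ × ℝ)) (v : ℝ × ℝ → ℝ) (G : ℝ × ℝ → ℝ × ℝ)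
    (τ : ℝ × ℝ → ℝ) : Prop :=
  MemLp τ 2 σ ∧ ∃ φ : ℕ → ℝ × ℝ → ℝ, (∀ n, ContDiff ℝ ∞ (φ n)) ∧
    Tendsto (fun n => eLpNorm (fun x => φ n x - v x) 2 (volume.restrict D)) atTop (𝓝 0) ∧
    Tendsto (fun n => eLpNorm (fun x => fderiv ℝ (φ n) x (1, 0) - (G x).1) 2 (volume.restrict D))
      atTop (𝓝 0) ∧
    Tendsto (fun n => eLpNorm (fun x => fderiv ℝ (φ n) x (0, 1) - (G x).2) 2 (volume.restrict D))
      atTop (𝓝 0) ∧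
    Tendsto (fun n => eLpNorm (fun x => φ n x - τ x) 2 σ) atTop (𝓝 0)

/-- `v ∈ V(region h)`: `v ∈ H¹`, and its trace vanishes on the whole boundary except the bottom side. Here `G`
is the weak gradient and `τ` the boundary trace of `v`. -/
structure MemV (h : ℝ → ℝ) (v : ℝ × ℝ → ℝ) (G : ℝ × ℝ → ℝ × ℝ) (τ : ℝ × ℝ → ℝ) : Prop where
  hasH1Grad : HasH1Grad (region h) v G
  isTrace : IsTrace (region h) (bottomMeasure h + dirichletMeasure h) v G τ
  dirichlet : τ =ᵐ[dirichletMeasure h] 0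

/-- `u` (with weak gradient `G`) is the weak solution of `-Δu = f` in `region h`, `∂u/∂n = q` on the bottom
side, `u = 0` on the rest of the boundary. -/
def IsWeakSolution (h : ℝ → ℝ) (f q u : ℝ × ℝ → ℝ) (G : ℝ × ℝ → ℝ × ℝ) : Prop :=
  (∃ τ, MemV h u G τ) ∧
    ∀ (v : ℝ × ℝ → ℝ) (Gv : ℝ × ℝ → ℝ × ℝ) (τv : ℝ × ℝ → ℝ), MemV h v Gv τv →
      ∫ x in region h, ((G x).1 * (Gv x).1 + (G x).2 * (Gv x).2) =
        (∫ x in region h, f x * v x) + ∫ x, q x * τv x ∂(bottomMeasure h)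

/-- The rough profile `x₁ ↦ ε γ(x₁/ε)`. -/
def roughProfile (γ : ℝ → ℝ) (ε : ℝ) : ℝ → ℝ := fun s => ε * γ (s / ε)

/-- The flat profile, so that `region flatProfile` is the open unit square. -/
def flatProfile : ℝ → ℝ := fun _ => 0

/-- The oscillating flux `g_ε(x) = g(x₁/ε)`. -/
def oscFlux (g : ℝ → ℝ) (ε : ℝ) : ℝ × ℝ → ℝ := fun x => g (x.1 / ε)

/-- The length `r` of the graph of `γ` over one period. -/
def periodLength (γ : ℝ → ℝ) : ℝ := ∫ t in (0 : ℝ)..1, √(1 + (deriv γ t) ^ 2)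

/-- The mean `⟨g⟩` of `g` over the graph of `γ` over one period. -/
def fluxMean (γ g : ℝ → ℝ) : ℝ :=
  1 / periodLength γ * ∫ t in (0 : ℝ)..1, g t * √(1 + (deriv γ t) ^ 2)

/-- `‖w‖_{L²(μ)}`, for `w ∈ L²(μ)`. -/
def l2Norm (μ : Measure (ℝ × ℝ)) (w : ℝ × ℝ → ℝ) : ℝ := √(∫ x, (w x) ^ 2 ∂μ)

/-- `‖G‖_{L²(D)}` for a square integrable vector field `G`. -/
def l2NormVec (D : Set (ℝ × ℝ)) (G : ℝ × ℝ → ℝ × ℝ) : ℝ :=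
  √(∫ x in D, ((G x).1 ^ 2 + (G x).2 ^ 2))

/-- `‖G‖_{H¹(D)}` for a vector field `G` whose components have the weak gradients `K₁` and `K₂`. -/
def h1NormVec (D : Set (ℝ × ℝ)) (G K₁ K₂ : ℝ × ℝ → ℝ × ℝ) : ℝ :=
  √(l2NormVec D G ^ 2 + l2NormVec D K₁ ^ 2 + l2NormVec D K₂ ^ 2)

end RoughNeumann

end

/-!
Let `h` be the rough profile `x₁ ↦ ε γ(x₁/ε)`, let `D ⊆ D₀` be the rough domain and the unit square, and
let `M > γ`, so that the layer `D₀ \ D` lies below the height `δ = M ε`. The error `w = uε - u₀` lies in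
`V(D)`. It is extended to the square by reflection across the graph of `h`
(`IsDirichletLimit.exists_extension`); the extension `W` lies in `V(D₀)`, and `‖∇W‖ ≤ C ‖∇w‖` because the
slope of `h` is bounded independently of `ε`. Testing the equation of `uε` with `w` and that of `u₀` with
`W`, and subtracting, yields

`∫_D |∇w|² = -∫_{D₀ \ D} f W + ∫_{D₀ \ D} ∇u₀ · ∇W + (∫_{Γε} g_ε w - ∫_{Γ₀} r⟨g⟩ W)`,

and each of the three terms is at most `C √δ ‖∇W‖` times a norm of the data.

* `W` vanishes on the top side, so on a strip of height `δ` its `L²` norm is at most `C √δ ‖∇W‖`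
  (`IsDirichletLimit.l2Norm_strip_le`).
* `∇u₀` has square integrable weak derivatives, so on the strip its `L²` norm is at most
  `C √δ ‖∇u₀‖_{H¹}` (`strip_le_of_hasH1Grad`). Here nothing but the definition of weak derivatives is
  available; the estimate is obtained by duality, from translates of test functions supported in the strip.
* In the flux term, both integrals are compared with integrals over the horizontal lines at the heights
  `z ∈ (0, δ)`, which costs `∂₂W` on the strip. On such a line the density `g √(1 + γ'²) - r⟨g⟩`, taken at
  `x₁/ε`, is the derivative of `ε P(x₁/ε)` with a bounded periodic function `P`. Integration by parts moves
  the derivative to `W`, and the average over `z` turns the line integrals into an integral over the strip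
  (`abs_graph_integral_sub_le`, `abs_flux_sub_le`).

This settles the case `M ε ≤ 1/4` (`error_le_of_thin`), in which the reflected layer stays inside the
square. For larger `ε` the factor `√ε` is bounded below and the energy estimate suffices
(`error_le_of_thick`).

All estimates are proved for smooth functions on the plane and passed to the limit. `IsDirichletLimit`
records the convergence that is needed for this: convergence in `H¹` to the function, and in `L²` to zero
on the Dirichlet part of the boundary. The traces on the bottom then converge by themselves
(`IsDirichletLimit.exists_memV`). Since the reflection is not smooth, the approximations of `W` use
`√(z² + δ²)` in place of `|z|`.
-/

noncomputable section

namespace RoughNeumann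

/-! ### Square integrable functions -/

section

variable {μ ν : Measure (ℝ × ℝ)} {v w : ℝ × ℝ → ℝ}

theorem l2Norm_nonneg (μ : Measure (ℝ × ℝ)) (w : ℝ × ℝ → ℝ) : 0 ≤ l2Norm μ w :=
  Real.sqrt_nonneg _

theorem sq_l2Norm (μ : Measure (ℝ × ℝ)) (w : ℝ × ℝ → ℝ) : l2Norm μ w ^ 2 = ∫ x, (w x) ^ 2 ∂μ :=
  Real.sq_sqrt (integral_nonneg fun _ => sq_nonneg _)

/-- The `L²` norm of square integrable functions in a general measure space. -/
theorem eLpNorm_two_eq_sqrt {α : Type*} [MeasurableSpace α] {μ : Measure α} {w : α → ℝ}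
    (hw : MemLp w 2 μ) : eLpNorm w 2 μ = ENNReal.ofReal (√(∫ x, (w x) ^ 2 ∂μ)) := by
  rw [hw.eLpNorm_eq_integral_rpow_norm (by norm_num) (by norm_num), Real.sqrt_eq_rpow]
  congr 2
  · refine integral_congr_ae (ae_of_all _ fun x => ?_)
    simp
  · norm_num

theorem eLpNorm_eq_l2Norm (hw : MemLp w 2 μ) : eLpNorm w 2 μ = ENNReal.ofReal (l2Norm μ w) :=
  eLpNorm_two_eq_sqrt hw

theorem l2Norm_eq_toReal (hw : MemLp w 2 μ) : l2Norm μ w = (eLpNorm w 2 μ).toReal := by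
  rw [eLpNorm_eq_l2Norm hw, ENNReal.toReal_ofReal (l2Norm_nonneg _ _)]

theorem l2Norm_mono_measure (hw : MemLp w 2 ν) (h : μ ≤ ν) : l2Norm μ w ≤ l2Norm ν w :=
  Real.sqrt_le_sqrt (integral_mono_measure h (ae_of_all _ fun _ => sq_nonneg _) hw.integrable_sq)

theorem l2Norm_add_le (hv : MemLp v 2 μ) (hw : MemLp w 2 μ) :
    l2Norm μ (fun x => v x + w x) ≤ l2Norm μ v + l2Norm μ w := by
  have := eLpNorm_add_le hv.1 hw.1 (by norm_num : (1 : ℝ≥0∞) ≤ 2)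
  rw [l2Norm_eq_toReal hv, l2Norm_eq_toReal hw,
    l2Norm_eq_toReal (w := fun x => v x + w x) (hv.add hw),
    ← ENNReal.toReal_add hv.2.ne hw.2.ne]
  exact ENNReal.toReal_mono (ENNReal.add_ne_top.2 ⟨hv.2.ne, hw.2.ne⟩) this

/-- The Cauchy-Schwarz inequality. -/
theorem integral_abs_mul_le_sqrt {α : Type*} [MeasurableSpace α] {μ : Measure α} {v w : α → ℝ}
    (hv : MemLp v 2 μ) (hw : MemLp w 2 μ) :
    ∫ x, |v x * w x| ∂μ ≤ √(∫ x, (v x) ^ 2 ∂μ) * √(∫ x, (w x) ^ 2 ∂μ) := by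
  have h2 : (2 : ℝ≥0∞) = ENNReal.ofReal 2 := by norm_num
  have := integral_mul_norm_le_Lp_mul_Lq (μ := μ) (f := v) (g := w) Real.HolderConjugate.two_two
    (h2 ▸ hv) (h2 ▸ hw)
  simpa [abs_mul, Real.sqrt_eq_rpow] using this

theorem abs_integral_mul_le_sqrt {α : Type*} [MeasurableSpace α] {μ : Measure α} {v w : α → ℝ}
    (hv : MemLp v 2 μ) (hw : MemLp w 2 μ) :
    |∫ x, v x * w x ∂μ| ≤ √(∫ x, (v x) ^ 2 ∂μ) * √(∫ x, (w x) ^ 2 ∂μ) :=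
  (abs_integral_le_integral_abs).trans (integral_abs_mul_le_sqrt hv hw)

theorem abs_integral_mul_le (hv : MemLp v 2 μ) (hw : MemLp w 2 μ) :
    |∫ x, v x * w x ∂μ| ≤ l2Norm μ v * l2Norm μ w :=
  abs_integral_mul_le_sqrt hv hw

theorem tendsto_eLpNorm_of_sub {φ : ℕ → ℝ × ℝ → ℝ} (hφ : ∀ n, MemLp (φ n) 2 μ)
    (hv : MemLp v 2 μ) (h : Tendsto (fun n => eLpNorm (fun x => φ n x - v x) 2 μ) atTop (𝓝 0)) :
    Tendsto (fun n => l2Norm μ (φ n)) atTop (𝓝 (l2Norm μ v)) := by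
  have h1 : Tendsto (fun n => (eLpNorm (fun x => φ n x - v x) 2 μ).toReal) atTop (𝓝 0) := by
    exact (ENNReal.tendsto_toReal ENNReal.zero_ne_top).comp h
  rw [tendsto_iff_norm_sub_tendsto_zero]
  refine squeeze_zero (fun _ => norm_nonneg _) (fun n => ?_) h1
  have hd : MemLp (fun x => φ n x - v x) 2 μ := (hφ n).sub hv
  have hd' : MemLp (fun x => v x - φ n x) 2 μ := hv.sub (hφ n)
  have e : l2Norm μ (fun x => v x - φ n x) = l2Norm μ (fun x => φ n x - v x) := by
    simp only [l2Norm, sub_sq_comm]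
  rw [← l2Norm_eq_toReal hd, Real.norm_eq_abs, abs_le]
  have a := l2Norm_add_le hd hv
  have b := l2Norm_add_le hd' (hφ n)
  simp only [sub_add_cancel] at a b
  constructor <;> linarith

theorem tendsto_l2Norm_zero {φ : ℕ → ℝ × ℝ → ℝ} (hφ : ∀ n, MemLp (φ n) 2 μ)
    (h : Tendsto (fun n => eLpNorm (φ n) 2 μ) atTop (𝓝 0)) :
    Tendsto (fun n => l2Norm μ (φ n)) atTop (𝓝 0) := by
  simp_rw [fun n => l2Norm_eq_toReal (hφ n)]
  exact (ENNReal.tendsto_toReal ENNReal.zero_ne_top).comp h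

theorem integrable_mul_of_memLp (hv : MemLp v 2 μ) (hw : MemLp w 2 μ) :
    Integrable (fun x => v x * w x) μ :=
  hv.integrable_mul hw

theorem tendsto_integral_mul {φ : ℕ → ℝ × ℝ → ℝ} (hφ : ∀ n, MemLp (φ n) 2 μ)
    (hv : MemLp v 2 μ) (h : Tendsto (fun n => eLpNorm (fun x => φ n x - v x) 2 μ) atTop (𝓝 0))
    (hw : MemLp w 2 μ) :
    Tendsto (fun n => ∫ x, w x * φ n x ∂μ) atTop (𝓝 (∫ x, w x * v x ∂μ)) := by
  have hd : ∀ n, MemLp (fun x => φ n x - v x) 2 μ := fun n => (hφ n).sub hv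
  have h1 : Tendsto (fun n => l2Norm μ w * l2Norm μ (fun x => φ n x - v x)) atTop (𝓝 0) := by
    simpa using (tendsto_l2Norm_zero hd h).const_mul (l2Norm μ w)
  rw [tendsto_iff_norm_sub_tendsto_zero]
  refine squeeze_zero (fun _ => norm_nonneg _) (fun n => ?_) h1
  refine le_trans (le_of_eq ?_) (abs_integral_mul_le hw (hd n))
  simp only [mul_sub]
  rw [integral_sub (integrable_mul_of_memLp hw (hφ n)) (integrable_mul_of_memLp hw hv),
    Real.norm_eq_abs]

/-- `L²` is complete: a sequence whose differences are dominated by quantities that tend to zero has a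
limit. -/
theorem exists_l2_limit {α : Type*} [MeasurableSpace α] {μ : Measure α} {φ : ℕ → α → ℝ}
    (hφ : ∀ n, MemLp (φ n) 2 μ) (b : ℕ → ℝ) (hb : Tendsto b atTop (𝓝 0))
    (h : ∀ n m, √(∫ x, (φ n x - φ m x) ^ 2 ∂μ) ≤ b n + b m) :
    ∃ τ, MemLp τ 2 μ ∧ Tendsto (fun n => eLpNorm (fun x => φ n x - τ x) 2 μ) atTop (𝓝 0) := by
  have hc : CauchySeq fun n => (hφ n).toLp (φ n) := by
    refine cauchySeq_of_le_tendsto_0' (fun n => |b n| + ⨆ m : {m // n ≤ m}, |b m|) ?_ ?_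
    · intro n m hnm
      have bdd : BddAbove (range fun m : {m // n ≤ m} => |b m|) := by
        refine BddAbove.mono ?_ (hb.abs.bddAbove_range)
        rintro _ ⟨m, rfl⟩
        exact ⟨m, rfl⟩
      have e : dist ((hφ n).toLp (φ n)) ((hφ m).toLp (φ m)) = √(∫ x, (φ n x - φ m x) ^ 2 ∂μ) := by
        rw [dist_eq_norm, ← MemLp.toLp_sub, Lp.norm_toLp, eLpNorm_two_eq_sqrt ((hφ n).sub (hφ m)),
          ENNReal.toReal_ofReal (Real.sqrt_nonneg _)]
        rfl
      rw [e]
      exact (h n m).trans (add_le_add (le_abs_self _)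
        ((le_abs_self _).trans (le_ciSup bdd ⟨m, hnm⟩)))
    · rw [Metric.tendsto_atTop] at hb ⊢
      intro e he
      obtain ⟨N, hN⟩ := hb (e / 3) (by positivity)
      refine ⟨N, fun n hn => ?_⟩
      have h1 : ∀ k ≥ N, |b k| ≤ e / 3 := fun k hk => by
        have := hN k hk
        rw [Real.dist_eq, sub_zero] at this
        exact this.le
      have : (⨆ m : {m // n ≤ m}, |b m|) ≤ e / 3 := by
        have : Nonempty {m // n ≤ m} := ⟨⟨n, le_rfl⟩⟩
        exact ciSup_le fun m => h1 _ (hn.trans m.2)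
      have h0 : 0 ≤ ⨆ m : {m // n ≤ m}, |b m| := Real.iSup_nonneg fun _ => abs_nonneg _
      rw [Real.dist_eq, sub_zero, abs_of_nonneg (by positivity)]
      linarith [h1 n hn]
  obtain ⟨F, hF⟩ := cauchySeq_tendsto_of_complete hc
  refine ⟨F, Lp.memLp F, ?_⟩
  have := (Lp.tendsto_Lp_iff_tendsto_eLpNorm' _ _).1 hF
  refine this.congr fun n => eLpNorm_congr_ae ?_
  filter_upwards [(hφ n).coeFn_toLp] with x hx
  simp [hx]

end

/-! ### The region under a graph: measurability and Fubini -/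

theorem measurableSet_region {h : ℝ → ℝ} (hc : Continuous h) : MeasurableSet (region h) := by
  have h1 : IsOpen (region h) := by
    have e : region h = {x | 0 < x.1} ∩ {x | x.1 < 1} ∩ {x | h x.1 < x.2} ∩ {x | x.2 < 1} := by
      ext x; simp [region, and_assoc]
    rw [e]
    exact (((isOpen_lt (by fun_prop) (by fun_prop)).inter (isOpen_lt (by fun_prop) (by fun_prop))).inter
      (isOpen_lt (by fun_prop) (by fun_prop))).inter (isOpen_lt (by fun_prop) (by fun_prop))
  exact h1.measurableSet

theorem region_subset_square {h : ℝ → ℝ} (h0 : ∀ s, 0 ≤ h s) :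
    region h ⊆ Icc (0 : ℝ) 1 ×ˢ Icc (0 : ℝ) 1 := fun _ hx =>
  ⟨⟨hx.1.le, hx.2.1.le⟩, ⟨(h0 _).trans hx.2.2.1.le, hx.2.2.2.le⟩⟩

theorem region_subset_region_flat {h : ℝ → ℝ} (h0 : ∀ s, 0 ≤ h s) : region h ⊆ region flatProfile :=
  fun _ hx => ⟨hx.1, hx.2.1, (h0 _).trans_lt hx.2.2.1, hx.2.2.2⟩

theorem region_flat : region flatProfile = Ioo (0 : ℝ) 1 ×ˢ Ioo (0 : ℝ) 1 := by
  ext x; simp [region, flatProfile, and_assoc]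

theorem memLp_of_continuous_of_compact {μ : Measure (ℝ × ℝ)} [IsFiniteMeasure μ] {K : Set (ℝ × ℝ)}
    (hK : IsCompact K) (hμ : ∀ᵐ x ∂μ, x ∈ K) {F : ℝ × ℝ → ℝ} (hF : Continuous F) :
    MemLp F 2 μ := by
  obtain ⟨C, hC⟩ := hK.exists_bound_of_continuousOn hF.continuousOn
  exact MemLp.of_bound hF.aestronglyMeasurable C (hμ.mono fun x hx => hC x hx)

theorem isCompact_square : IsCompact (Icc (0 : ℝ) 1 ×ˢ Icc (0 : ℝ) 1) :=
  isCompact_Icc.prod isCompact_Icc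

theorem isFiniteMeasure_region {h : ℝ → ℝ} (h0 : ∀ s, 0 ≤ h s) :
    IsFiniteMeasure (volume.restrict (region h) : Measure (ℝ × ℝ)) :=
  isFiniteMeasure_restrict.2
    ((measure_mono (region_subset_square h0)).trans_lt isCompact_square.measure_lt_top).ne

theorem memLp_region {h : ℝ → ℝ} (hc : Continuous h) (h0 : ∀ s, 0 ≤ h s) {F : ℝ × ℝ → ℝ}
    (hF : Continuous F) : MemLp F 2 (volume.restrict (region h)) := by
  have := isFiniteMeasure_region h0
  refine memLp_of_continuous_of_compact isCompact_square ?_ hF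
  filter_upwards [ae_restrict_mem (measurableSet_region hc)] with x hx using region_subset_square h0 hx

theorem integral_indicator_region (h : ℝ → ℝ) (F : ℝ × ℝ → ℝ) (s : ℝ) :
    ∫ y, (region h).indicator F (s, y) =
      (Ioo (0 : ℝ) 1).indicator (fun s => ∫ y in Ioo (h s) 1, F (s, y)) s := by
  by_cases hs : s ∈ Ioo (0 : ℝ) 1
  · rw [indicator_of_mem hs, ← integral_indicator measurableSet_Ioo]
    refine integral_congr_ae (ae_of_all _ fun y => ?_)
    simp only [indicator, region, mem_ofPred_eq, mem_Ioo]
    simp [hs.1, hs.2]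
  · rw [indicator_of_notMem hs]
    have : ∀ y, (region h).indicator F (s, y) = 0 := fun y =>
      indicator_of_notMem (fun hx => hs ⟨hx.1, hx.2.1⟩) _
    simp [this]

theorem setIntegral_region {h : ℝ → ℝ} (hc : Continuous h) {F : ℝ × ℝ → ℝ}
    (hF : IntegrableOn F (region h)) :
    ∫ x in region h, F x = ∫ s in Ioo (0 : ℝ) 1, ∫ y in Ioo (h s) 1, F (s, y) := by
  rw [← integral_indicator (measurableSet_region hc), ← integral_indicator measurableSet_Ioo,
    Measure.volume_eq_prod, integral_prod]
  · exact integral_congr_ae (ae_of_all _ fun s => integral_indicator_region h F s)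
  · rw [← Measure.volume_eq_prod]
    exact hF.integrable_indicator (measurableSet_region hc)

theorem integrableOn_integral_region {h : ℝ → ℝ} (hc : Continuous h) {F : ℝ × ℝ → ℝ}
    (hF : IntegrableOn F (region h)) :
    IntegrableOn (fun s => ∫ y in Ioo (h s) 1, F (s, y)) (Ioo (0 : ℝ) 1) := by
  rw [← integrable_indicator_iff measurableSet_Ioo]
  have := (hF.integrable_indicator (measurableSet_region hc))
  rw [Measure.volume_eq_prod] at this
  refine this.integral_prod_left.congr (ae_of_all _ fun s => ?_)
  exact integral_indicator_region h F s

/-! ### Boundary measures -/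

theorem isFiniteMeasure_dirichlet (h : ℝ → ℝ) : IsFiniteMeasure (dirichletMeasure h) := by
  unfold dirichletMeasure; infer_instance

theorem ae_dirichlet_mem {h : ℝ → ℝ} {p : ℝ × ℝ → Prop}
    (hp : MeasurableSet {x | p x})
    (h1 : ∀ t ∈ Ioo (h 0) 1, p (0, t)) (h2 : ∀ t ∈ Ioo (h 1) 1, p (1, t))
    (h3 : ∀ s ∈ Ioo (0 : ℝ) 1, p (s, 1)) : ∀ᵐ x ∂dirichletMeasure h, p x := by
  unfold dirichletMeasure
  rw [ae_add_measure_iff, ae_add_measure_iff]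
  refine ⟨⟨?_, ?_⟩, ?_⟩ <;> rw [ae_map_iff (by fun_prop) hp] <;>
    filter_upwards [ae_restrict_mem measurableSet_Ioo] with t ht
  exacts [h1 t ht, h2 t ht, h3 t ht]

theorem memLp_dirichlet {h : ℝ → ℝ} (h0 : ∀ s, 0 ≤ h s) {F : ℝ × ℝ → ℝ}
    (hF : Continuous F) : MemLp F 2 (dirichletMeasure h) := by
  have := isFiniteMeasure_dirichlet h
  refine memLp_of_continuous_of_compact isCompact_square
    (ae_dirichlet_mem (isCompact_square.measurableSet) ?_ ?_ ?_) hF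
  · exact fun t ht => ⟨by simp, (h0 0).trans ht.1.le, ht.2.le⟩
  · exact fun t ht => ⟨by simp, (h0 1).trans ht.1.le, ht.2.le⟩
  · exact fun t ht => ⟨⟨ht.1.le, ht.2.le⟩, by simp⟩

theorem dirichletMeasure_le_flat {h : ℝ → ℝ} (h0 : ∀ s, 0 ≤ h s) :
    dirichletMeasure h ≤ dirichletMeasure flatProfile := by
  unfold dirichletMeasure
  refine add_le_add (add_le_add ?_ ?_) le_rfl <;>
  exact Measure.map_mono (Measure.restrict_mono (Ioo_subset_Ioo_left (h0 _)) le_rfl) (by fun_prop)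

theorem setIntegral_top_le {h : ℝ → ℝ} (h0 : ∀ s, 0 ≤ h s) {F : ℝ × ℝ → ℝ} (hF : Continuous F) :
    ∫ s in Ioo (0 : ℝ) 1, F (s, 1) ^ 2 ≤ l2Norm (dirichletMeasure h) F ^ 2 := by
  rw [sq_l2Norm]
  have : ∫ s in Ioo (0 : ℝ) 1, F (s, 1) ^ 2 =
      ∫ x, F x ^ 2 ∂((volume.restrict (Ioo (0 : ℝ) 1)).map (fun s => (s, (1 : ℝ)))) := by
    rw [integral_map (by fun_prop) (by fun_prop)]
  rw [this]
  refine integral_mono_measure ?_ (ae_of_all _ fun _ => sq_nonneg _) (memLp_dirichlet h0 hF).integrable_sq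
  exact Measure.le_add_left le_rfl

theorem setIntegral_sides_le {h : ℝ → ℝ} (h0 : ∀ s, 0 ≤ h s) {F : ℝ × ℝ → ℝ} (hF : Continuous F) :
    (∫ t in Ioo (h 0) 1, F (0, t) ^ 2 ≤ l2Norm (dirichletMeasure h) F ^ 2) ∧
    ∫ t in Ioo (h 1) 1, F (1, t) ^ 2 ≤ l2Norm (dirichletMeasure h) F ^ 2 := by
  have e : ∀ i a : ℝ, ∫ t in Ioo a 1, F (i, t) ^ 2 =
      ∫ x, F x ^ 2 ∂((volume.restrict (Ioo a 1)).map (fun t => (i, t))) := fun i a => by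
    rw [integral_map (by fun_prop) (by fun_prop)]
  rw [sq_l2Norm, e, e]
  constructor
  · refine integral_mono_measure ?_ (ae_of_all _ fun _ => sq_nonneg _)
      (memLp_dirichlet h0 hF).integrable_sq
    exact Measure.le_add_right (Measure.le_add_right le_rfl)
  · refine integral_mono_measure ?_ (ae_of_all _ fun _ => sq_nonneg _)
      (memLp_dirichlet h0 hF).integrable_sq
    exact Measure.le_add_right (Measure.le_add_left le_rfl)

theorem measurable_lengthDensity (h : ℝ → ℝ) :
    Measurable fun s => ENNReal.ofReal (√(1 + (deriv h s) ^ 2)) := by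
  have := measurable_deriv h
  fun_prop

theorem measurableEmbedding_graph {h : ℝ → ℝ} (hc : Continuous h) :
    MeasurableEmbedding fun s : ℝ => (s, h s) :=
  (Function.LeftInverse.isClosedEmbedding (f := Prod.fst) (fun _ => rfl) continuous_fst
    (by fun_prop)).measurableEmbedding

theorem integral_bottom {h : ℝ → ℝ} (hc : Continuous h) (F : ℝ × ℝ → ℝ) :
    ∫ x, F x ∂bottomMeasure h = ∫ s in Ioo (0 : ℝ) 1, √(1 + (deriv h s) ^ 2) * F (s, h s) := by
  unfold bottomMeasure
  rw [(measurableEmbedding_graph hc).integral_map,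
    integral_withDensity_eq_integral_toReal_smul (measurable_lengthDensity h)
      (ae_of_all _ fun _ => ENNReal.ofReal_lt_top)]
  refine integral_congr_ae (ae_of_all _ fun s => ?_)
  simp [ENNReal.toReal_ofReal (Real.sqrt_nonneg _)]

theorem sqrt_one_add_sq_le {a L : ℝ} (h : |a| ≤ L) : √(1 + a ^ 2) ≤ 1 + L := by
  have : 0 ≤ L := (abs_nonneg _).trans h
  rw [Real.sqrt_le_left (by linarith)]
  nlinarith [sq_abs a, abs_nonneg a]

/-- Arc length on the graph is comparable to the image of Lebesgue measure when the slope is bounded. -/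
theorem bottomMeasure_le {h : ℝ → ℝ} {L : ℝ} (hL : ∀ s, |deriv h s| ≤ L) (hc : Continuous h) :
    bottomMeasure h ≤ ENNReal.ofReal (1 + L) •
      (volume.restrict (Ioo (0 : ℝ) 1)).map (fun s => (s, h s)) := by
  unfold bottomMeasure
  rw [← Measure.map_smul]
  refine Measure.map_mono ?_ (by fun_prop)
  rw [← withDensity_const]
  exact withDensity_mono (ae_of_all _ fun s => ENNReal.ofReal_le_ofReal (sqrt_one_add_sq_le (hL s)))

theorem isFiniteMeasure_bottom {h : ℝ → ℝ} {L : ℝ} (hL : ∀ s, |deriv h s| ≤ L) (hc : Continuous h) :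
    IsFiniteMeasure (bottomMeasure h) := by
  have : IsFiniteMeasure (ENNReal.ofReal (1 + L) •
      (volume.restrict (Ioo (0 : ℝ) 1)).map (fun s => (s, h s))) :=
    Measure.smul_finite _ ENNReal.ofReal_ne_top
  exact isFiniteMeasure_of_le _ (bottomMeasure_le hL hc)

theorem ae_bottom {h : ℝ → ℝ} {L : ℝ} (hL : ∀ s, |deriv h s| ≤ L) (hc : Continuous h)
    {p : ℝ × ℝ → Prop} (h1 : ∀ᵐ s ∂volume.restrict (Ioo (0 : ℝ) 1), p (s, h s)) :
    ∀ᵐ x ∂bottomMeasure h, p x := by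
  have : ∀ᵐ x ∂(volume.restrict (Ioo (0 : ℝ) 1)).map (fun s => (s, h s)), p x := by
    rwa [(measurableEmbedding_graph hc).ae_map_iff]
  exact (Measure.absolutelyContinuous_of_le_smul (bottomMeasure_le hL hc)).ae_le this

theorem memLp_bottom {h : ℝ → ℝ} {L : ℝ} (hL : ∀ s, |deriv h s| ≤ L) (hc : Continuous h)
    (h0 : ∀ s, 0 ≤ h s) (h1 : ∀ s, h s ≤ 1) {F : ℝ × ℝ → ℝ}
    (hF : Continuous F) : MemLp F 2 (bottomMeasure h) := by
  have := isFiniteMeasure_bottom hL hc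
  refine memLp_of_continuous_of_compact isCompact_square (ae_bottom hL hc ?_) hF
  filter_upwards [ae_restrict_mem measurableSet_Ioo] with s hs
  exact ⟨⟨hs.1.le, hs.2.le⟩, h0 s, h1 s⟩

theorem sq_l2Norm_bottom_le {h : ℝ → ℝ} {L : ℝ} (hL : ∀ s, |deriv h s| ≤ L) (hc : Continuous h)
    {F : ℝ × ℝ → ℝ} (hF : Continuous F) :
    l2Norm (bottomMeasure h) F ^ 2 ≤ (1 + L) * ∫ s in Ioo (0 : ℝ) 1, F (s, h s) ^ 2 := by
  rw [sq_l2Norm, integral_bottom hc, ← integral_const_mul]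
  have hi : IntegrableOn (fun s => F (s, h s) ^ 2) (Ioo (0 : ℝ) 1) :=
    (Continuous.integrableOn_Icc (by fun_prop)).mono_set Ioo_subset_Icc_self
  refine integral_mono_of_nonneg (ae_of_all _ fun s => by positivity) (hi.const_mul _)
    (ae_of_all _ fun s => ?_)
  exact mul_le_mul_of_nonneg_right (sqrt_one_add_sq_le (hL s)) (sq_nonneg _)

/-! ### Trace and Poincaré inequalities for smooth functions -/

theorem continuous_fderiv_apply {φ : ℝ × ℝ → ℝ} (hφ : ContDiff ℝ ∞ φ) (e : ℝ × ℝ) :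
    Continuous fun x => fderiv ℝ φ x e :=
  (hφ.continuous_fderiv (by simp)).clm_apply continuous_const

theorem hasDerivAt_snd {φ : ℝ × ℝ → ℝ} (hφ : ContDiff ℝ ∞ φ) (s y : ℝ) :
    HasDerivAt (fun y => φ (s, y)) (fderiv ℝ φ (s, y) (0, 1)) y := by
  have h1 : HasFDerivAt φ (fderiv ℝ φ (s, y)) (s, y) :=
    (hφ.differentiable (by simp) _).hasFDerivAt
  exact h1.comp_hasDerivAt y ((hasDerivAt_const y s).prodMk (hasDerivAt_id y))

theorem hasDerivAt_fst {φ : ℝ × ℝ → ℝ} (hφ : ContDiff ℝ ∞ φ) (s y : ℝ) :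
    HasDerivAt (fun s => φ (s, y)) (fderiv ℝ φ (s, y) (1, 0)) s := by
  have h1 : HasFDerivAt φ (fderiv ℝ φ (s, y)) (s, y) :=
    (hφ.differentiable (by simp) _).hasFDerivAt
  exact h1.comp_hasDerivAt s ((hasDerivAt_id s).prodMk (hasDerivAt_const s y))

theorem memLp_Ioo {f : ℝ → ℝ} (hf : Continuous f) (a b : ℝ) :
    MemLp f 2 (volume.restrict (Ioo a b)) := by
  obtain ⟨C, hC⟩ := (isCompact_Icc (a := a) (b := b)).exists_bound_of_continuousOn hf.continuousOn
  refine MemLp.of_bound hf.aestronglyMeasurable C ?_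
  filter_upwards [ae_restrict_mem measurableSet_Ioo] with x hx using hC x (Ioo_subset_Icc_self hx)

theorem sq_integral_abs_le {f : ℝ → ℝ} {a b : ℝ} (hf : MemLp f 2 (volume.restrict (Ioo a b)))
    (hab : a ≤ b) :
    (∫ y in Ioo a b, |f y|) ^ 2 ≤ (b - a) * ∫ y in Ioo a b, f y ^ 2 := by
  have h := integral_abs_mul_le_sqrt (memLp_Ioo (continuous_const (y := (1 : ℝ))) a b) hf
  simp only [one_mul, one_pow, integral_const, smul_eq_mul, mul_one, measureReal_restrict_apply_univ,
    Real.volume_real_Ioo_of_le hab] at h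
  have h0 : 0 ≤ ∫ y in Ioo a b, |f y| := integral_nonneg fun _ => abs_nonneg _
  calc _ ≤ (√(b - a) * √(∫ y in Ioo a b, f y ^ 2)) ^ 2 := pow_le_pow_left₀ h0 h 2
    _ = _ := by
      rw [mul_pow, Real.sq_sqrt (sub_nonneg.2 hab), Real.sq_sqrt (integral_nonneg fun _ => sq_nonneg _)]

theorem abs_sub_le_integral_deriv {f f' : ℝ → ℝ} (hf : ∀ y, HasDerivAt f (f' y) y)
    (hf' : Continuous f') {a b x y : ℝ} (hx : x ∈ Icc a b) (hy : y ∈ Icc a b) :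
    |f x - f y| ≤ ∫ t in Ioo a b, |f' t| := by
  rw [← intervalIntegral.integral_eq_sub_of_hasDerivAt (fun t _ => hf t)
    (hf'.intervalIntegrable y x), ← Real.norm_eq_abs]
  refine (intervalIntegral.norm_integral_le_integral_norm_uIoc).trans ?_
  simp only [Real.norm_eq_abs]
  rw [← integral_Icc_eq_integral_Ioo]
  refine setIntegral_mono_set ?_ (ae_of_all _ fun _ => abs_nonneg _) (LE.le.eventuallyLE ?_)
  · exact (Continuous.integrableOn_Icc (by fun_prop))
  · exact uIoc_subset_uIcc.trans (uIcc_subset_Icc hy hx)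

/-- The elementary one-dimensional estimate behind all trace inequalities: a value is controlled by the
value at `1` and the derivative. -/
theorem sq_le_two_mul {f f' : ℝ → ℝ} (hf : ∀ y, HasDerivAt f (f' y) y) (hf' : Continuous f')
    {a b : ℝ} (hb : 0 ≤ b) (hba : b ≤ a) (ha : a ≤ 1) :
    f a ^ 2 ≤ 2 * f 1 ^ 2 + 2 * ∫ t in Ioo b 1, f' t ^ 2 := by
  have h1 := abs_sub_le_integral_deriv hf hf' (a := b) (b := 1) ⟨hba, ha⟩ ⟨hba.trans ha, le_rfl⟩
  have h2 := sq_integral_abs_le (memLp_Ioo hf' b 1) (hba.trans ha)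
  have h3 : 0 ≤ ∫ y in Ioo b 1, f' y ^ 2 := integral_nonneg fun _ => sq_nonneg _
  have h4 : (f a - f 1) ^ 2 ≤ ∫ y in Ioo b 1, f' y ^ 2 := by
    rw [← sq_abs]
    nlinarith [pow_le_pow_left₀ (abs_nonneg _) h1 2]
  nlinarith [sq_nonneg (f a - 2 * f 1)]

/-- The trace inequality on any graph inside the region. -/
theorem trace_le {h : ℝ → ℝ} (hc : Continuous h) (h0 : ∀ s, 0 ≤ h s) {φ : ℝ × ℝ → ℝ}
    (hφ : ContDiff ℝ ∞ φ) {k : ℝ → ℝ} (hk : ∀ s ∈ Ioo (0 : ℝ) 1, h s ≤ k s) (hk1 : ∀ s, k s ≤ 1) :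
    ∫ s in Ioo (0 : ℝ) 1, φ (s, k s) ^ 2 ≤ 2 * l2Norm (dirichletMeasure h) φ ^ 2 +
      2 * l2Norm (volume.restrict (region h)) (fun x => fderiv ℝ φ x (0, 1)) ^ 2 := by
  have hd := continuous_fderiv_apply hφ (0, 1)
  have hi := (memLp_region hc h0 hd).integrable_sq
  have hcφ := hφ.continuous
  have h1 : IntegrableOn (fun s => φ (s, 1) ^ 2) (Ioo (0 : ℝ) 1) :=
    (Continuous.integrableOn_Icc (by fun_prop)).mono_set Ioo_subset_Icc_self
  have h2 := integrableOn_integral_region hc hi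
  calc ∫ s in Ioo (0 : ℝ) 1, φ (s, k s) ^ 2
      ≤ ∫ s in Ioo (0 : ℝ) 1, (2 * φ (s, 1) ^ 2 +
        2 * ∫ y in Ioo (h s) 1, fderiv ℝ φ (s, y) (0, 1) ^ 2) := by
        refine integral_mono_of_nonneg (ae_of_all _ fun _ => sq_nonneg _)
          ((h1.const_mul 2).add (h2.const_mul 2)) ?_
        filter_upwards [ae_restrict_mem measurableSet_Ioo] with s hs
        exact sq_le_two_mul (hasDerivAt_snd hφ s) (by fun_prop) (h0 s) (hk s hs) (hk1 s)
    _ = 2 * (∫ s in Ioo (0 : ℝ) 1, φ (s, 1) ^ 2) + 2 * ∫ x in region h, fderiv ℝ φ x (0, 1) ^ 2 := by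
        rw [integral_add (h1.const_mul 2) (h2.const_mul 2), integral_const_mul, integral_const_mul,
          setIntegral_region hc hi]
    _ ≤ _ := by
        rw [sq_l2Norm (volume.restrict (region h))]
        gcongr
        exact setIntegral_top_le h0 hcφ

/-- A function with small Dirichlet data is small in a strip above the line `x₂ = 0`, in the mean; for
`δ = 1` this is Poincaré's inequality. -/
theorem strip_le {h : ℝ → ℝ} (hc : Continuous h) (h0 : ∀ s, 0 ≤ h s) {φ : ℝ × ℝ → ℝ}
    (hφ : ContDiff ℝ ∞ φ) {δ : ℝ} (hδ : 0 ≤ δ) :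
    ∫ x in region h ∩ {x | x.2 < δ}, φ x ^ 2 ≤ δ * (2 * l2Norm (dirichletMeasure h) φ ^ 2 +
      2 * l2Norm (volume.restrict (region h)) (fun x => fderiv ℝ φ x (0, 1)) ^ 2) := by
  have hd := continuous_fderiv_apply hφ (0, 1)
  have hi := (memLp_region hc h0 hd).integrable_sq
  have hcφ := hφ.continuous
  have hm : MeasurableSet {x : ℝ × ℝ | x.2 < δ} := measurableSet_lt (by fun_prop) (by fun_prop)
  have h1 : IntegrableOn (fun s => φ (s, 1) ^ 2) (Ioo (0 : ℝ) 1) :=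
    (Continuous.integrableOn_Icc (by fun_prop)).mono_set Ioo_subset_Icc_self
  have h2 := integrableOn_integral_region hc hi
  have h3 : IntegrableOn ({x : ℝ × ℝ | x.2 < δ}.indicator fun x => φ x ^ 2) (region h) :=
    (memLp_region hc h0 hcφ).integrable_sq.indicator hm
  rw [inter_comm, ← Measure.restrict_restrict hm, ← integral_indicator hm, setIntegral_region hc h3]
  calc _ ≤ ∫ s in Ioo (0 : ℝ) 1, δ * (2 * φ (s, 1) ^ 2 +
        2 * ∫ y in Ioo (h s) 1, fderiv ℝ φ (s, y) (0, 1) ^ 2) := by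
        refine integral_mono_of_nonneg (ae_of_all _ fun _ => integral_nonneg fun _ =>
          indicator_nonneg (fun _ _ => sq_nonneg _) _)
          (((h1.const_mul 2).add (h2.const_mul 2)).const_mul δ) (ae_of_all _ fun s => ?_)
        set A := 2 * φ (s, 1) ^ 2 + 2 * ∫ y in Ioo (h s) 1, fderiv ℝ φ (s, y) (0, 1) ^ 2 with hA
        have hA0 : 0 ≤ A := by
          have : 0 ≤ ∫ y in Ioo (h s) 1, fderiv ℝ φ (s, y) (0, 1) ^ 2 :=
            integral_nonneg fun _ => sq_nonneg _
          positivity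
        calc ∫ y in Ioo (h s) 1, {x : ℝ × ℝ | x.2 < δ}.indicator (fun x => φ x ^ 2) (s, y)
            ≤ ∫ y in Ioo (h s) 1, (Ioo 0 δ).indicator (fun _ => A) y := by
              refine integral_mono_of_nonneg (ae_of_all _ fun _ =>
                indicator_nonneg (fun _ _ => sq_nonneg _) _) ?_ ?_
              · exact (integrable_const A).indicator measurableSet_Ioo
              · filter_upwards [ae_restrict_mem measurableSet_Ioo] with y hy
                by_cases hyδ : y < δ
                · rw [indicator_of_mem (show (s, y) ∈ {x : ℝ × ℝ | x.2 < δ} from hyδ),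
                    indicator_of_mem (show y ∈ Ioo 0 δ from ⟨(h0 s).trans_lt hy.1, hyδ⟩)]
                  exact sq_le_two_mul (hasDerivAt_snd hφ s) (by fun_prop) (h0 s) hy.1.le hy.2.le
                · rw [indicator_of_notMem (show (s, y) ∉ {x : ℝ × ℝ | x.2 < δ} from hyδ)]
                  exact indicator_nonneg (fun _ _ => hA0) _
          _ ≤ ∫ y, (Ioo 0 δ).indicator (fun _ => A) y := by
              refine setIntegral_le_integral ?_ (ae_of_all _ fun _ =>
                indicator_nonneg (fun _ _ => hA0) _)
              exact (integrable_indicator_iff measurableSet_Ioo).2 (integrable_const A)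
          _ = δ * A := by
              rw [integral_indicator measurableSet_Ioo]
              simp [hδ]
    _ = δ * (2 * (∫ s in Ioo (0 : ℝ) 1, φ (s, 1) ^ 2) +
          2 * ∫ x in region h, fderiv ℝ φ x (0, 1) ^ 2) := by
        rw [integral_const_mul, integral_add (h1.const_mul 2) (h2.const_mul 2), integral_const_mul,
          integral_const_mul, setIntegral_region hc hi]
    _ ≤ _ := by
        rw [sq_l2Norm (volume.restrict (region h))]
        gcongr
        exact setIntegral_top_le h0 hcφ

/-! ### Limits of smooth functions with vanishing Dirichlet data -/

/-- `v` and `G` are the `L²` limits of the smooth functions `φ n` and of their gradients, and the boundary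
values of `φ n` on the sides and the top tend to zero. In contrast to `MemV`, nothing is said about the
bottom, where convergence of the traces is automatic. -/
structure IsDirichletLimit (h : ℝ → ℝ) (v : ℝ × ℝ → ℝ) (G : ℝ × ℝ → ℝ × ℝ)
    (φ : ℕ → ℝ × ℝ → ℝ) : Prop where
  smooth : ∀ n, ContDiff ℝ ∞ (φ n)
  memLp : MemLp v 2 (volume.restrict (region h))
  memLp_fst : MemLp (fun x => (G x).1) 2 (volume.restrict (region h))
  memLp_snd : MemLp (fun x => (G x).2) 2 (volume.restrict (region h))
  tendsto : Tendsto (fun n => eLpNorm (fun x => φ n x - v x) 2 (volume.restrict (region h)))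
    atTop (𝓝 0)
  tendsto_fst : Tendsto (fun n => eLpNorm (fun x => fderiv ℝ (φ n) x (1, 0) - (G x).1) 2
    (volume.restrict (region h))) atTop (𝓝 0)
  tendsto_snd : Tendsto (fun n => eLpNorm (fun x => fderiv ℝ (φ n) x (0, 1) - (G x).2) 2
    (volume.restrict (region h))) atTop (𝓝 0)
  tendsto_dirichlet : Tendsto (fun n => eLpNorm (φ n) 2 (dirichletMeasure h)) atTop (𝓝 0)

theorem tendsto_zero_of_le_add {a b c : ℕ → ℝ≥0∞} (hb : Tendsto b atTop (𝓝 0))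
    (hc : Tendsto c atTop (𝓝 0)) (h : ∀ n, a n ≤ b n + c n) : Tendsto a atTop (𝓝 0) :=
  tendsto_of_tendsto_of_tendsto_of_le_of_le tendsto_const_nhds
    (by simpa using hb.add hc) (fun _ => zero_le) h

theorem tendsto_zero_of_le {a b : ℕ → ℝ≥0∞} (hb : Tendsto b atTop (𝓝 0))
    (h : ∀ n, a n ≤ b n) : Tendsto a atTop (𝓝 0) :=
  tendsto_of_tendsto_of_tendsto_of_le_of_le tendsto_const_nhds hb (fun _ => zero_le) h

theorem MemV.exists_isDirichletLimit {h : ℝ → ℝ} {v : ℝ × ℝ → ℝ} {G : ℝ × ℝ → ℝ × ℝ}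
    {τ : ℝ × ℝ → ℝ} (hv : MemV h v G τ) : ∃ φ, IsDirichletLimit h v G φ ∧
      Tendsto (fun n => eLpNorm (fun x => φ n x - τ x) 2 (bottomMeasure h)) atTop (𝓝 0) := by
  obtain ⟨⟨hm, h1, h2, -, -⟩, ⟨hτ, φ, hs, a, b, c, d⟩, hd⟩ := hv
  refine ⟨φ, ⟨hs, hm, h1, h2, a, b, c, ?_⟩, ?_⟩
  · refine tendsto_zero_of_le d fun n => ?_
    refine le_trans (le_of_eq (eLpNorm_congr_ae ?_))
      (eLpNorm_mono_measure _ (Measure.le_add_left le_rfl))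
    filter_upwards [hd] with x hx
    simp [hx]
  · exact tendsto_zero_of_le d fun n => eLpNorm_mono_measure _ (Measure.le_add_right le_rfl)

/-- Integration by parts for a smooth function against a test function. -/
theorem setIntegral_mul_fderiv {D : Set (ℝ × ℝ)} {φ χ : ℝ × ℝ → ℝ} (hφ : ContDiff ℝ ∞ φ)
    (hχ : ContDiff ℝ ∞ χ) (hs : HasCompactSupport χ) (hD : tsupport χ ⊆ D) (e : ℝ × ℝ) :
    ∫ x in D, φ x * fderiv ℝ χ x e = -∫ x in D, fderiv ℝ φ x e * χ x := by
  have hd : HasCompactSupport fun x => fderiv ℝ χ x e := hs.fderiv_apply ℝ e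
  have hc := continuous_fderiv_apply hχ e
  have hc' := continuous_fderiv_apply hφ e
  have z : ∀ x ∉ D, χ x = 0 := fun x hx => image_eq_zero_of_notMem_tsupport fun h => hx (hD h)
  have z' : ∀ x ∉ D, fderiv ℝ χ x e = 0 := fun x hx => by
    have : x ∉ tsupport (fderiv ℝ χ) := fun h => hx (hD (tsupport_fderiv_subset ℝ h))
    simp [image_eq_zero_of_notMem_tsupport this]
  rw [setIntegral_eq_integral_of_forall_compl_eq_zero (fun x hx => by simp [z' x hx]),
    setIntegral_eq_integral_of_forall_compl_eq_zero (fun x hx => by simp [z x hx])]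
  exact integral_mul_fderiv_eq_neg_fderiv_mul_of_integrable
    ((hc'.mul hχ.continuous).integrable_of_hasCompactSupport hs.mul_left)
    ((hφ.continuous.mul hc).integrable_of_hasCompactSupport hd.mul_left)
    ((hφ.continuous.mul hχ.continuous).integrable_of_hasCompactSupport hs.mul_left)
    (fun x _ => hφ.differentiable (by simp) x) (fun x _ => hχ.differentiable (by simp) x)

theorem weak_of_tendsto {h : ℝ → ℝ} (hc : Continuous h) (h0 : ∀ s, 0 ≤ h s) {e : ℝ × ℝ}
    {v g : ℝ × ℝ → ℝ} {φ : ℕ → ℝ × ℝ → ℝ} (hφ : ∀ n, ContDiff ℝ ∞ (φ n))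
    (hv : MemLp v 2 (volume.restrict (region h))) (hg : MemLp g 2 (volume.restrict (region h)))
    (h1 : Tendsto (fun n => eLpNorm (fun x => φ n x - v x) 2 (volume.restrict (region h)))
      atTop (𝓝 0))
    (h2 : Tendsto (fun n => eLpNorm (fun x => fderiv ℝ (φ n) x e - g x) 2
      (volume.restrict (region h))) atTop (𝓝 0))
    (χ : ℝ × ℝ → ℝ) (hχ : ContDiff ℝ ∞ χ) (hs : HasCompactSupport χ) (hD : tsupport χ ⊆ region h) :
    ∫ x in region h, v x * fderiv ℝ χ x e = -∫ x in region h, g x * χ x := by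
  have a := tendsto_integral_mul (fun n => memLp_region hc h0 (hφ n).continuous) hv h1
    (memLp_region hc h0 (continuous_fderiv_apply hχ e))
  have b := (tendsto_integral_mul (fun n => memLp_region hc h0 (continuous_fderiv_apply (hφ n) e))
    hg h2 (memLp_region hc h0 hχ.continuous)).neg
  have := tendsto_nhds_unique a (b.congr fun n => ?_)
  · simpa only [mul_comm] using this
  · simpa only [mul_comm] using (setIntegral_mul_fderiv (hφ n) hχ hs hD e).symm

theorem IsDirichletLimit.hasH1Grad {h : ℝ → ℝ} (hc : Continuous h) (h0 : ∀ s, 0 ≤ h s)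
    {v : ℝ × ℝ → ℝ} {G : ℝ × ℝ → ℝ × ℝ} {φ : ℕ → ℝ × ℝ → ℝ} (H : IsDirichletLimit h v G φ) :
    HasH1Grad (region h) v G where
  memLp := H.memLp
  memLp_fst := H.memLp_fst
  memLp_snd := H.memLp_snd
  weak_fst := weak_of_tendsto hc h0 H.smooth H.memLp H.memLp_fst H.tendsto H.tendsto_fst
  weak_snd := weak_of_tendsto hc h0 H.smooth H.memLp H.memLp_snd H.tendsto H.tendsto_snd

theorem eLpNorm_add_measure_le (f : ℝ × ℝ → ℝ) (μ ν : Measure (ℝ × ℝ)) :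
    eLpNorm f 2 (μ + ν) ≤ eLpNorm f 2 μ + eLpNorm f 2 ν := by
  simp only [eLpNorm_eq_lintegral_rpow_enorm_toReal (p := 2) (by norm_num) (by norm_num),
    lintegral_add_measure]
  exact ENNReal.rpow_add_le_add_rpow _ _ (by norm_num) (by norm_num)

theorem fderiv_sub_apply {φ ψ : ℝ × ℝ → ℝ} (hφ : ContDiff ℝ ∞ φ) (hψ : ContDiff ℝ ∞ ψ)
    (x e : ℝ × ℝ) : fderiv ℝ (fun x => φ x - ψ x) x e = fderiv ℝ φ x e - fderiv ℝ ψ x e := by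
  rw [fderiv_fun_sub (hφ.differentiable (by simp) x) (hψ.differentiable (by simp) x)]
  rfl

theorem IsDirichletLimit.tendsto_l2Norm_dirichlet {h : ℝ → ℝ} (h0 : ∀ s, 0 ≤ h s)
    {v : ℝ × ℝ → ℝ} {G : ℝ × ℝ → ℝ × ℝ} {φ : ℕ → ℝ × ℝ → ℝ} (H : IsDirichletLimit h v G φ) :
    Tendsto (fun n => l2Norm (dirichletMeasure h) (φ n)) atTop (𝓝 0) :=
  tendsto_l2Norm_zero (fun n => memLp_dirichlet h0 (H.smooth n).continuous) H.tendsto_dirichlet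

/-- The traces on the bottom side converge because, by the trace inequality, they form a Cauchy
sequence. -/
theorem IsDirichletLimit.exists_memV {h : ℝ → ℝ} (hc : Continuous h) (h0 : ∀ s, 0 ≤ h s)
    (h1 : ∀ s, h s < 1) {L : ℝ} (hL : ∀ s, |deriv h s| ≤ L)
    {v : ℝ × ℝ → ℝ} {G : ℝ × ℝ → ℝ × ℝ} {φ : ℕ → ℝ × ℝ → ℝ} (H : IsDirichletLimit h v G φ) :
    ∃ τ, MemV h v G τ ∧ MemLp τ 2 (bottomMeasure h) ∧
      Tendsto (fun n => eLpNorm (fun x => φ n x - τ x) 2 (bottomMeasure h)) atTop (𝓝 0) := by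
  have hcφ : ∀ n, Continuous (φ n) := fun n => (H.smooth n).continuous
  have hdc : ∀ n, Continuous fun x => fderiv ℝ (φ n) x (0, 1) := fun n =>
    continuous_fderiv_apply (H.smooth n) _
  have hmd : ∀ n, MemLp (fun x => fderiv ℝ (φ n) x (0, 1) - (G x).2) 2
      (volume.restrict (region h)) := fun n => (memLp_region hc h0 (hdc n)).sub H.memLp_snd
  have hme := measurableEmbedding_graph hc
  let b : ℕ → ℝ := fun n => 2 * (l2Norm (dirichletMeasure h) (φ n) +
    l2Norm (volume.restrict (region h)) (fun x => fderiv ℝ (φ n) x (0, 1) - (G x).2))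
  have hb : Tendsto b atTop (𝓝 0) := by
    simpa using ((H.tendsto_l2Norm_dirichlet h0).add
      (tendsto_l2Norm_zero hmd H.tendsto_snd)).const_mul 2
  obtain ⟨T, hT, hTt⟩ := exists_l2_limit (μ := volume.restrict (Ioo (0 : ℝ) 1))
    (φ := fun n s => φ n (s, h s)) (fun n => memLp_Ioo (by fun_prop) 0 1) b hb (fun n m => by
      have t := trace_le hc h0 ((H.smooth n).sub (H.smooth m)) (k := h) (fun _ _ => le_rfl)
        (fun s => (h1 s).le)
      simp only [fderiv_sub_apply (H.smooth n) (H.smooth m)] at t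
      have e1 : l2Norm (dirichletMeasure h) (fun x => φ n x - φ m x) ≤
          l2Norm (dirichletMeasure h) (φ n) + l2Norm (dirichletMeasure h) (φ m) := by
        have := l2Norm_add_le (memLp_dirichlet h0 (hcφ n)) (memLp_dirichlet h0 (hcφ m).neg)
        simpa [sub_eq_add_neg, l2Norm] using this
      have e2 : l2Norm (volume.restrict (region h))
          (fun x => fderiv ℝ (φ n) x (0, 1) - fderiv ℝ (φ m) x (0, 1)) ≤
          l2Norm (volume.restrict (region h)) (fun x => fderiv ℝ (φ n) x (0, 1) - (G x).2) +
          l2Norm (volume.restrict (region h)) (fun x => fderiv ℝ (φ m) x (0, 1) - (G x).2) := by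
        have hn : MemLp (fun x => (G x).2 - fderiv ℝ (φ m) x (0, 1)) 2
          (volume.restrict (region h)) := H.memLp_snd.sub (memLp_region hc h0 (hdc m))
        have := l2Norm_add_le (hmd n) hn
        have e : l2Norm (volume.restrict (region h)) (fun x => (G x).2 - fderiv ℝ (φ m) x (0, 1)) =
            l2Norm (volume.restrict (region h)) (fun x => fderiv ℝ (φ m) x (0, 1) - (G x).2) := by
          simp only [l2Norm, sub_sq_comm]
        rw [e] at this
        simpa only [sub_add_sub_cancel] using this
      set A := l2Norm (dirichletMeasure h) (fun x => φ n x - φ m x)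
      set B := l2Norm (volume.restrict (region h))
          (fun x => fderiv ℝ (φ n) x (0, 1) - fderiv ℝ (φ m) x (0, 1))
      have hA : 0 ≤ A := l2Norm_nonneg _ _
      have hB : 0 ≤ B := l2Norm_nonneg _ _
      calc _ ≤ 2 * (A + B) := by
            rw [Real.sqrt_le_left (by positivity)]
            nlinarith [mul_nonneg hA hB, sq_nonneg A, sq_nonneg B]
        _ ≤ _ := by simp only [b]; linarith)
  -- the limit lives on the bottom side only and is extended by zero to the rest of the plane
  classical
  let τ : ℝ × ℝ → ℝ := fun x => if x.1 ∈ Ioo (0 : ℝ) 1 ∧ x.2 = h x.1 then T x.1 else 0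
  have hτT : (fun s => τ (s, h s)) =ᵐ[volume.restrict (Ioo (0 : ℝ) 1)] T := by
    filter_upwards [ae_restrict_mem measurableSet_Ioo] with s hs
    simp [τ, hs.1, hs.2]
  have hτb : MemLp τ 2 (bottomMeasure h) := by
    refine MemLp.of_measure_le_smul ENNReal.ofReal_ne_top (bottomMeasure_le hL hc) ?_
    rw [hme.memLp_map_measure_iff]
    exact (memLp_congr_ae hτT).2 hT
  have hτd : τ =ᵐ[dirichletMeasure h] 0 := by
    have : ∀ᵐ x ∂dirichletMeasure h, ¬ (x.1 ∈ Ioo (0 : ℝ) 1 ∧ x.2 = h x.1) := by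
      refine ae_dirichlet_mem ?_ ?_ ?_ ?_
      · refine MeasurableSet.compl ((measurable_fst measurableSet_Ioo).inter ?_)
        exact measurableSet_eq_fun (by fun_prop) (by fun_prop)
      · intro t _; simp
      · intro t _; simp
      · intro s _ hs; exact (h1 s).ne hs.2.symm
    filter_upwards [this] with x hx
    simp only [τ, if_neg hx, Pi.zero_apply]
  have hbt : Tendsto (fun n => eLpNorm (fun x => φ n x - τ x) 2 (bottomMeasure h)) atTop (𝓝 0) := by
    have e : Tendsto (fun n => ENNReal.ofReal (1 + L) ^ ((1 : ℝ≥0∞) / 2).toReal •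
        eLpNorm (fun s => φ n (s, h s) - T s) 2 (volume.restrict (Ioo (0 : ℝ) 1))) atTop (𝓝 0) := by
      simp only [smul_eq_mul]
      have := ENNReal.Tendsto.const_mul (a := ENNReal.ofReal (1 + L) ^ ((1 : ℝ≥0∞) / 2).toReal) hTt
        (Or.inr (ENNReal.rpow_ne_top_of_nonneg (by simp) ENNReal.ofReal_ne_top))
      simpa using this
    refine tendsto_zero_of_le e fun n => ?_
    refine (eLpNorm_mono_measure _ (bottomMeasure_le hL hc)).trans ?_
    refine (eLpNorm_smul_measure_le _ _ _ _).trans (le_of_eq ?_)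
    rw [hme.eLpNorm_map_measure]
    congr 1
    refine eLpNorm_congr_ae ?_
    filter_upwards [hτT] with s hs
    simp [Function.comp, hs]
  have hτd0 : eLpNorm τ 2 (dirichletMeasure h) = 0 := by
    rw [eLpNorm_congr_ae hτd, eLpNorm_zero]
  have hτdm : AEStronglyMeasurable τ (dirichletMeasure h) :=
    (aestronglyMeasurable_const (b := (0 : ℝ))).congr hτd.symm
  refine ⟨τ, ⟨H.hasH1Grad hc h0, ⟨⟨hτb.1.add_measure hτdm, ?_⟩, φ, H.smooth, H.tendsto,
    H.tendsto_fst, H.tendsto_snd, ?_⟩, hτd⟩, hτb, hbt⟩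
  · refine (eLpNorm_add_measure_le _ _ _).trans_lt ?_
    rw [hτd0, add_zero]
    exact hτb.2
  · refine tendsto_zero_of_le_add hbt H.tendsto_dirichlet fun n => ?_
    refine (eLpNorm_add_measure_le _ _ _).trans (add_le_add le_rfl (le_of_eq ?_))
    refine eLpNorm_congr_ae ?_
    filter_upwards [hτd] with x hx
    simp [hx]

theorem eLpNorm_sub_sub_le {μ : Measure (ℝ × ℝ)} {a b c d : ℝ × ℝ → ℝ}
    (ha : AEStronglyMeasurable a μ) (hb : AEStronglyMeasurable b μ)
    (hc : AEStronglyMeasurable c μ) (hd : AEStronglyMeasurable d μ) :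
    eLpNorm (fun x => (a x - b x) - (c x - d x)) 2 μ ≤
      eLpNorm (fun x => a x - c x) 2 μ + eLpNorm (fun x => b x - d x) 2 μ := by
  have := eLpNorm_sub_le (ha.sub hc) (hb.sub hd) (by norm_num : (1 : ℝ≥0∞) ≤ 2)
  refine le_trans (le_of_eq ?_) this
  congr 1
  ext x
  simp only [Pi.sub_apply]
  ring

theorem IsDirichletLimit.sub {h : ℝ → ℝ} (hc : Continuous h) (h0 : ∀ s, 0 ≤ h s)
    {v w : ℝ × ℝ → ℝ} {G K : ℝ × ℝ → ℝ × ℝ} {φ ψ : ℕ → ℝ × ℝ → ℝ}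
    (H : IsDirichletLimit h v G φ) (H' : IsDirichletLimit h w K ψ) :
    IsDirichletLimit h (fun x => v x - w x) (fun x => G x - K x) (fun n x => φ n x - ψ n x) where
  smooth n := (H.smooth n).sub (H'.smooth n)
  memLp := H.memLp.sub H'.memLp
  memLp_fst := H.memLp_fst.sub H'.memLp_fst
  memLp_snd := H.memLp_snd.sub H'.memLp_snd
  tendsto := tendsto_zero_of_le_add H.tendsto H'.tendsto fun n =>
    eLpNorm_sub_sub_le (memLp_region hc h0 (H.smooth n).continuous).1
      (memLp_region hc h0 (H'.smooth n).continuous).1 H.memLp.1 H'.memLp.1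
  tendsto_fst := tendsto_zero_of_le_add H.tendsto_fst H'.tendsto_fst fun n => by
    simp only [fderiv_sub_apply (H.smooth n) (H'.smooth n), Prod.fst_sub]
    exact eLpNorm_sub_sub_le (memLp_region hc h0 (continuous_fderiv_apply (H.smooth n) _)).1
      (memLp_region hc h0 (continuous_fderiv_apply (H'.smooth n) _)).1 H.memLp_fst.1 H'.memLp_fst.1
  tendsto_snd := tendsto_zero_of_le_add H.tendsto_snd H'.tendsto_snd fun n => by
    simp only [fderiv_sub_apply (H.smooth n) (H'.smooth n), Prod.snd_sub]
    exact eLpNorm_sub_sub_le (memLp_region hc h0 (continuous_fderiv_apply (H.smooth n) _)).1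
      (memLp_region hc h0 (continuous_fderiv_apply (H'.smooth n) _)).1 H.memLp_snd.1 H'.memLp_snd.1
  tendsto_dirichlet := tendsto_zero_of_le_add H.tendsto_dirichlet H'.tendsto_dirichlet fun n =>
    eLpNorm_sub_le (memLp_dirichlet h0 (H.smooth n).continuous).1
      (memLp_dirichlet h0 (H'.smooth n).continuous).1 (by norm_num)

theorem IsDirichletLimit.restrict {h : ℝ → ℝ} (h0 : ∀ s, 0 ≤ h s)
    {v : ℝ × ℝ → ℝ} {G : ℝ × ℝ → ℝ × ℝ} {φ : ℕ → ℝ × ℝ → ℝ}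
    (H : IsDirichletLimit flatProfile v G φ) : IsDirichletLimit h v G φ := by
  have hm : (volume.restrict (region h) : Measure (ℝ × ℝ)) ≤ volume.restrict (region flatProfile) :=
    Measure.restrict_mono (region_subset_region_flat h0) le_rfl
  exact
    { smooth := H.smooth
      memLp := H.memLp.mono_measure hm
      memLp_fst := H.memLp_fst.mono_measure hm
      memLp_snd := H.memLp_snd.mono_measure hm
      tendsto := tendsto_zero_of_le H.tendsto fun _ => eLpNorm_mono_measure _ hm
      tendsto_fst := tendsto_zero_of_le H.tendsto_fst fun _ => eLpNorm_mono_measure _ hm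
      tendsto_snd := tendsto_zero_of_le H.tendsto_snd fun _ => eLpNorm_mono_measure _ hm
      tendsto_dirichlet := tendsto_zero_of_le H.tendsto_dirichlet fun _ =>
        eLpNorm_mono_measure _ (dirichletMeasure_le_flat h0) }

/-! ### Extension by reflection across the bottom side -/

/-- Reflection across the graph of `h` of the points below it; the points above it stay. -/
def fold (h : ℝ → ℝ) (x : ℝ × ℝ) : ℝ × ℝ := (x.1, h x.1 + |x.2 - h x.1|)

/-- The sign of `z`, as the limit of `z / √(z² + δ²)` for `δ → 0`; it is `0` at `z = 0`. -/
def sgn (z : ℝ) : ℝ := z / |z|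

/-- The first component of the gradient of `v ∘ fold h`, if `v` has the gradient `(a, b)`. -/
def foldFst (h : ℝ → ℝ) (a b : ℝ × ℝ → ℝ) (x : ℝ × ℝ) : ℝ :=
  a (fold h x) + deriv h x.1 * (1 - sgn (x.2 - h x.1)) * b (fold h x)

/-- The second component of the gradient of `v ∘ fold h`, if `v` has the gradient `(a, b)`. -/
def foldSnd (h : ℝ → ℝ) (b : ℝ × ℝ → ℝ) (x : ℝ × ℝ) : ℝ :=
  sgn (x.2 - h x.1) * b (fold h x)

/-- A smooth approximation of `fold h`. -/
def smoothFold (h : ℝ → ℝ) (δ : ℝ) (x : ℝ × ℝ) : ℝ × ℝ :=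
  (x.1, h x.1 + √((x.2 - h x.1) ^ 2 + δ ^ 2))

theorem abs_sgn_le (z : ℝ) : |sgn z| ≤ 1 := by
  unfold sgn
  rw [abs_div, abs_abs]
  exact div_self_le_one _

theorem sgn_of_pos {z : ℝ} (hz : 0 < z) : sgn z = 1 := by
  unfold sgn
  rw [abs_of_pos hz, div_self hz.ne']

theorem measurable_sgn : Measurable sgn := by
  unfold sgn
  exact measurable_id.div continuous_abs.measurable

theorem continuous_fold {h : ℝ → ℝ} (hc : Continuous h) : Continuous (fold h) := by
  unfold fold; fun_prop

theorem continuous_smoothFold {h : ℝ → ℝ} (hc : Continuous h) (δ : ℝ) :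
    Continuous (smoothFold h δ) := by
  unfold smoothFold; fun_prop

theorem fold_of_mem {h : ℝ → ℝ} {x : ℝ × ℝ} (hx : x ∈ region h) : fold h x = x := by
  unfold fold
  rw [abs_of_pos (sub_pos.2 hx.2.2.1)]
  simp

/-- Folding the interval `(0, 1)` at a point of its lower half covers `(c, 1)` at most twice. -/
theorem map_fold_real_le {c : ℝ} (h1 : c ≤ 1 / 2) :
    (volume.restrict (Ioo (0 : ℝ) 1)).map (fun t => c + |t - c|) ≤
      (2 : ℝ≥0∞) • volume.restrict (Ioo c 1) := by
  have hcont : Continuous fun t : ℝ => c + |t - c| := by fun_prop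
  refine Measure.le_iff.2 fun A hA => ?_
  rw [Measure.map_apply hcont.measurable hA, Measure.restrict_apply (hcont.measurable hA),
    Measure.smul_apply, Measure.restrict_apply hA, smul_eq_mul, two_mul]
  have hsub : (fun t : ℝ => c + |t - c|) ⁻¹' A ∩ Ioo 0 1 ⊆
      ((A ∩ Ioo c 1) ∪ (fun t => 2 * c - t) ⁻¹' (A ∩ Ioo c 1)) ∪ {c} := by
    rintro t ⟨htA, ht⟩
    simp only [mem_preimage] at htA
    rcases lt_trichotomy t c with hlt | rfl | hlt
    · refine Or.inl (Or.inr ?_)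
      rw [abs_of_neg (sub_neg.2 hlt)] at htA
      refine ⟨?_, ?_, ?_⟩
      · convert htA using 1; ring
      · dsimp only; linarith
      · dsimp only; linarith [ht.1]
    · exact Or.inr rfl
    · refine Or.inl (Or.inl ⟨?_, hlt, ht.2⟩)
      rw [abs_of_pos (sub_pos.2 hlt)] at htA
      simpa using htA
  refine (measure_mono hsub).trans ((measure_union_le _ _).trans ?_)
  rw [Real.volume_singleton, add_zero]
  refine (measure_union_le _ _).trans (add_le_add le_rfl (le_of_eq ?_))
  exact (Measure.measurePreserving_sub_left volume (2 * c)).measure_preimage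
    (hA.inter measurableSet_Ioo).nullMeasurableSet

/-- The two-dimensional version of `map_fold_real_le`, one vertical line at a time. -/
theorem map_fold_region_le {h : ℝ → ℝ} (hc : Continuous h) (h1 : ∀ s, h s ≤ 1 / 2) :
    (volume.restrict (region flatProfile)).map (fold h) ≤
      (2 : ℝ≥0∞) • (volume.restrict (region h) : Measure (ℝ × ℝ)) := by
  have hm := (continuous_fold hc).measurable
  have hmf : MeasurableSet (region flatProfile) := measurableSet_region continuous_const
  refine Measure.le_iff.2 fun A hA => ?_
  rw [Measure.map_apply hm hA, Measure.restrict_apply (hm hA),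
    Measure.smul_apply, Measure.restrict_apply hA, smul_eq_mul, Measure.volume_eq_prod,
    Measure.prod_apply ((hm hA).inter hmf), Measure.prod_apply (hA.inter (measurableSet_region hc)),
    ← lintegral_const_mul' _ _ (by norm_num)]
  refine lintegral_mono fun s => ?_
  by_cases hs : s ∈ Ioo (0 : ℝ) 1
  · have hAs : MeasurableSet (Prod.mk s ⁻¹' A) := measurable_prodMk_left hA
    have := (map_fold_real_le (h1 s)) (Prod.mk s ⁻¹' A)
    rw [Measure.map_apply (by fun_prop) hAs, Measure.restrict_apply
      ((by fun_prop : Measurable fun t => h s + |t - h s|) hAs),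
      Measure.smul_apply, Measure.restrict_apply hAs, smul_eq_mul] at this
    refine le_trans (measure_mono ?_) (this.trans (mul_le_mul_right (measure_mono ?_) 2))
    · rintro y ⟨hy, hy'⟩
      exact ⟨hy, hy'.2.2⟩
    · rintro y ⟨hy, hy'⟩
      exact ⟨hy, hs.1, hs.2, hy'⟩
  · have : Prod.mk s ⁻¹' (fold h ⁻¹' A ∩ region flatProfile) = ∅ := by
      ext y
      simp only [mem_preimage, mem_inter_iff, mem_empty_iff_false, iff_false]
      exact fun hy => hs ⟨hy.2.1, hy.2.2.1⟩
    simp [this]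

theorem map_fold_dirichlet_le {h : ℝ → ℝ} (hc : Continuous h) (h1 : ∀ s, h s ≤ 1 / 2) :
    (dirichletMeasure flatProfile).map (fold h) ≤ (2 : ℝ≥0∞) • dirichletMeasure h := by
  have hm := (continuous_fold hc).measurable
  have side : ∀ i : ℝ, ((volume.restrict (Ioo (0 : ℝ) 1)).map (fun t => (i, t))).map (fold h) ≤
      (2 : ℝ≥0∞) • (volume.restrict (Ioo (h i) 1)).map (fun t => (i, t)) := fun i => by
    rw [Measure.map_map hm (by fun_prop)]
    have : fold h ∘ (fun t => (i, t)) = (fun t => (i, t)) ∘ fun t => h i + |t - h i| := rfl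
    rw [this, ← Measure.map_map (by fun_prop) (by fun_prop), ← Measure.map_smul]
    exact Measure.map_mono (map_fold_real_le (h1 i)) (by fun_prop)
  have top : ((volume.restrict (Ioo (0 : ℝ) 1)).map (fun s => (s, (1 : ℝ)))).map (fold h) ≤
      (2 : ℝ≥0∞) • (volume.restrict (Ioo (0 : ℝ) 1)).map (fun s => (s, (1 : ℝ))) := by
    rw [Measure.map_map hm (by fun_prop)]
    have : fold h ∘ (fun s => (s, (1 : ℝ))) = (fun s => (s, (1 : ℝ))) := by
      ext s
      · rfl
      · simp only [fold, Function.comp]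
        rw [abs_of_nonneg (by linarith [h1 s])]
        ring
    rw [this, two_smul]
    exact Measure.le_add_left le_rfl
  unfold dirichletMeasure
  rw [Measure.map_add _ _ hm, Measure.map_add _ _ hm, smul_add, smul_add]
  exact add_le_add (add_le_add (side 0) (side 1)) top

theorem aestronglyMeasurable_comp_of_map_le {μ ν : Measure (ℝ × ℝ)} {R : ℝ × ℝ → ℝ × ℝ}
    (hR : Measurable R) (hle : μ.map R ≤ (2 : ℝ≥0∞) • ν) {F : ℝ × ℝ → ℝ}
    (hF : AEStronglyMeasurable F ν) : AEStronglyMeasurable (fun x => F (R x)) μ :=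
  (hF.mono_ac (Measure.absolutelyContinuous_of_le_smul hle)).comp_measurable hR

theorem eLpNorm_comp_le_of_map_le {μ ν : Measure (ℝ × ℝ)} {R : ℝ × ℝ → ℝ × ℝ}
    (hR : Measurable R) (hle : μ.map R ≤ (2 : ℝ≥0∞) • ν) {F : ℝ × ℝ → ℝ}
    (hF : AEStronglyMeasurable F ν) : eLpNorm (fun x => F (R x)) 2 μ ≤ 2 * eLpNorm F 2 ν := by
  have hF' := hF.mono_ac (Measure.absolutelyContinuous_of_le_smul hle)
  calc eLpNorm (fun x => F (R x)) 2 μ = eLpNorm F 2 (μ.map R) :=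
        (eLpNorm_map_measure hF' hR.aemeasurable).symm
    _ ≤ eLpNorm F 2 ((2 : ℝ≥0∞) • ν) := eLpNorm_mono_measure _ hle
    _ ≤ (2 : ℝ≥0∞) ^ ((1 : ℝ≥0∞) / 2).toReal • eLpNorm F 2 ν := eLpNorm_smul_measure_le _ _ _ _
    _ ≤ 2 * eLpNorm F 2 ν := by
      rw [smul_eq_mul]
      refine mul_le_mul_left ?_ _
      calc (2 : ℝ≥0∞) ^ ((1 : ℝ≥0∞) / 2).toReal ≤ 2 ^ (1 : ℝ) :=
            ENNReal.rpow_le_rpow_of_exponent_le (by norm_num) (by norm_num)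
        _ = 2 := by simp

theorem aestronglyMeasurable_foldSnd {h : ℝ → ℝ} {b : ℝ × ℝ → ℝ}
    (hc : Continuous h) (h1 : ∀ s, h s ≤ 1 / 2)
    (hb : AEStronglyMeasurable b (volume.restrict (region h))) :
    AEStronglyMeasurable (foldSnd h b) (volume.restrict (region flatProfile)) := by
  have hs : Measurable fun x : ℝ × ℝ => sgn (x.2 - h x.1) := measurable_sgn.comp (by fun_prop)
  exact hs.aestronglyMeasurable.mul (aestronglyMeasurable_comp_of_map_le
    (continuous_fold hc).measurable (map_fold_region_le hc h1) hb)

theorem aestronglyMeasurable_foldFst {h : ℝ → ℝ} {a b : ℝ × ℝ → ℝ}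
    (hc : Continuous h) (h1 : ∀ s, h s ≤ 1 / 2)
    (ha : AEStronglyMeasurable a (volume.restrict (region h)))
    (hb : AEStronglyMeasurable b (volume.restrict (region h))) :
    AEStronglyMeasurable (foldFst h a b) (volume.restrict (region flatProfile)) := by
  have hs : Measurable fun x : ℝ × ℝ => sgn (x.2 - h x.1) := measurable_sgn.comp (by fun_prop)
  have hd : Measurable fun x : ℝ × ℝ => deriv h x.1 := (measurable_deriv h).comp measurable_fst
  have hm := (continuous_fold hc).measurable
  have hle := map_fold_region_le hc h1
  exact (aestronglyMeasurable_comp_of_map_le hm hle ha).add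
    ((hd.mul (measurable_const.sub hs)).aestronglyMeasurable.mul
      (aestronglyMeasurable_comp_of_map_le hm hle hb))

theorem eLpNorm_foldSnd_le {h : ℝ → ℝ} {b : ℝ × ℝ → ℝ}
    (hc : Continuous h) (h1 : ∀ s, h s ≤ 1 / 2)
    (hb : AEStronglyMeasurable b (volume.restrict (region h))) :
    eLpNorm (foldSnd h b) 2 (volume.restrict (region flatProfile)) ≤
      2 * eLpNorm b 2 (volume.restrict (region h)) := by
  refine le_trans (eLpNorm_mono fun x => ?_) (eLpNorm_comp_le_of_map_le
    (continuous_fold hc).measurable (map_fold_region_le hc h1) hb)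
  rw [foldSnd, norm_mul, Real.norm_eq_abs]
  exact mul_le_of_le_one_left (norm_nonneg _) (abs_sgn_le _)

theorem abs_slope_mul_le {h : ℝ → ℝ} {L : ℝ}
    (hL : ∀ s, |deriv h s| ≤ L) (x : ℝ × ℝ) {c : ℝ} (hc : |c| ≤ 1) :
    |deriv h x.1 * (1 - c)| ≤ 2 * L := by
  have h1 : |1 - c| ≤ 2 := by
    rw [abs_le] at hc ⊢
    constructor <;> linarith
  rw [abs_mul]
  nlinarith [mul_le_mul (hL x.1) h1 (abs_nonneg _) ((abs_nonneg _).trans (hL x.1))]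

theorem eLpNorm_foldFst_le {h : ℝ → ℝ} {L : ℝ} {a b : ℝ × ℝ → ℝ}
    (hc : Continuous h) (h1 : ∀ s, h s ≤ 1 / 2)
    (hL : ∀ s, |deriv h s| ≤ L)
    (ha : AEStronglyMeasurable a (volume.restrict (region h)))
    (hb : AEStronglyMeasurable b (volume.restrict (region h))) :
    eLpNorm (foldFst h a b) 2 (volume.restrict (region flatProfile)) ≤
      2 * eLpNorm a 2 (volume.restrict (region h)) +
        ENNReal.ofReal (2 * L) * (2 * eLpNorm b 2 (volume.restrict (region h))) := by
  have hs : Measurable fun x : ℝ × ℝ => sgn (x.2 - h x.1) := measurable_sgn.comp (by fun_prop)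
  have hd : Measurable fun x : ℝ × ℝ => deriv h x.1 := (measurable_deriv h).comp measurable_fst
  have hm := (continuous_fold hc).measurable
  have hle := map_fold_region_le hc h1
  refine (eLpNorm_add_le (aestronglyMeasurable_comp_of_map_le hm hle ha)
    ((hd.mul (measurable_const.sub hs)).aestronglyMeasurable.mul
      (aestronglyMeasurable_comp_of_map_le hm hle hb)) (by norm_num)).trans ?_
  refine add_le_add (eLpNorm_comp_le_of_map_le hm hle ha) ?_
  refine le_trans (eLpNorm_le_mul_eLpNorm_of_ae_le_mul (g := fun x => b (fold h x))
    (ae_of_all _ fun x => ?_) 2) (mul_le_mul_right (eLpNorm_comp_le_of_map_le hm hle hb) _)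
  simp only [Pi.mul_apply, Pi.sub_apply, norm_mul]
  refine mul_le_mul_of_nonneg_right ?_ (norm_nonneg _)
  rw [← norm_mul, Real.norm_eq_abs]
  exact abs_slope_mul_le hL x (abs_sgn_le _)

/-- Dominated convergence in `L²` for uniformly bounded functions. -/
theorem tendsto_eLpNorm_of_bounded {μ : Measure (ℝ × ℝ)} [IsFiniteMeasure μ]
    {F : ℕ → ℝ × ℝ → ℝ} {f : ℝ × ℝ → ℝ} (hF : ∀ k, AEStronglyMeasurable (F k) μ)
    (hf : AEStronglyMeasurable f μ) (C : ℝ) (hC : ∀ k, ∀ᵐ x ∂μ, |F k x| ≤ C)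
    (hlim : ∀ᵐ x ∂μ, Tendsto (fun k => F k x) atTop (𝓝 (f x))) :
    Tendsto (fun k => eLpNorm (fun x => F k x - f x) 2 μ) atTop (𝓝 0) := by
  simp only [eLpNorm_eq_lintegral_rpow_enorm_toReal (p := 2) (by norm_num) (by norm_num)]
  have hfC : ∀ᵐ x ∂μ, |f x| ≤ C := by
    filter_upwards [hlim, ae_all_iff.2 hC] with x hx hx'
    exact le_of_tendsto hx.abs (Eventually.of_forall hx')
  have key : Tendsto (fun k => ∫⁻ x, ‖F k x - f x‖ₑ ^ (2 : ℝ≥0∞).toReal ∂μ) atTop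
      (𝓝 (∫⁻ _, 0 ∂μ)) := by
    refine tendsto_lintegral_of_dominated_convergence' (fun _ => ENNReal.ofReal (2 * C) ^ (2 : ℝ))
      (fun k => ((hF k).sub hf).enorm.pow_const _) (fun k => ?_) ?_ ?_
    · filter_upwards [hC k, hfC] with x hx hx'
      refine ENNReal.rpow_le_rpow ?_ (by norm_num)
      rw [← ofReal_norm]
      refine ENNReal.ofReal_le_ofReal ?_
      rw [Real.norm_eq_abs]
      exact (abs_sub _ _).trans (by linarith)
    · rw [lintegral_const]
      exact ENNReal.mul_ne_top (ENNReal.rpow_ne_top_of_nonneg (by norm_num) ENNReal.ofReal_ne_top)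
        (measure_ne_top _ _)
    · filter_upwards [hlim] with x hx
      have h1 : Tendsto (fun k => ‖F k x - f x‖ₑ) atTop (𝓝 0) := by
        have := (hx.sub_const (f x)).enorm
        simpa using this
      have h2 := ((ENNReal.continuous_rpow_const (y := (2 : ℝ≥0∞).toReal)).tendsto 0).comp h1
      simpa [Function.comp_def] using h2
  rw [lintegral_zero] at key
  have h2 := ((ENNReal.continuous_rpow_const (y := 1 / (2 : ℝ≥0∞).toReal)).tendsto 0).comp key
  simpa [Function.comp_def] using h2

/-- The derivative of `z ↦ √(z² + δ²)`. -/
def smoothSgn (δ z : ℝ) : ℝ := z / √(z ^ 2 + δ ^ 2)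

theorem abs_smoothSgn_le (δ z : ℝ) : |smoothSgn δ z| ≤ 1 := by
  unfold smoothSgn
  rw [abs_div, abs_of_nonneg (Real.sqrt_nonneg _)]
  refine div_le_one_of_le₀ ?_ (Real.sqrt_nonneg _)
  exact Real.abs_le_sqrt (by nlinarith [sq_nonneg δ])

theorem tendsto_sqrt_add_sq {δ : ℕ → ℝ} (hδ : Tendsto δ atTop (𝓝 0)) (z : ℝ) :
    Tendsto (fun k => √(z ^ 2 + δ k ^ 2)) atTop (𝓝 |z|) := by
  have : Tendsto (fun k => √(z ^ 2 + δ k ^ 2)) atTop (𝓝 √(z ^ 2 + 0 ^ 2)) :=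
    ((hδ.pow 2).const_add (z ^ 2)).sqrt
  simpa [Real.sqrt_sq_eq_abs] using this

theorem tendsto_smoothSgn {δ : ℕ → ℝ} (hδ : Tendsto δ atTop (𝓝 0)) (z : ℝ) :
    Tendsto (fun k => smoothSgn (δ k) z) atTop (𝓝 (sgn z)) := by
  unfold smoothSgn sgn
  by_cases hz : z = 0
  · simp [hz]
  · exact (tendsto_const_nhds).div (tendsto_sqrt_add_sq hδ z) (abs_ne_zero.2 hz)

theorem tendsto_smoothFold {δ : ℕ → ℝ} (hδ : Tendsto δ atTop (𝓝 0)) (h : ℝ → ℝ) (x : ℝ × ℝ) :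
    Tendsto (fun k => smoothFold h (δ k) x) atTop (𝓝 (fold h x)) :=
  tendsto_const_nhds.prodMk_nhds ((tendsto_sqrt_add_sq hδ _).const_add _)

theorem contDiff_smoothFold {h : ℝ → ℝ} (hh : ContDiff ℝ ∞ h) {δ : ℝ} (hδ : 0 < δ) :
    ContDiff ℝ ∞ (smoothFold h δ) := by
  unfold smoothFold
  refine contDiff_fst.prodMk ((hh.comp contDiff_fst).add (ContDiff.sqrt ?_ fun x => by positivity))
  exact ((contDiff_snd.sub (hh.comp contDiff_fst)).pow 2).add contDiff_const

theorem fderiv_comp_smoothFold {h : ℝ → ℝ} (hh : ContDiff ℝ ∞ h) {δ : ℝ} (hδ : 0 < δ)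
    {φ : ℝ × ℝ → ℝ} (hφ : ContDiff ℝ ∞ φ) (x : ℝ × ℝ) :
    fderiv ℝ (fun x => φ (smoothFold h δ x)) x (1, 0) = fderiv ℝ φ (smoothFold h δ x) (1, 0) +
        deriv h x.1 * (1 - smoothSgn δ (x.2 - h x.1)) * fderiv ℝ φ (smoothFold h δ x) (0, 1) ∧
      fderiv ℝ (fun x => φ (smoothFold h δ x)) x (0, 1) =
        smoothSgn δ (x.2 - h x.1) * fderiv ℝ φ (smoothFold h δ x) (0, 1) := by
  obtain ⟨s, y⟩ := x
  have hs : ContDiff ℝ ∞ (fun x => φ (smoothFold h δ x)) := hφ.comp (contDiff_smoothFold hh hδ)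
  have hF : HasFDerivAt φ (fderiv ℝ φ (smoothFold h δ (s, y))) (smoothFold h δ (s, y)) :=
    (hφ.differentiable (by simp) _).hasFDerivAt
  have hh' : HasDerivAt h (deriv h s) s := (hh.differentiable (by simp) s).hasDerivAt
  have hpos : (y - h s) ^ 2 + δ ^ 2 ≠ 0 := by positivity
  have lin : ∀ a b : ℝ, fderiv ℝ φ (smoothFold h δ (s, y)) (a, b) =
      a * fderiv ℝ φ (smoothFold h δ (s, y)) (1, 0) +
        b * fderiv ℝ φ (smoothFold h δ (s, y)) (0, 1) := fun a b => by
    have : ((a, b) : ℝ × ℝ) = a • (1, 0) + b • (0, 1) := by simp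
    rw [this, map_add, map_smul, map_smul, smul_eq_mul, smul_eq_mul]
  constructor
  · have h1 : HasDerivAt (fun s => (s, h s + √((y - h s) ^ 2 + δ ^ 2)))
        (1, deriv h s + (2 * (y - h s) ^ 1 * (-deriv h s)) / (2 * √((y - h s) ^ 2 + δ ^ 2))) s :=
      (hasDerivAt_id s).prodMk (hh'.add
        ((((hh'.const_sub y).pow 2).add_const (δ ^ 2)).sqrt hpos))
    have h2 := (hF.comp_hasDerivAt s h1).unique (hasDerivAt_fst hs s y)
    rw [← h2, lin]
    simp only [smoothSgn]
    field_simp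
    ring
  · have h1 : HasDerivAt (fun y => (s, h s + √((y - h s) ^ 2 + δ ^ 2)))
        (0, (2 * (y - h s) ^ 1 * 1) / (2 * √((y - h s) ^ 2 + δ ^ 2))) y :=
      (hasDerivAt_const y s).prodMk
        (((((hasDerivAt_id y).sub_const (h s)).pow 2).add_const (δ ^ 2)).sqrt hpos |>.const_add _)
    have h2 := (hF.comp_hasDerivAt y h1).unique (hasDerivAt_snd hs s y)
    rw [← h2, lin]
    simp only [smoothSgn]
    field_simp
    ring

/-- A smooth function composed with the smooth approximations of the reflection converges, with its
gradient, to its reflection. -/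
theorem tendsto_comp_smoothFold {h : ℝ → ℝ} (hh : ContDiff ℝ ∞ h) (h0 : ∀ s, 0 ≤ h s)
    (h1 : ∀ s, h s ≤ 1 / 2) {L : ℝ} (hL : ∀ s, |deriv h s| ≤ L) {φ : ℝ × ℝ → ℝ}
    (hφ : ContDiff ℝ ∞ φ) {δ : ℕ → ℝ} (hδ : Tendsto δ atTop (𝓝 0)) (hδ0 : ∀ k, 0 < δ k)
    (hδ1 : ∀ k, δ k ≤ 1) :
    Tendsto (fun k => eLpNorm (fun x => φ (smoothFold h (δ k) x) - φ (fold h x)) 2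
        (volume.restrict (region flatProfile))) atTop (𝓝 0) ∧
      Tendsto (fun k => eLpNorm (fun x => φ (smoothFold h (δ k) x) - φ (fold h x)) 2
        (dirichletMeasure flatProfile)) atTop (𝓝 0) ∧
      Tendsto (fun k => eLpNorm (fun x => fderiv ℝ (fun x => φ (smoothFold h (δ k) x)) x (1, 0) -
        foldFst h (fun x => fderiv ℝ φ x (1, 0)) (fun x => fderiv ℝ φ x (0, 1)) x) 2
        (volume.restrict (region flatProfile))) atTop (𝓝 0) ∧
      Tendsto (fun k => eLpNorm (fun x => fderiv ℝ (fun x => φ (smoothFold h (δ k) x)) x (0, 1) -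
        foldSnd h (fun x => fderiv ℝ φ x (0, 1)) x) 2
        (volume.restrict (region flatProfile))) atTop (𝓝 0) := by
  have hc := hh.continuous
  have hfl : ∀ s, 0 ≤ flatProfile s := fun _ => le_rfl
  have := isFiniteMeasure_region hfl
  have := isFiniteMeasure_dirichlet flatProfile
  have hcφ := hφ.continuous
  have hd1 := continuous_fderiv_apply hφ (1, 0)
  have hd2 := continuous_fderiv_apply hφ (0, 1)
  have hcf := continuous_fold hc
  have hcs := fun k => continuous_smoothFold hc (δ k)
  -- the unit square is mapped into a compact set by all approximations
  have hK : IsCompact (Icc (0 : ℝ) 1 ×ˢ Icc (0 : ℝ) 3) := isCompact_Icc.prod isCompact_Icc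
  have hmaps : ∀ k, ∀ x ∈ Icc (0 : ℝ) 1 ×ˢ Icc (0 : ℝ) 1,
      smoothFold h (δ k) x ∈ Icc (0 : ℝ) 1 ×ˢ Icc (0 : ℝ) 3 := fun k x hx => by
    refine ⟨hx.1, add_nonneg (h0 _) (Real.sqrt_nonneg _), ?_⟩
    have : √((x.2 - h x.1) ^ 2 + δ k ^ 2) ≤ 2 := by
      rw [Real.sqrt_le_left (by norm_num)]
      have a := hx.2.1
      have b := hx.2.2
      nlinarith [h0 x.1, h1 x.1, hδ0 k, hδ1 k]
    simp only [smoothFold]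
    linarith [h1 x.1]
  have hmem : ∀ᵐ x ∂(volume.restrict (region flatProfile) : Measure (ℝ × ℝ)),
      x ∈ Icc (0 : ℝ) 1 ×ˢ Icc (0 : ℝ) 1 := by
    filter_upwards [ae_restrict_mem (measurableSet_region continuous_const)] with x hx
      using region_subset_square hfl hx
  have hmemd : ∀ᵐ x ∂dirichletMeasure flatProfile, x ∈ Icc (0 : ℝ) 1 ×ˢ Icc (0 : ℝ) 1 := by
    refine ae_dirichlet_mem isCompact_square.measurableSet ?_ ?_ ?_
    · exact fun t ht => ⟨by simp, ht.1.le, ht.2.le⟩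
    · exact fun t ht => ⟨by simp, ht.1.le, ht.2.le⟩
    · exact fun t ht => ⟨⟨ht.1.le, ht.2.le⟩, by simp⟩
  obtain ⟨C, hC⟩ := hK.exists_bound_of_continuousOn hcφ.continuousOn
  obtain ⟨C₁, hC₁⟩ := hK.exists_bound_of_continuousOn hd1.continuousOn
  obtain ⟨C₂, hC₂⟩ := hK.exists_bound_of_continuousOn hd2.continuousOn
  have hlim : ∀ {F : ℝ × ℝ → ℝ}, Continuous F → ∀ x,
      Tendsto (fun k => F (smoothFold h (δ k) x)) atTop (𝓝 (F (fold h x))) := fun hF x =>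
    (hF.tendsto _).comp (tendsto_smoothFold hδ h x)
  refine ⟨?_, ?_, ?_, ?_⟩
  · exact tendsto_eLpNorm_of_bounded (fun k => (hcφ.comp (hcs k)).aestronglyMeasurable)
      (hcφ.comp hcf).aestronglyMeasurable C
      (fun k => hmem.mono fun x hx => hC _ (hmaps k x hx)) (ae_of_all _ fun x => hlim hcφ x)
  · exact tendsto_eLpNorm_of_bounded (fun k => (hcφ.comp (hcs k)).aestronglyMeasurable)
      (hcφ.comp hcf).aestronglyMeasurable C
      (fun k => hmemd.mono fun x hx => hC _ (hmaps k x hx)) (ae_of_all _ fun x => hlim hcφ x)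
  · refine tendsto_eLpNorm_of_bounded (fun k => ?_)
      (aestronglyMeasurable_foldFst hc h1 hd1.aestronglyMeasurable hd2.aestronglyMeasurable)
      (C₁ + 2 * L * C₂) (fun k => hmem.mono fun x hx => ?_) (ae_of_all _ fun x => ?_)
    · exact (continuous_fderiv_apply (hφ.comp (contDiff_smoothFold hh (hδ0 k)))
        (1, 0)).aestronglyMeasurable
    · rw [(fderiv_comp_smoothFold hh (hδ0 k) hφ x).1]
      refine (abs_add_le _ _).trans (add_le_add (hC₁ _ (hmaps k x hx)) ?_)
      rw [abs_mul]
      exact mul_le_mul (abs_slope_mul_le hL x (abs_smoothSgn_le _ _)) (hC₂ _ (hmaps k x hx))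
        (abs_nonneg _) (by linarith [(abs_nonneg _).trans (hL 0)])
    · simp only [fun k => (fderiv_comp_smoothFold hh (hδ0 k) hφ x).1]
      exact (hlim hd1 x).add ((((tendsto_smoothSgn hδ _).const_sub 1).const_mul _).mul (hlim hd2 x))
  · refine tendsto_eLpNorm_of_bounded (fun k => ?_)
      (aestronglyMeasurable_foldSnd hc h1 hd2.aestronglyMeasurable)
      (1 * C₂) (fun k => hmem.mono fun x hx => ?_) (ae_of_all _ fun x => ?_)
    · exact (continuous_fderiv_apply (hφ.comp (contDiff_smoothFold hh (hδ0 k)))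
        (0, 1)).aestronglyMeasurable
    · rw [(fderiv_comp_smoothFold hh (hδ0 k) hφ x).2, abs_mul]
      exact mul_le_mul (abs_smoothSgn_le _ _) (hC₂ _ (hmaps k x hx)) (abs_nonneg _) zero_le_one
    · simp only [fun k => (fderiv_comp_smoothFold hh (hδ0 k) hφ x).2]
      exact (tendsto_smoothSgn hδ _).mul (hlim hd2 x)

theorem eLpNorm_sub_le_add {μ : Measure (ℝ × ℝ)} {a b c : ℝ × ℝ → ℝ}
    (ha : AEStronglyMeasurable a μ) (hb : AEStronglyMeasurable b μ)
    (hc : AEStronglyMeasurable c μ) :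
    eLpNorm (fun x => a x - c x) 2 μ ≤
      eLpNorm (fun x => a x - b x) 2 μ + eLpNorm (fun x => b x - c x) 2 μ := by
  have := eLpNorm_add_le (ha.sub hb) (hb.sub hc) (by norm_num : (1 : ℝ≥0∞) ≤ 2)
  refine le_trans (le_of_eq ?_) this
  congr 1
  ext x
  simp only [Pi.sub_apply, Pi.add_apply]
  ring

theorem tendsto_const_mul_zero {a : ℕ → ℝ≥0∞} (ha : Tendsto a atTop (𝓝 0)) {c : ℝ≥0∞} (hc : c ≠ ⊤) :
    Tendsto (fun n => c * a n) atTop (𝓝 0) := by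
  simpa using ENNReal.Tendsto.const_mul ha (Or.inr hc)

/-- Reflection extends functions on the region above the graph of `h` to the unit square. The Dirichlet
condition is preserved, since the reflected points of the sides lie on the sides. -/
theorem IsDirichletLimit.exists_extension {h : ℝ → ℝ} (hh : ContDiff ℝ ∞ h) (h0 : ∀ s, 0 ≤ h s)
    (h1 : ∀ s, h s ≤ 1 / 2) {L : ℝ} (hL : ∀ s, |deriv h s| ≤ L)
    {w : ℝ × ℝ → ℝ} {G : ℝ × ℝ → ℝ × ℝ} {φ : ℕ → ℝ × ℝ → ℝ} (Hw : IsDirichletLimit h w G φ) :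
    ∃ W H ψ, IsDirichletLimit flatProfile W H ψ ∧ (∀ x ∈ region h, W x = w x) ∧
      (∀ x ∈ region h, H x = G x) ∧
      l2Norm (volume.restrict (region flatProfile)) (fun x => (H x).1) ≤
        2 * l2Norm (volume.restrict (region h)) (fun x => (G x).1) +
          2 * L * (2 * l2Norm (volume.restrict (region h)) (fun x => (G x).2)) ∧
      l2Norm (volume.restrict (region flatProfile)) (fun x => (H x).2) ≤
        2 * l2Norm (volume.restrict (region h)) (fun x => (G x).2) := by
  have hc := hh.continuous
  have hL0 : 0 ≤ L := (abs_nonneg _).trans (hL 0)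
  have hfl : ∀ s, 0 ≤ flatProfile s := fun _ => le_rfl
  have hcfl : Continuous flatProfile := continuous_const
  have hm := (continuous_fold hc).measurable
  have hle := map_fold_region_le hc h1
  have hled := map_fold_dirichlet_le hc h1
  have hcφ : ∀ n, Continuous (φ n) := fun n => (Hw.smooth n).continuous
  have hd1 : ∀ n, Continuous fun x => fderiv ℝ (φ n) x (1, 0) := fun n =>
    continuous_fderiv_apply (Hw.smooth n) _
  have hd2 : ∀ n, Continuous fun x => fderiv ℝ (φ n) x (0, 1) := fun n =>
    continuous_fderiv_apply (Hw.smooth n) _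
  let W : ℝ × ℝ → ℝ := fun x => w (fold h x)
  let H : ℝ × ℝ → ℝ × ℝ := fun x =>
    (foldFst h (fun x => (G x).1) (fun x => (G x).2) x, foldSnd h (fun x => (G x).2) x)
  have hH1 := eLpNorm_foldFst_le hc h1 hL Hw.memLp_fst.1 Hw.memLp_snd.1
  have hH2 := eLpNorm_foldSnd_le hc h1 Hw.memLp_snd.1
  have mW : MemLp W 2 (volume.restrict (region flatProfile)) :=
    ⟨aestronglyMeasurable_comp_of_map_le hm hle Hw.memLp.1,
      (eLpNorm_comp_le_of_map_le hm hle Hw.memLp.1).trans_lt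
        (ENNReal.mul_lt_top (by norm_num) Hw.memLp.2)⟩
  have fin1 : 2 * eLpNorm (fun x => (G x).1) 2 (volume.restrict (region h)) < ⊤ :=
    ENNReal.mul_lt_top (by norm_num) Hw.memLp_fst.2
  have fin2 : 2 * eLpNorm (fun x => (G x).2) 2 (volume.restrict (region h)) < ⊤ :=
    ENNReal.mul_lt_top (by norm_num) Hw.memLp_snd.2
  have fin3 := ENNReal.mul_lt_top (ENNReal.ofReal_lt_top (r := 2 * L)) fin2
  have mH1 : MemLp (fun x => (H x).1) 2 (volume.restrict (region flatProfile)) :=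
    ⟨aestronglyMeasurable_foldFst hc h1 Hw.memLp_fst.1 Hw.memLp_snd.1,
      hH1.trans_lt (ENNReal.add_lt_top.2 ⟨fin1, fin3⟩)⟩
  have mH2 : MemLp (fun x => (H x).2) 2 (volume.restrict (region flatProfile)) :=
    ⟨aestronglyMeasurable_foldSnd hc h1 Hw.memLp_snd.1, hH2.trans_lt fin2⟩
  -- smooth approximations of the reflections of the `φ n`, as close as `1 / (n + 1)`
  let δ : ℕ → ℝ := fun k => 1 / ((k : ℝ) + 1)
  have hδ : Tendsto δ atTop (𝓝 0) := tendsto_one_div_add_atTop_nhds_zero_nat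
  have hδ0 : ∀ k, 0 < δ k := fun k => by positivity
  have hδ1 : ∀ k, δ k ≤ 1 := fun k => by
    refine div_le_one_of_le₀ ?_ (by positivity)
    linarith [(Nat.cast_nonneg k : (0 : ℝ) ≤ k)]
  have hη : ∀ n : ℕ, (0 : ℝ≥0∞) < ((n : ℝ≥0∞) + 1)⁻¹ := fun n => by simp
  have hηt : Tendsto (fun n : ℕ => ((n : ℝ≥0∞) + 1)⁻¹) atTop (𝓝 0) := by
    have := (ENNReal.tendsto_inv_nat_nhds_zero).comp (tendsto_add_atTop_nat 1)
    refine this.congr fun n => ?_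
    simp
  have hex : ∀ n, ∃ k, _ := fun n => by
    obtain ⟨a, b, c, d⟩ := tendsto_comp_smoothFold hh h0 h1 hL (Hw.smooth n) hδ hδ0 hδ1
    exact ((a.eventually (gt_mem_nhds (hη n))).and ((b.eventually (gt_mem_nhds (hη n))).and
      ((c.eventually (gt_mem_nhds (hη n))).and (d.eventually (gt_mem_nhds (hη n)))))).exists
  choose k hk1 hk2 hk3 hk4 using hex
  let ψ : ℕ → ℝ × ℝ → ℝ := fun n x => φ n (smoothFold h (δ (k n)) x)
  have hψ : ∀ n, ContDiff ℝ ∞ (ψ n) := fun n =>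
    (Hw.smooth n).comp (contDiff_smoothFold hh (hδ0 _))
  have t1 : Tendsto (fun n => eLpNorm (fun x => ψ n x - W x) 2
      (volume.restrict (region flatProfile))) atTop (𝓝 0) := by
    refine tendsto_zero_of_le_add hηt (tendsto_const_mul_zero Hw.tendsto (c := 2) (by norm_num))
      fun n => ?_
    have hcn := ((hcφ n).comp (continuous_fold hc)).aestronglyMeasurable
      (μ := volume.restrict (region flatProfile))
    refine (eLpNorm_sub_le_add (hψ n).continuous.aestronglyMeasurable hcn mW.1).trans
      (add_le_add (hk1 n).le ?_)
    exact eLpNorm_comp_le_of_map_le (F := fun x => φ n x - w x) hm hle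
      ((hcφ n).aestronglyMeasurable.sub Hw.memLp.1)
  have s1 : ∀ n, AEStronglyMeasurable (fun x => fderiv ℝ (φ n) x (1, 0) - (G x).1)
      (volume.restrict (region h)) := fun n => (hd1 n).aestronglyMeasurable.sub Hw.memLp_fst.1
  have s2 : ∀ n, AEStronglyMeasurable (fun x => fderiv ℝ (φ n) x (0, 1) - (G x).2)
      (volume.restrict (region h)) := fun n => (hd2 n).aestronglyMeasurable.sub Hw.memLp_snd.1
  have t2 : Tendsto (fun n => eLpNorm (fun x => fderiv ℝ (ψ n) x (1, 0) - (H x).1) 2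
      (volume.restrict (region flatProfile))) atTop (𝓝 0) := by
    have e1 := tendsto_const_mul_zero Hw.tendsto_fst (c := 2) (by norm_num)
    have e2 := tendsto_const_mul_zero (tendsto_const_mul_zero Hw.tendsto_snd (c := 2) (by norm_num))
      (c := ENNReal.ofReal (2 * L)) ENNReal.ofReal_ne_top
    refine tendsto_zero_of_le_add hηt (by simpa only [add_zero] using e1.add e2) fun n => ?_
    refine (eLpNorm_sub_le_add (continuous_fderiv_apply (hψ n) _).aestronglyMeasurable
      (aestronglyMeasurable_foldFst hc h1 (hd1 n).aestronglyMeasurable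
        (hd2 n).aestronglyMeasurable) mH1.1).trans (add_le_add (hk3 n).le ?_)
    refine le_trans (le_of_eq ?_) (eLpNorm_foldFst_le hc h1 hL (s1 n) (s2 n))
    congr 1
    ext x
    simp only [H, foldFst]
    ring
  have t3 : Tendsto (fun n => eLpNorm (fun x => fderiv ℝ (ψ n) x (0, 1) - (H x).2) 2
      (volume.restrict (region flatProfile))) atTop (𝓝 0) := by
    have e1 := tendsto_const_mul_zero Hw.tendsto_snd (c := 2) (by norm_num)
    refine tendsto_zero_of_le_add hηt e1 fun n => ?_
    refine (eLpNorm_sub_le_add (continuous_fderiv_apply (hψ n) _).aestronglyMeasurable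
      (aestronglyMeasurable_foldSnd hc h1 (hd2 n).aestronglyMeasurable) mH2.1).trans
      (add_le_add (hk4 n).le ?_)
    refine le_trans (le_of_eq ?_) (eLpNorm_foldSnd_le hc h1 (s2 n))
    congr 1
    ext x
    simp only [H, foldSnd]
    ring
  have t4 : Tendsto (fun n => eLpNorm (ψ n) 2 (dirichletMeasure flatProfile)) atTop (𝓝 0) := by
    refine tendsto_zero_of_le_add hηt
      (tendsto_const_mul_zero Hw.tendsto_dirichlet (c := 2) (by norm_num)) fun n => ?_
    have := eLpNorm_sub_le_add (c := 0) (hψ n).continuous.aestronglyMeasurable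
      (((hcφ n).comp (continuous_fold hc)).aestronglyMeasurable
        (μ := dirichletMeasure flatProfile)) aestronglyMeasurable_zero
    simp only [Pi.zero_apply, sub_zero] at this
    exact this.trans (add_le_add (hk2 n).le
      (eLpNorm_comp_le_of_map_le hm hled (hcφ n).aestronglyMeasurable))
  refine ⟨W, H, ψ, ⟨hψ, mW, mH1, mH2, t1, t2, t3, t4⟩, fun x hx => ?_, fun x hx => ?_, ?_, ?_⟩
  · simp only [W, fold_of_mem hx]
  · simp only [H, foldFst, foldSnd, fold_of_mem hx, sgn_of_pos (sub_pos.2 hx.2.2.1)]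
    ext <;> simp
  · rw [l2Norm_eq_toReal mH1, l2Norm_eq_toReal Hw.memLp_fst, l2Norm_eq_toReal Hw.memLp_snd]
    have := ENNReal.toReal_mono (ENNReal.add_ne_top.2 ⟨fin1.ne, fin3.ne⟩) hH1
    rw [ENNReal.toReal_add fin1.ne fin3.ne, ENNReal.toReal_mul, ENNReal.toReal_mul,
      ENNReal.toReal_mul, ENNReal.toReal_ofReal (by positivity)] at this
    exact this
  · rw [l2Norm_eq_toReal mH2, l2Norm_eq_toReal Hw.memLp_snd]
    have := ENNReal.toReal_mono fin2.ne hH2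
    rwa [ENNReal.toReal_mul] at this

/-! ### Functions with a weak gradient near the bottom of the square -/

/-- Test functions are dense in `L²(U)`, so that the `L²` norm can be computed by duality. -/
theorem l2Norm_le_of_forall_test {U : Set (ℝ × ℝ)} (hU : IsOpen U) {v : ℝ × ℝ → ℝ}
    (hv : MemLp v 2 (volume.restrict U)) {c : ℝ} (hc : 0 ≤ c)
    (h : ∀ ψ : ℝ × ℝ → ℝ, ContDiff ℝ ∞ ψ → HasCompactSupport ψ → tsupport ψ ⊆ U →
      |∫ x in U, v x * ψ x| ≤ c * √(∫ x, ψ x ^ 2)) :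
    l2Norm (volume.restrict U) v ≤ c := by
  let S : Submodule ℝ (Lp ℝ 2 (volume.restrict U : Measure (ℝ × ℝ))) :=
    { carrier := {u | ∃ ψ : ℝ × ℝ → ℝ, ContDiff ℝ ∞ ψ ∧ HasCompactSupport ψ ∧ tsupport ψ ⊆ U ∧
        u =ᵐ[volume.restrict U] ψ}
      zero_mem' := ⟨0, contDiff_const, HasCompactSupport.zero, by simp, Lp.coeFn_zero _ _ _⟩
      add_mem' := by
        rintro u u' ⟨ψ, a, b, d, e⟩ ⟨ψ', a', b', d', e'⟩
        exact ⟨ψ + ψ', a.add a', b.add b', (tsupport_add ψ ψ').trans (union_subset d d'),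
          (Lp.coeFn_add u u').trans (e.add e')⟩
      smul_mem' := by
        rintro r u ⟨ψ, a, b, d, e⟩
        refine ⟨fun x => r * ψ x, contDiff_const.mul a, b.mul_left, ?_, ?_⟩
        · exact (closure_mono (Function.support_mul_subset_right _ _)).trans d
        · filter_upwards [Lp.coeFn_smul r u, e] with x hx hx'
          rw [hx, Pi.smul_apply, hx', smul_eq_mul] }
  have htop : S.topologicalClosure = ⊤ := by
    rw [Submodule.topologicalClosure_eq_top_iff, Submodule.eq_bot_iff]
    intro u hu
    rw [Submodule.mem_orthogonal] at hu
    have hli : LocallyIntegrableOn u U volume := by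
      rw [locallyIntegrableOn_iff hU.isLocallyClosed]
      intro K hKU hK
      have : IsFiniteMeasure (volume.restrict K : Measure (ℝ × ℝ)) :=
        isFiniteMeasure_restrict.2 hK.measure_lt_top.ne
      exact ((Lp.memLp u).mono_measure (Measure.restrict_mono hKU le_rfl)).integrable (by norm_num)
    have h0 := hU.ae_eq_zero_of_integral_contDiff_smul_eq_zero hli fun ψ a b d => by
      have hm : MemLp ψ 2 (volume.restrict U) :=
        (a.continuous.memLp_of_hasCompactSupport b).restrict U
      have := hu (hm.toLp ψ) ⟨ψ, a, b, d, hm.coeFn_toLp⟩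
      rw [L2.inner_def] at this
      rw [← this, ← setIntegral_eq_integral_of_forall_compl_eq_zero (s := U)]
      · refine integral_congr_ae ?_
        filter_upwards [hm.coeFn_toLp] with x hx
        rw [hx]
        simp [mul_comm]
      · intro x hx
        simp [image_eq_zero_of_notMem_tsupport fun h => hx (d h)]
    rw [Lp.eq_zero_iff_ae_eq_zero]
    exact (ae_restrict_iff' hU.measurableSet).2 h0
  have hall : ∀ u : Lp ℝ 2 (volume.restrict U : Measure (ℝ × ℝ)),
      |inner ℝ (hv.toLp v) u| ≤ c * ‖u‖ := fun u => by
    have hcl : IsClosed {u : Lp ℝ 2 (volume.restrict U : Measure (ℝ × ℝ)) |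
        |inner ℝ (hv.toLp v) u| ≤ c * ‖u‖} := isClosed_le (by fun_prop) (by fun_prop)
    refine closure_minimal ?_ hcl (show u ∈ closure (S : Set _) from ?_)
    · rintro u ⟨ψ, a, b, d, e⟩
      have hm : MemLp ψ 2 (volume.restrict U) :=
        (a.continuous.memLp_of_hasCompactSupport b).restrict U
      have hu : u = hm.toLp ψ := by
        rw [← Lp.toLp_coeFn u (Lp.memLp u)]
        exact MemLp.toLp_congr _ _ e
      have hn : ‖u‖ = √(∫ x, ψ x ^ 2) := by
        rw [hu, Lp.norm_toLp, eLpNorm_two_eq_sqrt hm, ENNReal.toReal_ofReal (Real.sqrt_nonneg _),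
          setIntegral_eq_integral_of_forall_compl_eq_zero]
        intro x hx
        simp [image_eq_zero_of_notMem_tsupport fun h => hx (d h)]
      have hi : inner ℝ (hv.toLp v) u = ∫ x in U, v x * ψ x := by
        rw [hu, L2.inner_def]
        refine integral_congr_ae ?_
        filter_upwards [hm.coeFn_toLp, hv.coeFn_toLp] with x hx hx'
        rw [hx, hx']
        simp [mul_comm]
      rw [mem_ofPred_eq, hn, hi]
      exact h ψ a b d
    · rw [← Submodule.topologicalClosure_coe, htop]
      trivial
  have hn : ‖hv.toLp v‖ = l2Norm (volume.restrict U) v := by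
    rw [Lp.norm_toLp, l2Norm_eq_toReal hv]
  have := hall (hv.toLp v)
  rw [real_inner_self_eq_norm_sq, hn, abs_of_nonneg (sq_nonneg _)] at this
  rcases (l2Norm_nonneg (volume.restrict U) v).eq_or_lt with h0 | h0
  · rw [← h0]; exact hc
  · nlinarith

/-- The pairing of `v` on the unit square with the upward translate of `ψ` by `t`. -/
def shiftPairing (v ψ : ℝ × ℝ → ℝ) (t : ℝ) : ℝ :=
  ∫ x in region flatProfile, v x * ψ (x.1, x.2 - t)

theorem continuous_shiftPairing {v ψ : ℝ × ℝ → ℝ}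
    (hv : MemLp v 2 (volume.restrict (region flatProfile))) (hψ : Continuous ψ)
    (hs : HasCompactSupport ψ) : Continuous (shiftPairing v ψ) := by
  have := isFiniteMeasure_region (h := flatProfile) fun _ => le_rfl
  obtain ⟨C, hC⟩ := hψ.bounded_above_of_compact_support hs
  refine continuous_of_dominated (bound := fun x => |v x| * C) (fun t => ?_) (fun t => ?_) ?_ ?_
  · exact hv.1.mul (by fun_prop : Continuous fun x : ℝ × ℝ => ψ (x.1, x.2 - t)).aestronglyMeasurable
  · refine ae_of_all _ fun x => ?_
    rw [norm_mul]
    exact mul_le_mul_of_nonneg_left (hC _) (norm_nonneg _)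
  · exact (hv.integrable (by norm_num)).abs.mul_const C
  · exact ae_of_all _ fun x => by fun_prop

theorem hasDerivAt_shiftPairing {v ψ : ℝ × ℝ → ℝ}
    (hv : MemLp v 2 (volume.restrict (region flatProfile))) (hψ : ContDiff ℝ ∞ ψ)
    (hs : HasCompactSupport ψ) (t : ℝ) :
    HasDerivAt (shiftPairing v ψ) (-shiftPairing v (fun x => fderiv ℝ ψ x (0, 1)) t) t := by
  have := isFiniteMeasure_region (h := flatProfile) fun _ => le_rfl
  have hd := continuous_fderiv_apply hψ (0, 1)
  have hcψ := hψ.continuous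
  have hds : HasCompactSupport fun x => fderiv ℝ ψ x (0, 1) := hs.fderiv_apply ℝ (0, 1)
  obtain ⟨C, hC⟩ := hd.bounded_above_of_compact_support hds
  have key := hasDerivAt_integral_of_dominated_loc_of_deriv_le
    (μ := volume.restrict (region flatProfile)) (F := fun t x => v x * ψ (x.1, x.2 - t))
    (F' := fun t x => v x * -fderiv ℝ ψ (x.1, x.2 - t) (0, 1)) (x₀ := t) (s := univ)
    (bound := fun x => |v x| * C) univ_mem
    (Eventually.of_forall fun t => hv.1.mul
      (by fun_prop : Continuous fun x : ℝ × ℝ => ψ (x.1, x.2 - t)).aestronglyMeasurable) ?_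
    (hv.1.mul (by fun_prop : Continuous fun x : ℝ × ℝ =>
      -fderiv ℝ ψ (x.1, x.2 - t) (0, 1)).aestronglyMeasurable) ?_
    ((hv.integrable (by norm_num)).abs.mul_const C) ?_
  · have e : -shiftPairing v (fun x => fderiv ℝ ψ x (0, 1)) t =
        ∫ x in region flatProfile, v x * -fderiv ℝ ψ (x.1, x.2 - t) (0, 1) := by
      simp only [shiftPairing, mul_neg, integral_neg]
    rw [e]
    exact key.2
  · obtain ⟨C', hC'⟩ := hcψ.bounded_above_of_compact_support hs
    exact (hv.integrable (by norm_num)).mul_bdd (c := C') (by fun_prop) (ae_of_all _ fun x => hC' _)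
  · refine ae_of_all _ fun x t _ => ?_
    rw [norm_mul, norm_neg]
    exact mul_le_mul_of_nonneg_left (hC _) (norm_nonneg _)
  · refine ae_of_all _ fun x t _ => HasDerivAt.const_mul _ ?_
    exact HasDerivAt.comp_const_sub x.2 t (hasDerivAt_snd hψ x.1 (x.2 - t))

/-- On average over the translations, `v` is paired with a function supported in a strip of width `δ`,
which costs only the factor `√δ`. -/
theorem integral_shiftPairing_le {v ψ : ℝ × ℝ → ℝ} {δ : ℝ} (hδ : 0 ≤ δ)
    (hv : MemLp v 2 (volume.restrict (region flatProfile))) (hψ : Continuous ψ)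
    (hs : HasCompactSupport ψ) (hψδ : ∀ x, ψ x ≠ 0 → 0 < x.2 ∧ x.2 < δ) :
    ∫ t in Ioo (0 : ℝ) (1 / 2), |shiftPairing v ψ t| ≤
      √δ * l2Norm (volume.restrict (region flatProfile)) v * √(∫ x, ψ x ^ 2) := by
  have hfin := isFiniteMeasure_region (h := flatProfile) fun _ => le_rfl
  set μ : Measure (ℝ × ℝ) := volume.restrict (region flatProfile) with hμ
  let A : ℝ → Set (ℝ × ℝ) := fun t => {x | t < x.2 ∧ x.2 < t + δ}
  have hA : ∀ t, MeasurableSet (A t) := fun t =>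
    (measurableSet_lt measurable_const measurable_snd).inter
      (measurableSet_lt measurable_snd measurable_const)
  let E : ℝ → ℝ := fun t => ∫ x, (A t).indicator (fun x => v x ^ 2) x ∂μ
  have hsq : ∀ t, shiftPairing v ψ t ^ 2 ≤ (∫ x, ψ x ^ 2) * E t := fun t => by
    have hψt : Continuous fun x : ℝ × ℝ => ψ (x.1, x.2 - t) := by fun_prop
    have hψm : MemLp (fun x : ℝ × ℝ => ψ (x.1, x.2 - t)) 2 μ :=
      memLp_region continuous_const (fun _ => le_rfl) hψt
    have e : shiftPairing v ψ t = ∫ x, (A t).indicator v x * ψ (x.1, x.2 - t) ∂μ := by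
      refine integral_congr_ae (ae_of_all _ fun x => ?_)
      by_cases hx : x ∈ A t
      · simp [indicator_of_mem hx]
      · have : ψ (x.1, x.2 - t) = 0 := by
          by_contra hne
          have := hψδ _ hne
          exact hx ⟨by linarith [this.1], by linarith [this.2]⟩
        simp [this]
    have cs := abs_integral_mul_le (hv.indicator (hA t)) hψm
    rw [← e] at cs
    have e2 : l2Norm μ ((A t).indicator v) ^ 2 = E t := by
      rw [sq_l2Norm]
      refine integral_congr_ae (ae_of_all _ fun x => ?_)
      by_cases hx : x ∈ A t <;> simp [hx]
    have e3 : l2Norm μ (fun x => ψ (x.1, x.2 - t)) ^ 2 ≤ ∫ x, ψ x ^ 2 := by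
      have hmp : MeasurePreserving (fun x : ℝ × ℝ => x - (0, t)) volume volume :=
        measurePreserving_sub_right volume (0, t)
      have hi : Integrable (fun x => ψ x ^ 2) :=
        (hψ.memLp_of_hasCompactSupport (p := 2) hs).integrable_sq
      have hi2 : Integrable (fun x : ℝ × ℝ => ψ (x.1, x.2 - t) ^ 2) := by
        have := hmp.integrable_comp_of_integrable hi
        refine this.congr (ae_of_all _ fun x => ?_)
        simp [Function.comp, Prod.sub_def]
      rw [sq_l2Norm]
      refine (setIntegral_le_integral hi2 (ae_of_all _ fun _ => sq_nonneg _)).trans (le_of_eq ?_)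
      have := integral_sub_right_eq_self (μ := (volume : Measure (ℝ × ℝ))) (fun x => ψ x ^ 2) (0, t)
      rw [← this]
      refine integral_congr_ae (ae_of_all _ fun x => ?_)
      simp [Prod.sub_def]
    rw [← sq_abs, ← e2]
    calc |shiftPairing v ψ t| ^ 2 ≤ (l2Norm μ ((A t).indicator v) *
          l2Norm μ (fun x => ψ (x.1, x.2 - t))) ^ 2 := pow_le_pow_left₀ (abs_nonneg _) cs 2
      _ = l2Norm μ (fun x => ψ (x.1, x.2 - t)) ^ 2 * l2Norm μ ((A t).indicator v) ^ 2 := by ring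
      _ ≤ _ := by gcongr
  let B : Set (ℝ × (ℝ × ℝ)) := {p | p.1 < p.2.2 ∧ p.2.2 < p.1 + δ}
  have hB : MeasurableSet B :=
    (measurableSet_lt measurable_fst (measurable_snd.comp measurable_snd)).inter
      (measurableSet_lt (measurable_snd.comp measurable_snd) (measurable_fst.add_const δ))
  have hint : Integrable (Function.uncurry fun (t : ℝ) (x : ℝ × ℝ) =>
      (A t).indicator (fun x => v x ^ 2) x) ((volume.restrict (Ioo (0 : ℝ) (1 / 2))).prod μ) := by
    have : Integrable (fun p : ℝ × (ℝ × ℝ) => v p.2 ^ 2)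
        ((volume.restrict (Ioo (0 : ℝ) (1 / 2))).prod μ) := hv.integrable_sq.comp_snd _
    exact this.indicator hB
  have hE : ∫ t in Ioo (0 : ℝ) (1 / 2), E t ≤ δ * l2Norm μ v ^ 2 := by
    simp only [E]
    rw [integral_integral_swap hint, sq_l2Norm, ← integral_const_mul]
    refine integral_mono_of_nonneg (ae_of_all _ fun x => integral_nonneg fun t =>
      indicator_nonneg (fun _ _ => sq_nonneg _) _) (hv.integrable_sq.const_mul δ)
      (ae_of_all _ fun x => ?_)
    -- a given point lies in the translated strip for a set of parameters of length `δ`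
    have e : ∀ t, (A t).indicator (fun x => v x ^ 2) x =
        (Ioo (x.2 - δ) x.2).indicator (fun _ => v x ^ 2) t := fun t => by
      have : x ∈ A t ↔ t ∈ Ioo (x.2 - δ) x.2 :=
        ⟨fun h => ⟨by linarith [h.2], h.1⟩, fun h => ⟨h.2, by linarith [h.1]⟩⟩
      by_cases hx : x ∈ A t
      · rw [indicator_of_mem hx, indicator_of_mem (this.1 hx)]
      · rw [indicator_of_notMem hx, indicator_of_notMem (fun h => hx (this.2 h))]
    simp only [e]
    refine (setIntegral_le_integral ((integrable_indicator_iff measurableSet_Ioo).2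
      (integrableOn_const measure_Ioo_lt_top.ne)) (ae_of_all _ fun t =>
        indicator_nonneg (fun _ _ => sq_nonneg _) _)).trans (le_of_eq ?_)
    rw [integral_indicator measurableSet_Ioo]
    simp [hδ]
  have hF := sq_integral_abs_le (memLp_Ioo (continuous_shiftPairing hv hψ hs) 0 (1 / 2))
    (by norm_num)
  have hF2 : ∫ t in Ioo (0 : ℝ) (1 / 2), shiftPairing v ψ t ^ 2 ≤
      (∫ x, ψ x ^ 2) * (δ * l2Norm μ v ^ 2) := by
    refine le_trans (integral_mono_of_nonneg (ae_of_all _ fun _ => sq_nonneg _)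
      (hint.integral_prod_left.const_mul _) (ae_of_all _ hsq)) ?_
    rw [integral_const_mul]
    exact mul_le_mul_of_nonneg_left hE (integral_nonneg fun _ => sq_nonneg _)
  have hψ0 : 0 ≤ ∫ x, ψ x ^ 2 := integral_nonneg fun _ => sq_nonneg _
  refine abs_le_of_sq_le_sq' (a := ∫ t in Ioo (0 : ℝ) (1 / 2), |shiftPairing v ψ t|) ?_ ?_ |>.2
  · rw [mul_pow, mul_pow, Real.sq_sqrt hδ, Real.sq_sqrt hψ0]
    have : 0 ≤ (∫ x, ψ x ^ 2) * (δ * l2Norm μ v ^ 2) := by positivity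
    nlinarith
  · have := l2Norm_nonneg μ v
    positivity

/-- A function with a square integrable weak gradient has an `L²` norm of order `√δ` on the strip of width
`δ` at the bottom of the square. By duality it is enough to pair it with a test function supported in the
strip; moving the test function upwards by `t` changes the pairing by an integral of `∂₂v`, and the average
over `0 < t < 1 / 2` is controlled by `integral_shiftPairing_le`. -/
theorem strip_le_of_hasH1Grad {v : ℝ × ℝ → ℝ} {K : ℝ × ℝ → ℝ × ℝ}
    (H : HasH1Grad (region flatProfile) v K) {δ : ℝ} (hδ : 0 < δ) (hδ' : δ ≤ 1 / 2) :
    l2Norm (volume.restrict (region flatProfile ∩ {x | x.2 < δ})) v ≤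
      2 * √δ * (l2Norm (volume.restrict (region flatProfile)) v +
        l2Norm (volume.restrict (region flatProfile)) (fun x => (K x).2)) := by
  have hmflat := measurableSet_region (h := flatProfile) continuous_const
  have hopen : IsOpen (region flatProfile ∩ {x : ℝ × ℝ | x.2 < δ}) := by
    rw [region_flat]
    exact (isOpen_Ioo.prod isOpen_Ioo).inter (isOpen_lt (by fun_prop) (by fun_prop))
  have hN := l2Norm_nonneg (volume.restrict (region flatProfile)) v
  have hNK := l2Norm_nonneg (volume.restrict (region flatProfile)) (fun x => (K x).2)
  refine l2Norm_le_of_forall_test hopen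
    (H.memLp.mono_measure (Measure.restrict_mono inter_subset_left le_rfl))
    (by positivity) fun ψ hψ hs hsub => ?_
  have hψδ : ∀ x, ψ x ≠ 0 → 0 < x.2 ∧ x.2 < δ := fun x hx => by
    have := hsub (subset_tsupport ψ hx)
    exact ⟨this.1.2.2.1, this.2⟩
  have e0 : ∫ x in region flatProfile ∩ {x | x.2 < δ}, v x * ψ x = shiftPairing v ψ 0 := by
    unfold shiftPairing
    have z : ∀ x ∉ region flatProfile ∩ {x | x.2 < δ}, v x * ψ x = 0 := fun x hx => by
      rw [image_eq_zero_of_notMem_tsupport fun h => hx (hsub h), mul_zero]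
    simp only [sub_zero, Prod.mk.eta]
    rw [setIntegral_eq_integral_of_forall_compl_eq_zero z,
      setIntegral_eq_integral_of_forall_compl_eq_zero fun x hx => z x fun h => hx h.1]
  -- the derivative of the pairing in the translation parameter is the pairing with `∂₂v`
  have hderiv : ∀ t ∈ Ioo (0 : ℝ) (1 / 2), -shiftPairing v (fun x => fderiv ℝ ψ x (0, 1)) t =
      shiftPairing (fun x => (K x).2) ψ t := fun t ht => by
    let T : ℝ × ℝ ≃ₜ ℝ × ℝ := Homeomorph.subRight (0, t)
    have hT : ∀ x : ℝ × ℝ, T x = (x.1, x.2 - t) := fun x => by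
      simp [T, Prod.sub_def]
    have hψt : ContDiff ℝ ∞ fun x : ℝ × ℝ => ψ (x.1, x.2 - t) :=
      hψ.comp (contDiff_fst.prodMk (contDiff_snd.sub contDiff_const))
    have ecomp : (fun x : ℝ × ℝ => ψ (x.1, x.2 - t)) = ψ ∘ T := by
      ext x
      rw [Function.comp, hT]
    have hsupp : tsupport (fun x : ℝ × ℝ => ψ (x.1, x.2 - t)) ⊆ region flatProfile := by
      rw [ecomp, tsupport_comp_eq_preimage]
      intro x hx
      have := hsub hx
      rw [hT] at this
      obtain ⟨⟨a, b, c, d⟩, e⟩ := this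
      simp only [mem_ofPred_eq, flatProfile] at a b c d e
      refine ⟨a, b, ?_, ?_⟩
      · simp only [flatProfile]; linarith [ht.1]
      · linarith [ht.2]
    have hw := H.weak_snd _ hψt (by rw [ecomp]; exact hs.comp_homeomorph T) hsupp
    have hd : ∀ x : ℝ × ℝ, fderiv ℝ (fun x : ℝ × ℝ => ψ (x.1, x.2 - t)) x (0, 1) =
        fderiv ℝ ψ (x.1, x.2 - t) (0, 1) := fun x => by
      have h1 := hasDerivAt_snd hψt x.1 x.2
      exact h1.unique (HasDerivAt.comp_sub_const x.2 t (hasDerivAt_snd hψ x.1 (x.2 - t)))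
    simp only [hd] at hw
    unfold shiftPairing
    linarith
  have hf' : Continuous fun t => -shiftPairing v (fun x => fderiv ℝ ψ x (0, 1)) t :=
    (continuous_shiftPairing H.memLp (continuous_fderiv_apply hψ _) (hs.fderiv_apply ℝ _)).neg
  have hcv := continuous_shiftPairing H.memLp hψ.continuous hs
  have hJ := integral_shiftPairing_le hδ.le H.memLp hψ.continuous hs hψδ
  have hJK := integral_shiftPairing_le hδ.le H.memLp_snd hψ.continuous hs hψδ
  set J := ∫ t in Ioo (0 : ℝ) (1 / 2), |shiftPairing v ψ t|
  set JK := ∫ t in Ioo (0 : ℝ) (1 / 2), |shiftPairing (fun x => (K x).2) ψ t|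
  have hpt : ∀ t ∈ Ioo (0 : ℝ) (1 / 2), |shiftPairing v ψ 0| ≤ |shiftPairing v ψ t| + JK :=
    fun t ht => by
      have := abs_sub_le_integral_deriv (hasDerivAt_shiftPairing H.memLp hψ hs) hf'
        (a := 0) (b := 1 / 2) (x := 0) (y := t) ⟨le_rfl, by norm_num⟩ ⟨ht.1.le, ht.2.le⟩
      rw [setIntegral_congr_fun measurableSet_Ioo (fun t ht => by rw [hderiv t ht])] at this
      have h2 := abs_sub_abs_le_abs_sub (shiftPairing v ψ 0) (shiftPairing v ψ t)
      linarith
  have hint : 1 / 2 * |shiftPairing v ψ 0| ≤ J + 1 / 2 * JK := by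
    have hi : IntegrableOn (fun t => |shiftPairing v ψ t|) (Ioo (0 : ℝ) (1 / 2)) :=
      (Continuous.integrableOn_Icc (by fun_prop)).mono_set Ioo_subset_Icc_self
    have := setIntegral_mono_on (μ := volume) (integrable_const |shiftPairing v ψ 0|)
      (hi.add (integrable_const JK)) measurableSet_Ioo hpt
    simp only [Pi.add_apply] at this
    have e : ∀ c : ℝ, ∫ _ in Ioo (0 : ℝ) (1 / 2), c = 1 / 2 * c := fun c => by simp
    rwa [integral_add hi (integrable_const JK), e, e] at this
  rw [e0]
  have hq := Real.sqrt_nonneg (∫ x, ψ x ^ 2)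
  have hsδ := Real.sqrt_nonneg δ
  have hpos : 0 ≤ √δ * l2Norm (volume.restrict (region flatProfile)) (fun x => (K x).2) *
    √(∫ x, ψ x ^ 2) := by positivity
  linarith

/-! ### Oscillating boundary integrals -/

theorem continuous_flatProfile : Continuous flatProfile := continuous_const

theorem setIntegral_flat_swap {F : ℝ × ℝ → ℝ} (hF : Continuous F) :
    ∫ x in region flatProfile, F x = ∫ z in Ioo (0 : ℝ) 1, ∫ s in Ioo (0 : ℝ) 1, F (s, z) := by
  have hi : IntegrableOn F (region flatProfile) :=
    (hF.continuousOn.integrableOn_compact isCompact_square).mono_set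
      (region_subset_square fun _ => le_rfl)
  rw [setIntegral_region continuous_flatProfile hi]
  simp only [flatProfile]
  rw [integral_integral_swap]
  rw [region_flat, IntegrableOn, Measure.volume_eq_prod, ← Measure.prod_restrict] at hi
  exact hi

theorem setIntegral_Ioo_mono {f : ℝ → ℝ} (hf : Continuous f) (h0 : ∀ t, 0 ≤ f t) {δ : ℝ}
    (hδ : δ ≤ 1) : ∫ t in Ioo 0 δ, f t ≤ ∫ t in Ioo (0 : ℝ) 1, f t :=
  setIntegral_mono_set (hf.integrableOn_Icc.mono_set Ioo_subset_Icc_self) (ae_of_all _ h0)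
    (LE.le.eventuallyLE (Ioo_subset_Ioo_right hδ))

theorem continuous_integral_Ioo {f : ℝ → ℝ → ℝ} (hf : Continuous (Function.uncurry f)) (a b : ℝ) :
    Continuous fun s => ∫ t in Ioo a b, f s t := by
  simp only [← integral_Icc_eq_integral_Ioo]
  exact continuous_parametric_integral_of_continuous hf isCompact_Icc

theorem integral_abs_le_of_sq_le {f : ℝ → ℝ} (hf : Continuous f) {δ N : ℝ} (hδ : 0 ≤ δ) (hN : 0 ≤ N)
    (h : ∫ t in Ioo 0 δ, f t ^ 2 ≤ N ^ 2) : ∫ t in Ioo 0 δ, |f t| ≤ √δ * N := by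
  have := sq_integral_abs_le (memLp_Ioo hf 0 δ) hδ
  refine abs_le_of_sq_le_sq' (a := ∫ t in Ioo 0 δ, |f t|) ?_ (by positivity) |>.2
  rw [mul_pow, Real.sq_sqrt hδ]
  nlinarith

theorem integral_strip_vertical_le {F : ℝ × ℝ → ℝ} (hF : Continuous F) {δ : ℝ} (hδ : 0 ≤ δ)
    (hδ1 : δ ≤ 1) :
    ∫ s in Ioo (0 : ℝ) 1, (∫ t in Ioo 0 δ, |F (s, t)|) ^ 2 ≤
      δ * l2Norm (volume.restrict (region flatProfile)) F ^ 2 := by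
  have hi := (memLp_region (h := flatProfile) continuous_const (fun _ => le_rfl) hF).integrable_sq
  rw [sq_l2Norm, setIntegral_region continuous_flatProfile hi, ← integral_const_mul]
  refine integral_mono_of_nonneg (ae_of_all _ fun _ => sq_nonneg _)
    ((integrableOn_integral_region continuous_flatProfile hi).const_mul δ) (ae_of_all _ fun s => ?_)
  have h1 := sq_integral_abs_le (f := fun t => F (s, t)) (memLp_Ioo (by fun_prop) 0 δ) hδ
  have h2 := setIntegral_Ioo_mono (f := fun t => F (s, t) ^ 2) (by fun_prop)
    (fun _ => sq_nonneg _) hδ1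
  refine h1.trans ?_
  rw [sub_zero]
  exact mul_le_mul_of_nonneg_left h2 hδ

theorem integral_strip_horizontal_le {F : ℝ × ℝ → ℝ} (hF : Continuous F) {δ : ℝ} (hδ : 0 ≤ δ)
    (hδ1 : δ ≤ 1) :
    ∫ z in Ioo 0 δ, ∫ s in Ioo (0 : ℝ) 1, |F (s, z)| ≤
      √δ * l2Norm (volume.restrict (region flatProfile)) F := by
  have hg : Continuous fun z => ∫ s in Ioo (0 : ℝ) 1, |F (s, z)| :=
    continuous_integral_Ioo (f := fun z s => |F (s, z)|) (by fun_prop) 0 1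
  have hg2 : Continuous fun z => ∫ s in Ioo (0 : ℝ) 1, F (s, z) ^ 2 :=
    continuous_integral_Ioo (f := fun z s => F (s, z) ^ 2) (by fun_prop) 0 1
  have h := integral_abs_le_of_sq_le hg hδ
    (l2Norm_nonneg (volume.restrict (region flatProfile)) F) ?_
  · refine le_trans (le_of_eq (integral_congr_ae (ae_of_all _ fun z => ?_))) h
    exact (abs_of_nonneg (integral_nonneg fun _ => abs_nonneg _)).symm
  · rw [sq_l2Norm, setIntegral_flat_swap (by fun_prop)]
    refine le_trans ?_ (setIntegral_Ioo_mono hg2 (fun _ => integral_nonneg fun _ => sq_nonneg _) hδ1)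
    refine integral_mono_of_nonneg (ae_of_all _ fun _ => sq_nonneg _)
      (hg2.integrableOn_Icc.mono_set Ioo_subset_Icc_self) (ae_of_all _ fun z => ?_)
    have := sq_integral_abs_le (f := fun s => F (s, z)) (memLp_Ioo (by fun_prop) 0 1) zero_le_one
    simpa using this

/-- A boundary integral over a graph close to the bottom of the square and with an oscillating density
`a`, compared with the integral over the bottom with constant density `q`. Here `A` is a primitive of
`a - q`, so that `B` is small if `a` oscillates rapidly around `q`. Both integrals are compared with
integrals over the horizontal lines at height `z`, where `a - q` is integrated by parts; then the result is
averaged over `0 < z < δ`. -/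
theorem abs_graph_integral_sub_le {a A h : ℝ → ℝ} (ha : Continuous a) {q B δ : ℝ}
    (hA : ∀ s, HasDerivAt A (a s - q) s) (hB : ∀ s, |A s| ≤ B) (hh : Continuous h)
    (h0 : ∀ s, 0 ≤ h s) (hhδ : ∀ s, h s ≤ δ) (hδ : 0 < δ) (hδ1 : δ ≤ 1)
    {ψ : ℝ × ℝ → ℝ} (hψ : ContDiff ℝ ∞ ψ) :
    |(∫ s in Ioo (0 : ℝ) 1, a s * ψ (s, h s)) - ∫ s in Ioo (0 : ℝ) 1, q * ψ (s, 0)| ≤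
      √δ * (√(∫ s in Ioo (0 : ℝ) 1, a s ^ 2) + |q|) *
        l2Norm (volume.restrict (region flatProfile)) (fun x => fderiv ℝ ψ x (0, 1)) +
      B / δ * (√δ * l2Norm (volume.restrict (region flatProfile)) (fun x => fderiv ℝ ψ x (1, 0)) +
        2 * l2Norm (dirichletMeasure flatProfile) ψ) := by
  have hcψ := hψ.continuous
  have hd1 := continuous_fderiv_apply hψ (1, 0)
  have hd2 := continuous_fderiv_apply hψ (0, 1)
  have hB0 : 0 ≤ B := (abs_nonneg _).trans (hB 0)
  have hAc : Continuous A := continuous_iff_continuousAt.2 fun s => (hA s).continuousAt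
  have ic : ∀ {f : ℝ → ℝ} (b : ℝ), Continuous f → IntegrableOn f (Ioo 0 b) := fun b hf =>
    hf.integrableOn_Icc.mono_set Ioo_subset_Icc_self
  set N1 := l2Norm (volume.restrict (region flatProfile)) (fun x => fderiv ℝ ψ x (1, 0))
  set N2 := l2Norm (volume.restrict (region flatProfile)) (fun x => fderiv ℝ ψ x (0, 1))
  set d := l2Norm (dirichletMeasure flatProfile) ψ
  set X := (∫ s in Ioo (0 : ℝ) 1, a s * ψ (s, h s)) - ∫ s in Ioo (0 : ℝ) 1, q * ψ (s, 0) with hX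
  have hN2 : 0 ≤ N2 := l2Norm_nonneg _ _
  have hd : 0 ≤ d := l2Norm_nonneg _ _
  let Q : ℝ → ℝ := fun s => ∫ t in Ioo 0 δ, |fderiv ℝ ψ (s, t) (0, 1)|
  have hQ : Continuous Q :=
    continuous_integral_Ioo (f := fun s t => |fderiv ℝ ψ (s, t) (0, 1)|) (by fun_prop) 0 δ
  have hQ0 : ∀ s, 0 ≤ Q s := fun s => integral_nonneg fun _ => abs_nonneg _
  have hQ2 : ∫ s in Ioo (0 : ℝ) 1, Q s ^ 2 ≤ (√δ * N2) ^ 2 := by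
    rw [mul_pow, Real.sq_sqrt hδ.le]
    exact integral_strip_vertical_le hd2 hδ.le hδ1
  have hQs : √(∫ s in Ioo (0 : ℝ) 1, Q s ^ 2) ≤ √δ * N2 :=
    Real.sqrt_le_iff.2 ⟨by positivity, hQ2⟩
  have hQ1 : ∫ s in Ioo (0 : ℝ) 1, Q s ≤ √δ * N2 := by
    have := integral_abs_le_of_sq_le hQ zero_le_one (by positivity) hQ2
    simpa [abs_of_nonneg (hQ0 _)] using this
  have haQ : ∫ s in Ioo (0 : ℝ) 1, |a s| * Q s ≤ √(∫ s in Ioo (0 : ℝ) 1, a s ^ 2) * (√δ * N2) := by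
    have := integral_abs_mul_le_sqrt (memLp_Ioo ha 0 1) (memLp_Ioo hQ 0 1)
    simp only [abs_mul, abs_of_nonneg (hQ0 _)] at this
    exact this.trans (mul_le_mul_of_nonneg_left hQs (Real.sqrt_nonneg _))
  let Z : ℝ → ℝ := fun z => |ψ (1, z)| + |ψ (0, z)| +
    ∫ s in Ioo (0 : ℝ) 1, |fderiv ℝ ψ (s, z) (1, 0)|
  have hZ3 : Continuous fun z => ∫ s in Ioo (0 : ℝ) 1, |fderiv ℝ ψ (s, z) (1, 0)| :=
    continuous_integral_Ioo (f := fun z s => |fderiv ℝ ψ (s, z) (1, 0)|) (by fun_prop) 0 1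
  set Y := ∫ s in Ioo (0 : ℝ) 1, (|a s| + |q|) * Q s with hY
  have hYle : Y ≤ √δ * (√(∫ s in Ioo (0 : ℝ) 1, a s ^ 2) + |q|) * N2 := by
    have : Y = (∫ s in Ioo (0 : ℝ) 1, |a s| * Q s) + |q| * ∫ s in Ioo (0 : ℝ) 1, Q s := by
      rw [hY, ← integral_const_mul, ← integral_add (ic 1 (by fun_prop)) (ic 1 (by fun_prop))]
      simp only [add_mul]
    rw [this]
    nlinarith [mul_le_mul_of_nonneg_left hQ1 (abs_nonneg q)]
  have hpt : ∀ z ∈ Ioo 0 δ, |X| ≤ Y + B * Z z := fun z hz => by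
    have e1 : X = (∫ s in Ioo (0 : ℝ) 1, (a s * (ψ (s, h s) - ψ (s, z)) -
        q * (ψ (s, 0) - ψ (s, z)))) + ∫ s in Ioo (0 : ℝ) 1, (a s - q) * ψ (s, z) := by
      rw [hX, ← integral_sub (ic 1 (by fun_prop)) (ic 1 (by fun_prop)),
        ← integral_add (ic 1 (by fun_prop)) (ic 1 (by fun_prop))]
      congr 1
      ext s
      ring
    have e2 : |∫ s in Ioo (0 : ℝ) 1, (a s * (ψ (s, h s) - ψ (s, z)) -
        q * (ψ (s, 0) - ψ (s, z)))| ≤ Y := by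
      refine abs_integral_le_integral_abs.trans (setIntegral_mono (ic 1 (by fun_prop))
        (ic 1 (by fun_prop)) fun s => ?_)
      have d1 := abs_sub_le_integral_deriv (hasDerivAt_snd hψ s) (by fun_prop)
        (a := 0) (b := δ) ⟨h0 s, hhδ s⟩ ⟨hz.1.le, hz.2.le⟩
      have d2 := abs_sub_le_integral_deriv (hasDerivAt_snd hψ s) (by fun_prop)
        (a := 0) (b := δ) ⟨le_rfl, hδ.le⟩ ⟨hz.1.le, hz.2.le⟩
      calc _ ≤ |a s * (ψ (s, h s) - ψ (s, z))| + |q * (ψ (s, 0) - ψ (s, z))| := abs_sub _ _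
        _ = |a s| * |ψ (s, h s) - ψ (s, z)| + |q| * |ψ (s, 0) - ψ (s, z)| := by
          rw [abs_mul, abs_mul]
        _ ≤ |a s| * Q s + |q| * Q s := by gcongr
        _ = _ := by ring
    have e3 : |∫ s in Ioo (0 : ℝ) 1, (a s - q) * ψ (s, z)| ≤ B * Z z := by
      have parts := intervalIntegral.integral_deriv_mul_eq_sub (a := 0) (b := 1)
        (u := A) (u' := fun s => a s - q) (v := fun s => ψ (s, z))
        (v' := fun s => fderiv ℝ ψ (s, z) (1, 0)) (fun s _ => hA s)
        (fun s _ => hasDerivAt_fst hψ s z)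
        (Continuous.intervalIntegrable (by fun_prop) 0 1)
        (Continuous.intervalIntegrable (by fun_prop) 0 1)
      rw [intervalIntegral.integral_of_le zero_le_one, integral_Ioc_eq_integral_Ioo,
        integral_add (ic 1 (by fun_prop)) (ic 1 (by fun_prop))] at parts
      have i1 : |∫ s in Ioo (0 : ℝ) 1, A s * fderiv ℝ ψ (s, z) (1, 0)| ≤
          B * ∫ s in Ioo (0 : ℝ) 1, |fderiv ℝ ψ (s, z) (1, 0)| := by
        rw [← integral_const_mul]
        refine abs_integral_le_integral_abs.trans (setIntegral_mono (ic 1 (by fun_prop))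
          (ic 1 (by fun_prop)) fun s => ?_)
        rw [abs_mul]
        exact mul_le_mul_of_nonneg_right (hB s) (abs_nonneg _)
      have i2 : |A 1 * ψ (1, z)| ≤ B * |ψ (1, z)| := by
        rw [abs_mul]; exact mul_le_mul_of_nonneg_right (hB 1) (abs_nonneg _)
      have i3 : |A 0 * ψ (0, z)| ≤ B * |ψ (0, z)| := by
        rw [abs_mul]; exact mul_le_mul_of_nonneg_right (hB 0) (abs_nonneg _)
      have : ∫ s in Ioo (0 : ℝ) 1, (a s - q) * ψ (s, z) = A 1 * ψ (1, z) - A 0 * ψ (0, z) -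
          ∫ s in Ioo (0 : ℝ) 1, A s * fderiv ℝ ψ (s, z) (1, 0) := by linarith
      rw [this]
      simp only [Z, mul_add]
      refine (abs_sub _ _).trans (add_le_add ((abs_sub _ _).trans (add_le_add i2 i3)) i1)
    rw [e1]
    exact (abs_add_le _ _).trans (add_le_add e2 e3)
  have hZint : ∫ z in Ioo 0 δ, Z z ≤ √δ * N1 + 2 * d := by
    have hside : ∀ i : ℝ, ∫ t in Ioo (0 : ℝ) 1, ψ (i, t) ^ 2 ≤ d ^ 2 →
        ∫ z in Ioo 0 δ, |ψ (i, z)| ≤ d := fun i hi => by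
      have := integral_abs_le_of_sq_le (f := fun t => ψ (i, t)) (by fun_prop) zero_le_one hd hi
      rw [Real.sqrt_one, one_mul] at this
      exact (setIntegral_Ioo_mono (by fun_prop) (fun _ => abs_nonneg _) hδ1).trans this
    have hs := setIntegral_sides_le (h := flatProfile) (fun _ => le_rfl) hcψ
    have a1 := hside 1 hs.2
    have a2 := hside 0 hs.1
    have a3 := integral_strip_horizontal_le hd1 hδ.le hδ1
    simp only [Z]
    rw [integral_add (ic δ (by fun_prop)) (ic δ hZ3),
      integral_add (ic δ (by fun_prop)) (ic δ (by fun_prop))]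
    linarith
  have hfin := setIntegral_mono_on (μ := volume) (s := Ioo 0 δ) (f := fun _ => |X|)
    (g := fun z => Y + B * Z z) (ic δ continuous_const) (ic δ (by fun_prop)) measurableSet_Ioo hpt
  rw [integral_add (ic δ continuous_const) (ic δ (by fun_prop)), integral_const_mul] at hfin
  simp only [integral_const, measureReal_restrict_apply_univ, Real.volume_real_Ioo_of_le hδ.le,
    sub_zero, smul_eq_mul] at hfin
  have h5 : |X| ≤ Y + B / δ * ∫ z in Ioo 0 δ, Z z := by
    have : δ * (Y + B / δ * ∫ z in Ioo 0 δ, Z z) = δ * Y + B * ∫ z in Ioo 0 δ, Z z := by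
      field_simp
    exact le_of_mul_le_mul_left (by rw [this]; exact hfin) hδ
  refine h5.trans (add_le_add hYle ?_)
  exact mul_le_mul_of_nonneg_left hZint (by positivity)

/-! ### Periodic densities -/

/-- The primitive of a periodic function minus its mean is bounded by the `L¹` norm over a period. -/
theorem exists_primitive_bound {f : ℝ → ℝ} (hf : Continuous f) (hper : Function.Periodic f 1) {q : ℝ}
    (hq : q = ∫ t in (0 : ℝ)..1, f t) :
    ∃ P : ℝ → ℝ, (∀ t, HasDerivAt P (f t - q) t) ∧
      ∀ t, |P t| ≤ 2 * ∫ t in Ioo (0 : ℝ) 1, |f t| := by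
  have hc : Continuous fun t => f t - q := by fun_prop
  have hper' : Function.Periodic (fun t => f t - q) 1 := fun t => by simp only [hper t]
  have hmean : ∫ t in (0 : ℝ)..1, (f t - q) = 0 := by
    rw [intervalIntegral.integral_sub (hf.intervalIntegrable _ _)
      (continuous_const.intervalIntegrable _ _), ← hq]
    simp
  let P : ℝ → ℝ := fun t => ∫ x in (0 : ℝ)..t, (f x - q)
  have hP : Function.Periodic P 1 := fun t => by
    have h1 := intervalIntegral.integral_add_adjacent_intervals
      (hc.intervalIntegrable (μ := volume) 0 t) (hc.intervalIntegrable (μ := volume) t (t + 1))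
    have h2 := hper'.intervalIntegral_add_eq t 0
    rw [zero_add] at h2
    simp only [P]
    rw [← h1, h2, hmean, add_zero]
  refine ⟨P, fun t => intervalIntegral.integral_hasDerivAt_right (hc.intervalIntegrable _ _)
    (hc.stronglyMeasurableAtFilter _ _) hc.continuousAt, fun t => ?_⟩
  obtain ⟨y, hy, hty⟩ := hP.exists_mem_Ico₀ one_pos t
  rw [hty]
  have hI : IntegrableOn (fun t => |f t|) (Ioo (0 : ℝ) 1) :=
    (Continuous.integrableOn_Icc (by fun_prop)).mono_set Ioo_subset_Icc_self
  have habs : |q| ≤ ∫ t in Ioo (0 : ℝ) 1, |f t| := by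
    rw [hq, intervalIntegral.integral_of_le zero_le_one, integral_Ioc_eq_integral_Ioo]
    exact abs_integral_le_integral_abs
  calc |P y| ≤ ∫ t in Ioo 0 y, |f t - q| := by
        simp only [P]
        rw [intervalIntegral.integral_of_le hy.1, integral_Ioc_eq_integral_Ioo]
        exact abs_integral_le_integral_abs
    _ ≤ ∫ t in Ioo (0 : ℝ) 1, |f t - q| :=
        setIntegral_Ioo_mono (by fun_prop) (fun _ => abs_nonneg _) hy.2.le
    _ ≤ ∫ t in Ioo (0 : ℝ) 1, (|f t| + |q|) := by
        refine setIntegral_mono ?_ (hI.add (integrable_const _)) fun t => abs_sub _ _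
        exact (Continuous.integrableOn_Icc (by fun_prop)).mono_set Ioo_subset_Icc_self
    _ = (∫ t in Ioo (0 : ℝ) 1, |f t|) + |q| := by
        rw [integral_add hI (integrable_const _)]
        simp
    _ ≤ _ := by linarith

/-- The mean over a period is controlled by the mean of the rescaled function over `(0, 1)`. -/
theorem integral_period_le {k : ℝ → ℝ} (hk : Continuous k) (hper : Function.Periodic k 1)
    (h0 : ∀ t, 0 ≤ k t) {ε : ℝ} (hε : 0 < ε) (hε1 : ε ≤ 1) :
    ∫ t in Ioo (0 : ℝ) 1, k t ≤ 2 * ∫ s in Ioo (0 : ℝ) 1, k (s / ε) := by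
  rw [← integral_Ioc_eq_integral_Ioo, ← integral_Ioc_eq_integral_Ioo,
    ← intervalIntegral.integral_of_le zero_le_one, ← intervalIntegral.integral_of_le zero_le_one,
    intervalIntegral.integral_comp_div _ hε.ne', zero_div, smul_eq_mul]
  -- `(0, 1 / ε)` contains `n ≥ 1` full periods, and `ε n ≥ 1 / 2`
  set n := ⌊1 / ε⌋₊
  have hn1 : 1 ≤ n := Nat.le_floor (by rw [Nat.cast_one, le_div_iff₀ hε]; linarith)
  have hn2 : (n : ℝ) ≤ 1 / ε := Nat.floor_le (by positivity)
  have hn3 : 1 / ε < n + 1 := Nat.lt_floor_add_one _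
  have hperiods : ∫ t in (0 : ℝ)..n, k t = n * ∫ t in (0 : ℝ)..1, k t := by
    have := hper.intervalIntegral_add_zsmul_eq n 0 fun a b => hk.intervalIntegrable a b
    simpa using this
  have hmono : ∫ t in (0 : ℝ)..n, k t ≤ ∫ t in (0 : ℝ)..1 / ε, k t :=
    intervalIntegral.integral_mono_interval le_rfl (by positivity) hn2 (ae_of_all _ h0)
      (hk.intervalIntegrable _ _)
  have hI : 0 ≤ ∫ t in (0 : ℝ)..1, k t :=
    intervalIntegral.integral_nonneg zero_le_one fun t _ => h0 t
  have h2n : 1 ≤ 2 * (ε * n) := by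
    have : 1 < (n + 1) * ε := (div_lt_iff₀ hε).1 hn3
    have h1 : (1 : ℝ) ≤ n := by exact_mod_cast hn1
    nlinarith
  calc ∫ t in (0 : ℝ)..1, k t ≤ 2 * (ε * n) * ∫ t in (0 : ℝ)..1, k t :=
        le_mul_of_one_le_left hI h2n
    _ = 2 * (ε * (n * ∫ t in (0 : ℝ)..1, k t)) := by ring
    _ ≤ _ := by
      rw [← hperiods]
      gcongr

theorem deriv_roughProfile {γ : ℝ → ℝ} (hγ : ContDiff ℝ ∞ γ) {ε : ℝ} (hε : 0 < ε) (s : ℝ) :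
    deriv (roughProfile γ ε) s = deriv γ (s / ε) := by
  have h1 : HasDerivAt γ (deriv γ (s / ε)) (s / ε) :=
    (hγ.differentiable (by simp) _).hasDerivAt
  have h2 : HasDerivAt (fun s => s / ε) (1 / ε) s := (hasDerivAt_id s).div_const ε
  have h3 := (h1.comp s h2).const_mul ε
  have := h3.deriv
  simp only [Function.comp_def] at this
  rw [show roughProfile γ ε = fun s => ε * γ (s / ε) from rfl, this]
  field_simp

theorem contDiff_roughProfile {γ : ℝ → ℝ} (hγ : ContDiff ℝ ∞ γ) (ε : ℝ) :
    ContDiff ℝ ∞ (roughProfile γ ε) :=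
  contDiff_const.mul (hγ.comp (contDiff_id.div_const ε))

theorem continuous_deriv_of_contDiff {γ : ℝ → ℝ} (hγ : ContDiff ℝ ∞ γ) : Continuous (deriv γ) :=
  hγ.continuous_deriv (by simp)

theorem exists_abs_le_of_periodic {f : ℝ → ℝ} (hf : Continuous f) (hper : Function.Periodic f 1) :
    ∃ C, ∀ t, |f t| ≤ C := by
  obtain ⟨C, hC⟩ := (isCompact_Icc (a := (0 : ℝ)) (b := 1)).exists_bound_of_continuousOn
    hf.continuousOn
  refine ⟨C, fun t => ?_⟩
  obtain ⟨y, hy, hty⟩ := hper.exists_mem_Ico₀ one_pos t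
  rw [hty]
  exact hC y (Ico_subset_Icc_self hy)

theorem periodic_deriv {f : ℝ → ℝ} (hper : Function.Periodic f 1) :
    Function.Periodic (deriv f) 1 := fun t => by
  rw [← deriv_comp_add_const]
  congr 1
  ext x
  exact hper x

theorem periodLength_mul_fluxMean {γ : ℝ → ℝ} (hγ : ContDiff ℝ ∞ γ) (g : ℝ → ℝ) :
    periodLength γ * fluxMean γ g = ∫ t in (0 : ℝ)..1, g t * √(1 + (deriv γ t) ^ 2) := by
  have hc := continuous_deriv_of_contDiff hγ
  have : (1 : ℝ) ≤ periodLength γ := by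
    have h1 : ∫ _ in (0 : ℝ)..1, (1 : ℝ) ≤ periodLength γ := by
      refine intervalIntegral.integral_mono_on zero_le_one (by simp)
        (Continuous.intervalIntegrable (by fun_prop) _ _) fun t _ => ?_
      exact Real.one_le_sqrt.2 (by nlinarith [sq_nonneg (deriv γ t)])
    simpa using h1
  unfold fluxMean
  field_simp

/-- The estimate of the boundary terms: on smooth functions, the oscillating flux on the rough side and
the homogenized flux on the flat side differ by `O(√δ)`, where `δ = M ε` bounds the height of the rough
side. -/
theorem abs_flux_sub_le {γ : ℝ → ℝ} (hγ : ContDiff ℝ ∞ γ) (hγper : Function.Periodic γ 1)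
    (hγ0 : ∀ t, 0 ≤ γ t) {M L : ℝ} (hM : ∀ t, γ t ≤ M) (hM1 : 1 ≤ M) (hL : ∀ t, |deriv γ t| ≤ L)
    {ε : ℝ} (hε : 0 < ε) (hεM : M * ε ≤ 1) {g : ℝ → ℝ} (hg : ContDiff ℝ ∞ g)
    (hgper : Function.Periodic g 1) {ψ : ℝ × ℝ → ℝ} (hψ : ContDiff ℝ ∞ ψ) :
    |(∫ x, oscFlux g ε x * ψ x ∂bottomMeasure (roughProfile γ ε)) -
        ∫ x, periodLength γ * fluxMean γ g * ψ x ∂bottomMeasure flatProfile| ≤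
      4 * (1 + L) * l2Norm (bottomMeasure (roughProfile γ ε)) (oscFlux g ε) *
        (√(M * ε) *
          (l2Norm (volume.restrict (region flatProfile)) (fun x => fderiv ℝ ψ x (0, 1)) +
          l2Norm (volume.restrict (region flatProfile)) (fun x => fderiv ℝ ψ x (1, 0))) +
        2 * l2Norm (dirichletMeasure flatProfile) ψ) := by
  have hdc := continuous_deriv_of_contDiff hγ
  have hcg := hg.continuous
  have hcγ := hγ.continuous
  have hch := (contDiff_roughProfile hγ ε).continuous
  have hL0 : 0 ≤ L := (abs_nonneg _).trans (hL 0)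
  have hε1 : ε ≤ 1 := by nlinarith
  let ρ : ℝ → ℝ := fun t => √(1 + (deriv γ t) ^ 2)
  have hρ : Continuous ρ := by fun_prop
  have hρ0 : ∀ t, 0 ≤ ρ t := fun t => Real.sqrt_nonneg _
  have hρL : ∀ t, ρ t ≤ 1 + L := fun t => sqrt_one_add_sq_le (hL t)
  let f : ℝ → ℝ := fun t => g t * ρ t
  have hf : Continuous f := by fun_prop
  have hfper : Function.Periodic f 1 := fun t => by
    simp only [f, ρ, hgper t, periodic_deriv hγper t]
  set q := periodLength γ * fluxMean γ g with hqdef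
  have hq : q = ∫ t in (0 : ℝ)..1, f t := periodLength_mul_fluxMean hγ g
  obtain ⟨P, hP, hPb⟩ := exists_primitive_bound hf hfper hq
  set m := ∫ t in Ioo (0 : ℝ) 1, |f t| with hm
  set N := l2Norm (bottomMeasure (roughProfile γ ε)) (oscFlux g ε)
  have hN0 : 0 ≤ N := l2Norm_nonneg _ _
  let k : ℝ → ℝ := fun t => ρ t * g t ^ 2
  have hk : Continuous k := by fun_prop
  have hk0 : ∀ t, 0 ≤ k t := fun t => mul_nonneg (hρ0 t) (sq_nonneg _)
  have hkper : Function.Periodic k 1 := fun t => by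
    simp only [k, ρ, hgper t, periodic_deriv hγper t]
  have hN : N ^ 2 = ∫ s in Ioo (0 : ℝ) 1, k (s / ε) := by
    rw [sq_l2Norm, integral_bottom hch]
    simp only [deriv_roughProfile hγ hε, oscFlux, k, ρ]
  have ic : ∀ {F : ℝ → ℝ}, Continuous F → IntegrableOn F (Ioo (0 : ℝ) 1) := fun hF =>
    hF.integrableOn_Icc.mono_set Ioo_subset_Icc_self
  have hfk : ∀ t, f t ^ 2 ≤ (1 + L) * k t := fun t => by
    have : f t ^ 2 = ρ t * k t := by simp only [f, k]; ring
    rw [this]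
    exact mul_le_mul_of_nonneg_right (hρL t) (hk0 t)
  have hm0 : 0 ≤ m := integral_nonneg fun _ => abs_nonneg _
  have hmN : m ≤ 2 * (1 + L) * N := by
    have h1 := sq_integral_abs_le (memLp_Ioo hf 0 1) zero_le_one
    have h2 : ∫ t in Ioo (0 : ℝ) 1, f t ^ 2 ≤ (1 + L) * ∫ t in Ioo (0 : ℝ) 1, k t := by
      rw [← integral_const_mul]
      exact setIntegral_mono (ic (by fun_prop)) (ic (by fun_prop)) hfk
    have h3 := integral_period_le hk hkper hk0 hε hε1
    refine abs_le_of_sq_le_sq' (a := m) ?_ (by positivity) |>.2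
    rw [← hN] at h3
    have h4 : m ^ 2 ≤ (1 + L) * (2 * N ^ 2) := by
      have := mul_le_mul_of_nonneg_left h3 (by linarith : 0 ≤ 1 + L)
      linarith
    nlinarith [mul_nonneg (mul_nonneg hL0 hL0) (sq_nonneg N), mul_nonneg hL0 (sq_nonneg N),
      sq_nonneg N]
  have hqm : |q| ≤ m := by
    rw [hq, intervalIntegral.integral_of_le zero_le_one, integral_Ioc_eq_integral_Ioo]
    exact abs_integral_le_integral_abs
  have haN : √(∫ s in Ioo (0 : ℝ) 1, f (s / ε) ^ 2) ≤ (1 + L) * N := by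
    rw [Real.sqrt_le_left (by positivity)]
    calc ∫ s in Ioo (0 : ℝ) 1, f (s / ε) ^ 2 ≤ (1 + L) * ∫ s in Ioo (0 : ℝ) 1, k (s / ε) := by
          rw [← integral_const_mul]
          exact setIntegral_mono (ic (by fun_prop)) (ic (by fun_prop)) fun s => hfk _
      _ = (1 + L) * N ^ 2 := by rw [hN]
      _ ≤ ((1 + L) * N) ^ 2 := by
        nlinarith [mul_nonneg (mul_nonneg hL0 hL0) (sq_nonneg N), mul_nonneg hL0 (sq_nonneg N)]
  have key := abs_graph_integral_sub_le (a := fun s => f (s / ε)) (A := fun s => ε * P (s / ε))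
    (h := roughProfile γ ε) (by fun_prop) (q := q) (B := ε * (2 * m)) (δ := M * ε) (fun s => by
      have := ((hP (s / ε)).comp s ((hasDerivAt_id s).div_const ε)).const_mul ε
      refine this.congr_deriv ?_
      field_simp) (fun s => by
      rw [abs_mul, abs_of_pos hε]
      exact mul_le_mul_of_nonneg_left (hPb _) hε.le) hch
    (fun s => mul_nonneg hε.le (hγ0 _)) (fun s => by
      rw [mul_comm M]
      exact mul_le_mul_of_nonneg_left (hM _) hε.le) (by positivity) hεM hψ
  have e1 : ∫ x, oscFlux g ε x * ψ x ∂bottomMeasure (roughProfile γ ε) =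
      ∫ s in Ioo (0 : ℝ) 1, f (s / ε) * ψ (s, roughProfile γ ε s) := by
    rw [integral_bottom hch]
    refine integral_congr_ae (ae_of_all _ fun s => ?_)
    simp only [deriv_roughProfile hγ hε, oscFlux, f, ρ]
    ring
  have e2 : ∫ x, q * ψ x ∂bottomMeasure flatProfile = ∫ s in Ioo (0 : ℝ) 1, q * ψ (s, 0) := by
    rw [integral_bottom continuous_flatProfile]
    refine integral_congr_ae (ae_of_all _ fun s => ?_)
    have : deriv flatProfile s = 0 := deriv_const s 0
    simp [this, flatProfile]
  rw [e1, e2]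
  refine key.trans ?_
  set N1 := l2Norm (volume.restrict (region flatProfile)) (fun x => fderiv ℝ ψ x (1, 0))
  set N2 := l2Norm (volume.restrict (region flatProfile)) (fun x => fderiv ℝ ψ x (0, 1))
  set d := l2Norm (dirichletMeasure flatProfile) ψ
  have hN1 : 0 ≤ N1 := l2Norm_nonneg _ _
  have hN2 : 0 ≤ N2 := l2Norm_nonneg _ _
  have hd : 0 ≤ d := l2Norm_nonneg _ _
  have hLN : 0 ≤ (1 + L) * N := by positivity
  have hB : ε * (2 * m) / (M * ε) ≤ 4 * (1 + L) * N := by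
    rw [div_le_iff₀ (by positivity)]
    have : 2 * m ≤ 4 * (1 + L) * N * M := by nlinarith
    nlinarith
  calc _ ≤ √(M * ε) * ((1 + L) * N + 2 * (1 + L) * N) * N2 +
        4 * (1 + L) * N * (√(M * ε) * N1 + 2 * d) := by
        have := hqm.trans hmN
        gcongr
    _ ≤ _ := by
      have : 0 ≤ √(M * ε) * ((1 + L) * N) * N2 := by positivity
      nlinarith

/-! ### The error estimate -/

section
variable {h : ℝ → ℝ} {v : ℝ × ℝ → ℝ} {G : ℝ × ℝ → ℝ × ℝ} {φ : ℕ → ℝ × ℝ → ℝ}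

theorem IsDirichletLimit.tendsto_l2Norm_fst (H : IsDirichletLimit h v G φ) (hc : Continuous h)
    (h0 : ∀ s, 0 ≤ h s) :
    Tendsto (fun n => l2Norm (volume.restrict (region h)) fun x => fderiv ℝ (φ n) x (1, 0)) atTop
      (𝓝 (l2Norm (volume.restrict (region h)) fun x => (G x).1)) :=
  tendsto_eLpNorm_of_sub (fun n => memLp_region hc h0 (continuous_fderiv_apply (H.smooth n) _))
    H.memLp_fst H.tendsto_fst

theorem IsDirichletLimit.tendsto_l2Norm_snd (H : IsDirichletLimit h v G φ) (hc : Continuous h)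
    (h0 : ∀ s, 0 ≤ h s) :
    Tendsto (fun n => l2Norm (volume.restrict (region h)) fun x => fderiv ℝ (φ n) x (0, 1)) atTop
      (𝓝 (l2Norm (volume.restrict (region h)) fun x => (G x).2)) :=
  tendsto_eLpNorm_of_sub (fun n => memLp_region hc h0 (continuous_fderiv_apply (H.smooth n) _))
    H.memLp_snd H.tendsto_snd

theorem IsDirichletLimit.l2Norm_strip_le (H : IsDirichletLimit h v G φ) (hc : Continuous h)
    (h0 : ∀ s, 0 ≤ h s) {δ : ℝ} (hδ : 0 ≤ δ) :
    l2Norm (volume.restrict (region h ∩ {x | x.2 < δ})) v ≤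
      2 * √δ * l2Norm (volume.restrict (region h)) fun x => (G x).2 := by
  have hm : (volume.restrict (region h ∩ {x | x.2 < δ}) : Measure (ℝ × ℝ)) ≤
    volume.restrict (region h) := Measure.restrict_mono inter_subset_left le_rfl
  have t1 := (tendsto_eLpNorm_of_sub (fun n =>
    (memLp_region hc h0 (H.smooth n).continuous).mono_measure hm) (H.memLp.mono_measure hm)
    (tendsto_zero_of_le H.tendsto fun n => eLpNorm_mono_measure _ hm)).pow 2
  have t2 := ((((H.tendsto_l2Norm_dirichlet h0).pow 2).const_mul 2).add
    (((H.tendsto_l2Norm_snd hc h0).pow 2).const_mul 2)).const_mul δ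
  have h1 := le_of_tendsto_of_tendsto' t1 t2 fun n => by
    rw [sq_l2Norm (volume.restrict (region h ∩ {x | x.2 < δ}))]
    exact strip_le hc h0 (H.smooth n) hδ
  have hN := l2Norm_nonneg (volume.restrict (region h)) fun x => (G x).2
  refine abs_le_of_sq_le_sq' ?_ (by positivity) |>.2
  rw [mul_pow, mul_pow, Real.sq_sqrt hδ]
  refine h1.trans ?_
  nlinarith [mul_nonneg hδ (sq_nonneg (l2Norm (volume.restrict (region h)) fun x => (G x).2))]

theorem IsDirichletLimit.l2Norm_le (H : IsDirichletLimit h v G φ) (hc : Continuous h)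
    (h0 : ∀ s, 0 ≤ h s) :
    l2Norm (volume.restrict (region h)) v ≤
      2 * l2Norm (volume.restrict (region h)) fun x => (G x).2 := by
  have := H.l2Norm_strip_le hc h0 zero_le_one
  have e : region h ∩ {x | x.2 < 1} = region h := inter_eq_left.2 fun x hx => hx.2.2.2
  rwa [e, Real.sqrt_one, mul_one] at this

theorem IsDirichletLimit.l2Norm_trace_le (H : IsDirichletLimit h v G φ) (hc : Continuous h)
    (h0 : ∀ s, 0 ≤ h s) (h1 : ∀ s, h s ≤ 1) {L : ℝ} (hL : ∀ s, |deriv h s| ≤ L) {τ : ℝ × ℝ → ℝ}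
    (hτ : MemLp τ 2 (bottomMeasure h))
    (hlim : Tendsto (fun n => eLpNorm (fun x => φ n x - τ x) 2 (bottomMeasure h)) atTop (𝓝 0)) :
    l2Norm (bottomMeasure h) τ ≤
      2 * (1 + L) * l2Norm (volume.restrict (region h)) fun x => (G x).2 := by
  have hL0 : 0 ≤ L := (abs_nonneg _).trans (hL 0)
  have t1 := (tendsto_eLpNorm_of_sub (fun n => memLp_bottom hL hc h0 h1 (H.smooth n).continuous)
    hτ hlim).pow 2
  have t2 := ((((H.tendsto_l2Norm_dirichlet h0).pow 2).const_mul 2).add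
    (((H.tendsto_l2Norm_snd hc h0).pow 2).const_mul 2)).const_mul (1 + L)
  have h2 := le_of_tendsto_of_tendsto' t1 t2 fun n =>
    (sq_l2Norm_bottom_le hL hc (H.smooth n).continuous).trans
      (mul_le_mul_of_nonneg_left (trace_le hc h0 (H.smooth n) (fun _ _ => le_rfl) h1)
        (by linarith))
  have hN := l2Norm_nonneg (volume.restrict (region h)) fun x => (G x).2
  refine abs_le_of_sq_le_sq' ?_ (by positivity) |>.2
  refine h2.trans ?_
  have hN2 := sq_nonneg (l2Norm (volume.restrict (region h)) fun x => (G x).2)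
  nlinarith [mul_nonneg hL0 hN2, mul_nonneg (mul_nonneg hL0 hL0) hN2]

end

theorem sq_l2NormVec {D : Set (ℝ × ℝ)} {G : ℝ × ℝ → ℝ × ℝ}
    (h1 : MemLp (fun x => (G x).1) 2 (volume.restrict D))
    (h2 : MemLp (fun x => (G x).2) 2 (volume.restrict D)) :
    l2NormVec D G ^ 2 = l2Norm (volume.restrict D) (fun x => (G x).1) ^ 2 +
      l2Norm (volume.restrict D) (fun x => (G x).2) ^ 2 := by
  rw [sq_l2Norm, sq_l2Norm, ← integral_add h1.integrable_sq h2.integrable_sq, l2NormVec,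
    Real.sq_sqrt (integral_nonneg fun _ => by positivity)]

theorem l2NormVec_nonneg (D : Set (ℝ × ℝ)) (G : ℝ × ℝ → ℝ × ℝ) : 0 ≤ l2NormVec D G :=
  Real.sqrt_nonneg _

theorem l2Norm_le_l2NormVec {D : Set (ℝ × ℝ)} {G : ℝ × ℝ → ℝ × ℝ}
    (h1 : MemLp (fun x => (G x).1) 2 (volume.restrict D))
    (h2 : MemLp (fun x => (G x).2) 2 (volume.restrict D)) :
    l2Norm (volume.restrict D) (fun x => (G x).1) ≤ l2NormVec D G ∧
      l2Norm (volume.restrict D) (fun x => (G x).2) ≤ l2NormVec D G := by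
  have h := sq_l2NormVec h1 h2
  constructor <;> refine abs_le_of_sq_le_sq' ?_ (l2NormVec_nonneg D G) |>.2 <;> rw [h]
  · linarith [sq_nonneg (l2Norm (volume.restrict D) fun x => (G x).2)]
  · linarith [sq_nonneg (l2Norm (volume.restrict D) fun x => (G x).1)]

theorem l2NormVec_le_add {D : Set (ℝ × ℝ)} {G : ℝ × ℝ → ℝ × ℝ}
    (h1 : MemLp (fun x => (G x).1) 2 (volume.restrict D))
    (h2 : MemLp (fun x => (G x).2) 2 (volume.restrict D)) :
    l2NormVec D G ≤ l2Norm (volume.restrict D) (fun x => (G x).1) +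
      l2Norm (volume.restrict D) (fun x => (G x).2) := by
  have a := l2Norm_nonneg (volume.restrict D) fun x => (G x).1
  have b := l2Norm_nonneg (volume.restrict D) fun x => (G x).2
  refine abs_le_of_sq_le_sq' ?_ (by positivity) |>.2
  rw [sq_l2NormVec h1 h2]
  nlinarith

theorem l2NormVec_le_h1NormVec (D : Set (ℝ × ℝ)) (G K₁ K₂ : ℝ × ℝ → ℝ × ℝ) :
    l2NormVec D G ≤ h1NormVec D G K₁ K₂ ∧ l2NormVec D K₁ ≤ h1NormVec D G K₁ K₂ ∧
      l2NormVec D K₂ ≤ h1NormVec D G K₁ K₂ := by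
  have a := sq_nonneg (l2NormVec D G)
  have b := sq_nonneg (l2NormVec D K₁)
  have c := sq_nonneg (l2NormVec D K₂)
  refine ⟨?_, ?_, ?_⟩ <;> exact Real.le_sqrt_of_sq_le (by linarith)

/-- The energy estimate for weak solutions. -/
theorem l2NormVec_le_of_isWeakSolution {h : ℝ → ℝ} (hc : Continuous h) (h0 : ∀ s, 0 ≤ h s)
    (h1 : ∀ s, h s ≤ 1) {L : ℝ} (hL : ∀ s, |deriv h s| ≤ L) {f q u : ℝ × ℝ → ℝ}
    {G : ℝ × ℝ → ℝ × ℝ} (hf : MemLp f 2 (volume.restrict (region h)))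
    (hq : MemLp q 2 (bottomMeasure h)) (hu : IsWeakSolution h f q u G) :
    l2NormVec (region h) G ≤ 2 * (1 + L) *
      (l2Norm (volume.restrict (region h)) f + l2Norm (bottomMeasure h) q) := by
  have hL0 : 0 ≤ L := (abs_nonneg _).trans (hL 0)
  obtain ⟨⟨τ, hτ⟩, hweak⟩ := hu
  obtain ⟨φ, H, hlim⟩ := hτ.exists_isDirichletLimit
  have hτb : MemLp τ 2 (bottomMeasure h) :=
    hτ.isTrace.1.mono_measure (Measure.le_add_right le_rfl)
  have hE := hweak u G τ hτ
  have e : ∫ x in region h, ((G x).1 * (G x).1 + (G x).2 * (G x).2) = l2NormVec (region h) G ^ 2 := by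
    rw [l2NormVec, Real.sq_sqrt (integral_nonneg fun _ => by positivity)]
    simp only [pow_two]
  rw [e] at hE
  have b1 := (le_abs_self _).trans (abs_integral_mul_le hf H.memLp)
  have b2 := (le_abs_self _).trans (abs_integral_mul_le hq hτb)
  have b3 := H.l2Norm_le hc h0
  have b4 := H.l2Norm_trace_le hc h0 h1 hL hτb hlim
  have b5 := (l2Norm_le_l2NormVec H.memLp_fst H.memLp_snd).2
  have hF := l2Norm_nonneg (volume.restrict (region h)) f
  have hN := l2Norm_nonneg (bottomMeasure h) q
  have hE0 := l2NormVec_nonneg (region h) G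
  set E := l2NormVec (region h) G
  set F := l2Norm (volume.restrict (region h)) f
  set N := l2Norm (bottomMeasure h) q
  have c1 : l2Norm (volume.restrict (region h)) u ≤ 2 * (1 + L) * E := by
    refine b3.trans ?_
    have : 0 ≤ L * E := by positivity
    nlinarith
  have c2 : l2Norm (bottomMeasure h) τ ≤ 2 * (1 + L) * E := b4.trans (by gcongr)
  have key : E ^ 2 ≤ 2 * (1 + L) * (F + N) * E := by
    rw [hE]
    have d1 := b1.trans (mul_le_mul_of_nonneg_left c1 hF)
    have d2 := b2.trans (mul_le_mul_of_nonneg_left c2 hN)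
    linarith
  rcases hE0.eq_or_lt with h' | h'
  · rw [← h']; positivity
  · nlinarith

/-- The homogenization error for a thin boundary layer. The weak form on the rough domain and the weak form
on the square are tested with the same function, the extension of the error by reflection. -/
theorem error_le_of_thin {γ : ℝ → ℝ} (hγ : ContDiff ℝ ∞ γ) (hγper : Function.Periodic γ 1)
    (hγ0 : ∀ t, 0 ≤ γ t) {M L : ℝ} (hM : ∀ t, γ t < M) (hM1 : 1 ≤ M) (hL : ∀ t, |deriv γ t| ≤ L)
    {ε : ℝ} (hε : 0 < ε) (hεM : M * ε ≤ 1 / 4) {g : ℝ → ℝ} (hg : ContDiff ℝ ∞ g)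
    (hgper : Function.Periodic g 1) {f : ℝ × ℝ → ℝ}
    (hf : MemLp f 2 (volume.restrict (region flatProfile)))
    {uε u₀ : ℝ × ℝ → ℝ} {Gε G₀ : ℝ × ℝ → ℝ × ℝ}
    (huε : IsWeakSolution (roughProfile γ ε) f (oscFlux g ε) uε Gε)
    (hu₀ : IsWeakSolution flatProfile f (fun _ => periodLength γ * fluxMean γ g) u₀ G₀)
    {K₁ K₂ : ℝ × ℝ → ℝ × ℝ} (hK₁ : HasH1Grad (region flatProfile) (fun x => (G₀ x).1) K₁)
    (hK₂ : HasH1Grad (region flatProfile) (fun x => (G₀ x).2) K₂) :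
    l2NormVec (region (roughProfile γ ε)) (fun x => Gε x - G₀ x) ≤ 16 * (1 + L) ^ 2 * √(M * ε) *
      (l2Norm (volume.restrict (region flatProfile)) f + h1NormVec (region flatProfile) G₀ K₁ K₂ +
        l2Norm (bottomMeasure (roughProfile γ ε)) (oscFlux g ε)) := by
  have hL0 : 0 ≤ L := (abs_nonneg _).trans (hL 0)
  have hh := contDiff_roughProfile hγ ε
  set h := roughProfile γ ε with hdef
  have hc := hh.continuous
  have hcfl := continuous_flatProfile
  have hfl : ∀ s, 0 ≤ flatProfile s := fun _ => le_rfl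
  have hfl1 : ∀ s, flatProfile s < 1 := fun _ => zero_lt_one
  have hLfl : ∀ s, |deriv flatProfile s| ≤ 0 := fun s => by
    have : deriv flatProfile s = 0 := deriv_const s 0
    simp [this]
  have h0 : ∀ s, 0 ≤ h s := fun s => mul_nonneg hε.le (hγ0 _)
  have hhδ : ∀ s, h s < M * ε := fun s => by
    rw [mul_comm M]
    exact mul_lt_mul_of_pos_left (hM _) hε
  have h1 : ∀ s, h s < 1 := fun s => (hhδ s).trans_le (by linarith)
  have hhalf : ∀ s, h s ≤ 1 / 2 := fun s => (hhδ s).le.trans (by linarith)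
  have hhL : ∀ s, |deriv h s| ≤ L := fun s => by
    rw [hdef, deriv_roughProfile hγ hε]
    exact hL _
  have hδ : 0 < M * ε := by positivity
  set q := periodLength γ * fluxMean γ g
  -- the error, its extension, and its traces on the rough and on the flat side
  obtain ⟨⟨τε, hτε⟩, hweakε⟩ := huε
  obtain ⟨⟨τ₀, hτ₀⟩, hweak₀⟩ := hu₀
  obtain ⟨φε, Hε, -⟩ := hτε.exists_isDirichletLimit
  obtain ⟨φ₀, H₀, -⟩ := hτ₀.exists_isDirichletLimit
  have Herr := Hε.sub hc h0 (H₀.restrict h0)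
  obtain ⟨W, H, ψ, HW, -, hHG, hH1, hH2⟩ := Herr.exists_extension hh h0 hhalf hhL
  have HWr : IsDirichletLimit h W H ψ := HW.restrict h0
  obtain ⟨τW, hτW, hτWb, hlimW⟩ := HW.exists_memV hcfl hfl hfl1 hLfl
  obtain ⟨τw, hτw, hτwb, hlimw⟩ := HWr.exists_memV hc h0 h1 hhL
  -- the same function `W` is admissible in both problems
  have eqε := hweakε W H τw hτw
  have eq₀ := hweak₀ W H τW hτW
  set D := region h with hD
  set D₀ := region flatProfile with hD₀
  have hDm : MeasurableSet D := measurableSet_region hc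
  have hDsub : D ⊆ D₀ := region_subset_region_flat h0
  -- the rough layer is contained in the strip of width `M ε`
  have hS : D₀ \ D ⊆ D₀ ∩ {x | x.2 < M * ε} := fun x hx => by
    refine ⟨hx.1, ?_⟩
    have : ¬ h x.1 < x.2 := fun hlt => hx.2 ⟨hx.1.1, hx.1.2.1, hlt, hx.1.2.2.2⟩
    exact (not_lt.1 this).trans_lt (hhδ _)
  have mS : (volume.restrict (D₀ \ D) : Measure (ℝ × ℝ)) ≤ volume.restrict D₀ :=
    Measure.restrict_mono sdiff_subset le_rfl
  have mS' : (volume.restrict (D₀ \ D) : Measure (ℝ × ℝ)) ≤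
    volume.restrict (D₀ ∩ {x | x.2 < M * ε}) := Measure.restrict_mono hS le_rfl
  have mT : (volume.restrict (D₀ ∩ {x | x.2 < M * ε}) : Measure (ℝ × ℝ)) ≤ volume.restrict D₀ :=
    Measure.restrict_mono inter_subset_left le_rfl
  have mD : (volume.restrict D : Measure (ℝ × ℝ)) ≤ volume.restrict D₀ :=
    Measure.restrict_mono hDsub le_rfl
  have split : ∀ {F : ℝ × ℝ → ℝ}, Integrable F (volume.restrict D₀) →
      ∫ x in D₀, F x = (∫ x in D, F x) + ∫ x in D₀ \ D, F x := fun hF => by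
    rw [setIntegral_sdiff hDm hF hDsub]
    ring
  have iG₀H : Integrable (fun x => (G₀ x).1 * (H x).1 + (G₀ x).2 * (H x).2) (volume.restrict D₀) :=
    (integrable_mul_of_memLp hK₁.memLp HW.memLp_fst).add
      (integrable_mul_of_memLp hK₂.memLp HW.memLp_snd)
  have iGεH : Integrable (fun x => (Gε x).1 * (H x).1 + (Gε x).2 * (H x).2) (volume.restrict D) :=
    (integrable_mul_of_memLp Hε.memLp_fst HWr.memLp_fst).add
      (integrable_mul_of_memLp Hε.memLp_snd HWr.memLp_snd)
  rw [split iG₀H, split (integrable_mul_of_memLp hf HW.memLp)] at eq₀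
  set E := l2NormVec D (fun x => Gε x - G₀ x)
  have hE : E ^ 2 = (∫ x in D, ((Gε x).1 * (H x).1 + (Gε x).2 * (H x).2)) -
      ∫ x in D, ((G₀ x).1 * (H x).1 + (G₀ x).2 * (H x).2) := by
    rw [← integral_sub iGεH (iG₀H.mono_measure mD)]
    simp only [E, l2NormVec]
    rw [Real.sq_sqrt (integral_nonneg fun _ => by positivity)]
    refine setIntegral_congr_fun hDm fun x hx => ?_
    simp only [hHG x hx, Prod.fst_sub, Prod.snd_sub]
    ring
  set U := h1NormVec D₀ G₀ K₁ K₂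
  set F := l2Norm (volume.restrict D₀) f
  set N := l2Norm (bottomMeasure h) (oscFlux g ε)
  set n1 := l2Norm (volume.restrict D₀) (fun x => (H x).1)
  set n2 := l2Norm (volume.restrict D₀) (fun x => (H x).2)
  have hn1 : 0 ≤ n1 := l2Norm_nonneg _ _
  have hn2 : 0 ≤ n2 := l2Norm_nonneg _ _
  have hF0 : 0 ≤ F := l2Norm_nonneg _ _
  have hN0 : 0 ≤ N := l2Norm_nonneg _ _
  have hU0 : 0 ≤ U := Real.sqrt_nonneg _
  have hE0 : 0 ≤ E := l2NormVec_nonneg _ _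
  have hs0 : 0 ≤ √(M * ε) := Real.sqrt_nonneg _
  -- the three error terms
  have T1 : |∫ x in D₀ \ D, f x * W x| ≤ F * (2 * √(M * ε) * n2) := by
    refine (abs_integral_mul_le (hf.mono_measure mS) (HW.memLp.mono_measure mS)).trans ?_
    refine mul_le_mul (l2Norm_mono_measure hf mS) ?_ (l2Norm_nonneg _ _) hF0
    exact (l2Norm_mono_measure (HW.memLp.mono_measure mT) mS').trans
      (HW.l2Norm_strip_le hcfl hfl hδ.le)
  have hUs := l2NormVec_le_h1NormVec D₀ G₀ K₁ K₂
  have hUG := l2Norm_le_l2NormVec hK₁.memLp hK₂.memLp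
  have strip : ∀ {w : ℝ × ℝ → ℝ} {K : ℝ × ℝ → ℝ × ℝ}, HasH1Grad D₀ w K →
      l2Norm (volume.restrict D₀) w ≤ U → l2Norm (volume.restrict D₀) (fun x => (K x).2) ≤ U →
      l2Norm (volume.restrict (D₀ \ D)) w ≤ 4 * √(M * ε) * U := fun hw a b => by
    refine (l2Norm_mono_measure (hw.memLp.mono_measure mT) mS').trans ?_
    refine (strip_le_of_hasH1Grad hw hδ (by linarith)).trans ?_
    nlinarith
  have s1 := strip hK₁ (hUG.1.trans hUs.1)
    ((l2Norm_le_l2NormVec hK₁.memLp_fst hK₁.memLp_snd).2.trans hUs.2.1)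
  have s2 := strip hK₂ (hUG.2.trans hUs.1)
    ((l2Norm_le_l2NormVec hK₂.memLp_fst hK₂.memLp_snd).2.trans hUs.2.2)
  have T2 : |∫ x in D₀ \ D, ((G₀ x).1 * (H x).1 + (G₀ x).2 * (H x).2)| ≤
      4 * √(M * ε) * U * n1 + 4 * √(M * ε) * U * n2 := by
    rw [integral_add ((integrable_mul_of_memLp hK₁.memLp HW.memLp_fst).mono_measure mS)
      ((integrable_mul_of_memLp hK₂.memLp HW.memLp_snd).mono_measure mS)]
    refine (abs_add_le _ _).trans (add_le_add ?_ ?_)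
    · refine (abs_integral_mul_le (hK₁.memLp.mono_measure mS)
        (HW.memLp_fst.mono_measure mS)).trans ?_
      exact mul_le_mul s1 (l2Norm_mono_measure HW.memLp_fst mS) (l2Norm_nonneg _ _) (by positivity)
    · refine (abs_integral_mul_le (hK₂.memLp.mono_measure mS)
        (HW.memLp_snd.mono_measure mS)).trans ?_
      exact mul_le_mul s2 (l2Norm_mono_measure HW.memLp_snd mS) (l2Norm_nonneg _ _) (by positivity)
  have T3 : |(∫ x, oscFlux g ε x * τw x ∂bottomMeasure h) -
      ∫ x, q * τW x ∂bottomMeasure flatProfile| ≤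
      4 * (1 + L) * N * (√(M * ε) * (n2 + n1) + 2 * 0) := by
    have hcosc : Continuous (oscFlux g ε) := by
      have := hg.continuous
      unfold oscFlux
      fun_prop
    have l1 := tendsto_integral_mul (fun n => memLp_bottom hhL hc h0 (fun s => (h1 s).le)
      (HW.smooth n).continuous) hτwb hlimw (memLp_bottom hhL hc h0 (fun s => (h1 s).le) hcosc)
    have l2 := tendsto_integral_mul (fun n => memLp_bottom hLfl hcfl hfl (fun s => (hfl1 s).le)
      (HW.smooth n).continuous) hτWb hlimW
      (memLp_bottom hLfl hcfl hfl (fun s => (hfl1 s).le) (continuous_const (y := q)))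
    refine le_of_tendsto_of_tendsto' (l1.sub l2).abs ((((((HW.tendsto_l2Norm_snd hcfl hfl).add
      (HW.tendsto_l2Norm_fst hcfl hfl)).const_mul _).add
        ((HW.tendsto_l2Norm_dirichlet hfl).const_mul 2))).const_mul _) fun n => ?_
    exact abs_flux_sub_le hγ hγper hγ0 (fun t => (hM t).le) hM1 hL hε (by linarith) hg hgper
      (HW.smooth n)
  have hsum : E ^ 2 ≤ 4 * (1 + L) * √(M * ε) * (F + U + N) * (n1 + n2) := by
    have eE : E ^ 2 = -(∫ x in D₀ \ D, f x * W x) +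
        (∫ x in D₀ \ D, ((G₀ x).1 * (H x).1 + (G₀ x).2 * (H x).2)) +
        ((∫ x, oscFlux g ε x * τw x ∂bottomMeasure h) -
          ∫ x, q * τW x ∂bottomMeasure flatProfile) := by
      rw [hE]
      linarith
    rw [eE]
    have a1 := (abs_le.1 T1).1
    have a2 := (abs_le.1 T2).2
    have a3 := (abs_le.1 T3).2
    have p1 : 0 ≤ √(M * ε) * F * n1 := by positivity
    have p2 : 0 ≤ √(M * ε) * F * n2 := by positivity
    have p3 : 0 ≤ L * (√(M * ε) * F * n1) := by positivity
    have p4 : 0 ≤ L * (√(M * ε) * F * n2) := by positivity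
    have p5 : 0 ≤ L * (√(M * ε) * U * n1) := by positivity
    have p6 : 0 ≤ L * (√(M * ε) * U * n2) := by positivity
    linarith
  have hg := l2Norm_le_l2NormVec Herr.memLp_fst Herr.memLp_snd
  have hnE : n1 + n2 ≤ 4 * (1 + L) * E := by
    have := mul_le_mul_of_nonneg_left hg.2 hL0
    linarith [hg.1, hg.2]
  have hfin : E ^ 2 ≤ 16 * (1 + L) ^ 2 * √(M * ε) * (F + U + N) * E := by
    refine hsum.trans ((mul_le_mul_of_nonneg_left hnE (by positivity)).trans (le_of_eq ?_))
    ring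
  rcases hE0.eq_or_lt with h' | h'
  · rw [← h']; positivity
  · nlinarith

/-- A bound without the factor `√ε`, from the energy estimate for the rough problem alone: `∇u₀` is bounded by
its own `H¹` norm. -/
theorem error_le_of_thick {γ : ℝ → ℝ} (hγ : ContDiff ℝ ∞ γ)
    (hγ0 : ∀ t, 0 ≤ γ t) {L : ℝ} (hL : ∀ t, |deriv γ t| ≤ L)
    {ε : ℝ} (hε : 0 < ε) (hγε : ∀ t, ε * γ t < 1) {g : ℝ → ℝ} (hg : ContDiff ℝ ∞ g)
    {f : ℝ × ℝ → ℝ} (hf : MemLp f 2 (volume.restrict (region flatProfile)))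
    {uε : ℝ × ℝ → ℝ} {Gε G₀ : ℝ × ℝ → ℝ × ℝ}
    (huε : IsWeakSolution (roughProfile γ ε) f (oscFlux g ε) uε Gε)
    {K₁ K₂ : ℝ × ℝ → ℝ × ℝ} (hK₁ : HasH1Grad (region flatProfile) (fun x => (G₀ x).1) K₁)
    (hK₂ : HasH1Grad (region flatProfile) (fun x => (G₀ x).2) K₂) :
    l2NormVec (region (roughProfile γ ε)) (fun x => Gε x - G₀ x) ≤ 4 * (1 + L) *
      (l2Norm (volume.restrict (region flatProfile)) f + h1NormVec (region flatProfile) G₀ K₁ K₂ +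
        l2Norm (bottomMeasure (roughProfile γ ε)) (oscFlux g ε)) := by
  have hL0 : 0 ≤ L := (abs_nonneg _).trans (hL 0)
  have hc := (contDiff_roughProfile hγ ε).continuous
  have h0 : ∀ s, 0 ≤ roughProfile γ ε s := fun s => mul_nonneg hε.le (hγ0 _)
  have h1 : ∀ s, roughProfile γ ε s ≤ 1 := fun s => (hγε _).le
  have hhL : ∀ s, |deriv (roughProfile γ ε) s| ≤ L := fun s => by
    rw [deriv_roughProfile hγ hε]
    exact hL _
  have mD : (volume.restrict (region (roughProfile γ ε)) : Measure (ℝ × ℝ)) ≤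
    volume.restrict (region flatProfile) :=
      Measure.restrict_mono (region_subset_region_flat h0) le_rfl
  have hcosc : Continuous (oscFlux g ε) := by
    have := hg.continuous
    unfold oscFlux
    fun_prop
  have hen := l2NormVec_le_of_isWeakSolution hc h0 h1 hhL (hf.mono_measure mD)
    (memLp_bottom hhL hc h0 h1 hcosc) huε
  have hfD := l2Norm_mono_measure hf mD
  obtain ⟨⟨τ, hτ⟩, -⟩ := huε
  have m1 := hτ.hasH1Grad.memLp_fst
  have m2 := hτ.hasH1Grad.memLp_snd
  have k1 := hK₁.memLp.mono_measure mD
  have k2 := hK₂.memLp.mono_measure mD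
  have hsub : ∀ {a b : ℝ × ℝ → ℝ}, MemLp a 2 (volume.restrict (region (roughProfile γ ε))) →
      MemLp b 2 (volume.restrict (region (roughProfile γ ε))) →
      l2Norm (volume.restrict (region (roughProfile γ ε))) (fun x => a x - b x) ≤
        l2Norm (volume.restrict (region (roughProfile γ ε))) a +
        l2Norm (volume.restrict (region (roughProfile γ ε))) b := fun ha hb => by
    have := l2Norm_add_le ha hb.neg
    simpa [sub_eq_add_neg, l2Norm] using this
  have a1 := hsub m1 k1
  have a2 := hsub m2 k2
  have b := l2Norm_le_l2NormVec m1 m2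
  have hU := (l2NormVec_le_h1NormVec (region flatProfile) G₀ K₁ K₂).1
  have c := l2Norm_le_l2NormVec hK₁.memLp hK₂.memLp
  have d1 := l2Norm_mono_measure hK₁.memLp mD
  have d2 := l2Norm_mono_measure hK₂.memLp mD
  have e := l2NormVec_le_add (G := fun x => Gε x - G₀ x) (m1.sub k1) (m2.sub k2)
  simp only [Prod.fst_sub, Prod.snd_sub] at e
  have hU0 : 0 ≤ h1NormVec (region flatProfile) G₀ K₁ K₂ := Real.sqrt_nonneg _
  have f1 := mul_le_mul_of_nonneg_left hfD hL0
  have f2 := mul_nonneg hL0 hU0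
  linarith [b.1, b.2, c.1, c.2]

end RoughNeumann

end

theorem mainTheorem4 (γ : ℝ → ℝ) (hγ : ContDiff ℝ ∞ γ) (hγper : Function.Periodic γ 1)
    (hγnonneg : ∀ t, 0 ≤ γ t) :
    ∃ C : ℝ, 0 < C ∧
      ∀ (ε : ℝ), 0 < ε → (∀ t, ε * γ t < 1) →
      ∀ (g : ℝ → ℝ), ContDiff ℝ ∞ g → Function.Periodic g 1 →
      ∀ (f : ℝ × ℝ → ℝ),
        MemLp f 2 (volume.restrict (RoughNeumann.region RoughNeumann.flatProfile)) →
      ∀ (uε u₀ : ℝ × ℝ → ℝ) (Gε G₀ : ℝ × ℝ → ℝ × ℝ),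
        RoughNeumann.IsWeakSolution (RoughNeumann.roughProfile γ ε) f
          (RoughNeumann.oscFlux g ε) uε Gε →
        RoughNeumann.IsWeakSolution RoughNeumann.flatProfile f
          (fun _ => RoughNeumann.periodLength γ * RoughNeumann.fluxMean γ g) u₀ G₀ →
      ∀ (K₁ K₂ : ℝ × ℝ → ℝ × ℝ),
        RoughNeumann.HasH1Grad (RoughNeumann.region RoughNeumann.flatProfile)
          (fun x => (G₀ x).1) K₁ →
        RoughNeumann.HasH1Grad (RoughNeumann.region RoughNeumann.flatProfile)
          (fun x => (G₀ x).2) K₂ →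
        RoughNeumann.l2NormVec (RoughNeumann.region (RoughNeumann.roughProfile γ ε))
            (fun x => Gε x - G₀ x) ≤
          C * √ε *
            (RoughNeumann.l2Norm
                (volume.restrict (RoughNeumann.region RoughNeumann.flatProfile)) f +
              RoughNeumann.h1NormVec (RoughNeumann.region RoughNeumann.flatProfile) G₀ K₁ K₂ +
              RoughNeumann.l2Norm
                (RoughNeumann.bottomMeasure (RoughNeumann.roughProfile γ ε))
                (RoughNeumann.oscFlux g ε)) := by
  obtain ⟨C, hC⟩ := RoughNeumann.exists_abs_le_of_periodic hγ.continuous hγper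
  obtain ⟨L, hL⟩ := RoughNeumann.exists_abs_le_of_periodic
    (RoughNeumann.continuous_deriv_of_contDiff hγ) (RoughNeumann.periodic_deriv hγper)
  have hC0 : 0 ≤ C := (abs_nonneg _).trans (hC 0)
  have hL0 : 0 ≤ L := (abs_nonneg _).trans (hL 0)
  -- the strict bound makes the strip of height `(1 + C) ε` contain the rough layer with its boundary
  have hM : ∀ t, γ t < 1 + C := fun t => by linarith [le_abs_self (γ t), hC t]
  refine ⟨16 * (1 + L) ^ 2 * √(1 + C), by positivity, ?_⟩
  intro ε hε hγε g hg hgper f hf uε u₀ Gε G₀ huε hu₀ K₁ K₂ hK₁ hK₂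
  by_cases hthin : (1 + C) * ε ≤ 1 / 4
  · have := RoughNeumann.error_le_of_thin hγ hγper hγnonneg hM (by linarith) hL hε hthin hg hgper hf
      huε hu₀ hK₁ hK₂
    rwa [Real.sqrt_mul (by positivity), ← mul_assoc] at this
  · refine (RoughNeumann.error_le_of_thick hγ hγnonneg hL hε hγε hg hf huε hK₁ hK₂).trans ?_
    have hnn : 0 ≤ RoughNeumann.l2Norm (volume.restrict
        (RoughNeumann.region RoughNeumann.flatProfile)) f +
        RoughNeumann.h1NormVec (RoughNeumann.region RoughNeumann.flatProfile) G₀ K₁ K₂ +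
        RoughNeumann.l2Norm (RoughNeumann.bottomMeasure (RoughNeumann.roughProfile γ ε))
          (RoughNeumann.oscFlux g ε) :=
      add_nonneg (add_nonneg (Real.sqrt_nonneg _) (Real.sqrt_nonneg _)) (Real.sqrt_nonneg _)
    refine mul_le_mul_of_nonneg_right ?_ hnn
    have h1 : 1 / 2 ≤ √(1 + C) * √ε := by
      rw [← Real.sqrt_mul (by positivity)]
      exact Real.le_sqrt_of_sq_le (by linarith)
    calc 4 * (1 + L) ≤ 16 * (1 + L) ^ 2 * (1 / 2) := by nlinarith
      _ ≤ 16 * (1 + L) ^ 2 * (√(1 + C) * √ε) := by gcongr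
      _ = _ := by ring
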